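/- For a bounded open set $D$ in a finite-dimensional complex vector space let $A(D)$ be the algebra of continuous functions on $\overline D$ that are holomorphic on $D$. The Shilov boundary $\partial_s D$ is the smallest closed subset $S\subset\overline D$ such that for every $g\in A(D)$ the maximum of $|g|$ over $\overline D$ is attained on $S$. A domain is a nonempty connected open set. Let $\mathcal R_{II}=\{z\in\mathcal M_{2\times2}(\mathbb C): z=z^t,\ \|z\|<1\}$ ($\|\cdot\|$ the operator norm), regarded as a domain in the space of symmetric matrices, let $\mathcal U$ be the set of unitary symmetric $2\times2$ matrices, let $\Pi(z)=(z_{1,1},z_{2,2},\det z)$, and let $\mathbb E=\Pi(\mathcal R_{II})\subset\mathbb C^3$ be the tetrablock. For $n\in\mathbb N$ let $\sigma_n:\mathbb C^n\to\mathbb C^n$ be the map whose components are the elementary symmetric polynomials of degrees $1,\dots,n$, and let $\mathbb G_n=\sigma_n(\mathbb D^n)$ be the symmetrized polydisc, where $\mathbb D$ is the open unit disc. All the Shilov boundaries below exist, and the following holds. (1) Tetrablock: $\partial_s\mathcal R_{II}=\mathcal U$ and $\partial_s\mathbb E=\Pi(\partial_s\mathcal R_{II})=\Pi(\mathcal U)$.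 (2) Symmetrized polydisc: $\partial_s\mathbb D^n=\mathbb T^n$ and $\partial_s\mathbb G_n=\sigma_n(\partial_s\mathbb D^n)=\sigma_n(\mathbb T^n)$, where $\mathbb T$ is the unit circle. (3) The general class: if $D,G\subset\mathbb C^n$ are domains, $f:D\to G$ is a proper holomorphic mapping and $L$ is a domain relatively compact in $G$, then $\partial_s L=f(\partial_s(f^{-1}(L)))$. (4) The tetrablock and the symmetrized polydiscs are covered by (3). The map $(z_{1,1},z_{2,2},z_{1,2})\mapsto(z_{1,1},z_{2,2},z_{1,1}z_{2,2}-z_{1,2}^2)$ (that is, $\Pi$ on symmetric matrices, in coordinates) and the maps $\sigma_n$ are proper holomorphic mappings of $\mathbb C^3$, respectively $\mathbb C^n$, to itself; $\mathbb E$ and $\mathbb G_n$ are bounded domains; and the preimages of $\mathbb E$ and $\mathbb G_n$ are $\mathcal R_{II}$ (in these coordinates) and $\mathbb D^n$. -/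

import Mathlib

open scoped Matrix.Norms.L2Operator

/-- `S` is a closed subset of `closure D` on which the modulus of every function of the algebra
`A(D)` (continuous on `closure D`, holomorphic on `D`) reaches its supremum over `closure D`. -/
def IsClosedBoundary {V : Type*} [NormedAddCommGroup V] [NormedSpace ℂ V] (D S : Set V) : Prop :=
  IsClosed S ∧ S ⊆ closure D ∧
    ∀ g : V → ℂ, DiffContOnCl ℂ g D → ∀ x ∈ closure D, ∃ y ∈ S, ‖g x‖ ≤ ‖g y‖

/-- `S` is the Shilov boundary of `D`, i.e. the smallest closed boundary for `A(D)`. -/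
def IsShilovBoundary {V : Type*} [NormedAddCommGroup V] [NormedSpace ℂ V] (D S : Set V) : Prop :=
  IsLeast {S | IsClosedBoundary D S} S

/-- The Shilov boundary as a set: the intersection of all closed boundaries. Whenever a smallest
closed boundary exists, it is this set, see `IsShilovBoundary.eq`. -/
def shilovBoundary {V : Type*} [NormedAddCommGroup V] [NormedSpace ℂ V] (D : Set V) : Set V :=
  ⋂₀ {S | IsClosedBoundary D S}

theorem IsShilovBoundary.eq {V : Type*} [NormedAddCommGroup V] [NormedSpace ℂ V] {D S : Set V}
    (h : IsShilovBoundary D S) : shilovBoundary D = S :=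
  Set.Subset.antisymm (Set.sInter_subset_of_mem h.1) (Set.subset_sInter fun _ hT => h.2 hT)

/-- A domain: a nonempty connected open set. -/
def IsDomainSet {V : Type*} [TopologicalSpace V] (D : Set V) : Prop :=
  IsOpen D ∧ IsConnected D

/-- `f` restricts to a proper holomorphic map from `D` to `G`. -/
def IsProperHolomorphic {V W : Type*} [NormedAddCommGroup V] [NormedSpace ℂ V]
    [NormedAddCommGroup W] [NormedSpace ℂ W] (f : V → W) (D : Set V) (G : Set W) : Prop :=
  DifferentiableOn ℂ f D ∧ Set.MapsTo f D G ∧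
    ∀ C ⊆ G, IsCompact C → IsCompact (D ∩ f ⁻¹' C)

/-- `L` is relatively compact in `G`. -/
def RelCompactIn {V : Type*} [TopologicalSpace V] (L G : Set V) : Prop :=
  IsCompact (closure L) ∧ closure L ⊆ G

/-- The complex vector space of symmetric `2 × 2` matrices, normed by the operator norm. -/
def SymMat : Submodule ℂ (Matrix (Fin 2) (Fin 2) ℂ) where
  carrier := {z | z.transpose = z}
  add_mem' := by
    intro a b ha hb
    simp only [Set.mem_ofPred_eq] at ha hb ⊢
    rw [Matrix.transpose_add, ha, hb]
  zero_mem' := Matrix.transpose_zero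
  smul_mem' := by
    intro c a ha
    simp only [Set.mem_ofPred_eq] at ha ⊢
    rw [Matrix.transpose_smul, ha]

/-- The classical Cartan domain of the second type, a domain in the space of symmetric matrices
(the norm is the operator norm for the Euclidean norm of `ℂ²`). -/
def cartanII : Set SymMat := {z | ‖(z : Matrix (Fin 2) (Fin 2) ℂ)‖ < 1}

/-- The symmetric unitary matrices. -/
def symUnitary : Set SymMat :=
  {z | (z : Matrix (Fin 2) (Fin 2) ℂ) ∈ Matrix.unitaryGroup (Fin 2) ℂ}

/-- The map `z ↦ (z₁₁, z₂₂, det z)`. -/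
def tetraMap (z : Matrix (Fin 2) (Fin 2) ℂ) : Fin 3 → ℂ := ![z 0 0, z 1 1, z.det]

/-- The tetrablock. -/
def tetrablock : Set (Fin 3 → ℂ) := (fun z : SymMat => tetraMap z) '' cartanII

/-- The symmetrization map of `ℂⁿ`, given by the elementary symmetric polynomials. -/
def symMap (n : ℕ) (z : Fin n → ℂ) : Fin n → ℂ :=
  fun k => ∑ s ∈ Finset.powersetCard (k.val + 1) (Finset.univ : Finset (Fin n)), ∏ i ∈ s, z i

/-- The open unit polydisc. -/
def polydisc (n : ℕ) : Set (Fin n → ℂ) := {z | ∀ i, ‖z i‖ < 1}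

/-- The unit torus. -/
def torus (n : ℕ) : Set (Fin n → ℂ) := {z | ∀ i, ‖z i‖ = 1}

/-- The symmetrized polydisc. -/
def symPolydisc (n : ℕ) : Set (Fin n → ℂ) := symMap n '' polydisc n

/-! Write `Λ = D ∩ f⁻¹(L)`. A smallest closed boundary exists for every set with compact closure: if
every point where `|g|` is maximal is missed by some closed boundary, then finitely many small balls
around such points can be removed from the closure without losing the boundary property, which is
absurd.

The inclusion `∂ₛL ⊆ f(∂ₛΛ)` comes from `g ↦ g ∘ f` and the surjectivity of proper maps
(`IsClosedBoundary.image`). For the converse, `f⁻¹(∂ₛL)` has to be a closed boundary of `Λ`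
(`IsClosedBoundary.preimage`). If `|h| ≤ c` there but `|h(w)| > c` for some `w`, move `w` so that
`f(w)` is a regular value, choose an entire `p` equal to `1` at `w` and `0` at the rest of its
fiber, and push `p hᵏ` forward by summing over fibers. The sum lies in `A(L)`, so `|h(w)|ᵏ ≤ m B
cᵏ`, where `m` is the number of sheets and `B` bounds `p`. This fails for large `k`.

The bulk of the file shows that fiber sums are well defined and holomorphic. They are approximated
by `T(z) = ∫ h |J|² φ(f - z)` with `φ` an approximate identity. By the Piola identity (the field
`adj(f')v` is divergence free) the `∂̄`-derivative of `T` is the integral of a divergence, hence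
`0`. For `h = 1` the function `T` is real and holomorphic, so constant: this is the degree. At
regular values, dense by Sard, `T` tends to the fiber sum by change of variables; over critical
values the fiber with multiplicities is a limit of regular fibers. Perturbing `f` to `f + s·id`
shows that `f` is open and thus has noncritical points.

For the polydisc and the Cartan domain, the maximum principle on discs shows that `𝕋ⁿ` and `𝒰` are
closed boundaries, and explicit peak functions show that they are smallest. Both maps are proper on
the whole space and both images are saturated, so the general statement applies. -/

/-! ### Holomorphic maps of several variables: Taylor bounds, limits, smoothness, identity theorem.
-/

section SeveralComplexVariables

universe u

open Filter Topology Metric Set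

variable {E F : Type*} [NormedAddCommGroup E] [NormedSpace ℂ E]
  [NormedAddCommGroup F] [NormedSpace ℂ F]

/-- Second order Taylor estimate for a bounded holomorphic map on a ball. -/
theorem norm_sub_sub_fderiv_le_of_bounded {f : E → F} {c : E} {r M : ℝ} (hr : 0 < r)
    (hd : DifferentiableOn ℂ f (ball c r)) (hb : ∀ z ∈ ball c r, ‖f z‖ ≤ M) {w : E}
    (hw : w ∈ ball c r) :
    ‖fderiv ℂ f c‖ ≤ 2 * M / r ∧
      ‖f w - f c - fderiv ℂ f c (w - c)‖ ≤ 4 * M * (dist w c / r) ^ 2 := by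
  have hc : c ∈ ball c r := mem_ball_self hr
  have hD : ‖fderiv ℂ f c‖ ≤ 2 * M / r := by
    refine Complex.norm_fderiv_le_div_of_mapsTo_ball hd (fun z hz => ?_) hr
    rw [mem_closedBall, dist_eq_norm]
    linarith [norm_sub_le (f z) (f c), hb z hz, hb c hc]
  refine ⟨hD, ?_⟩
  have hfc : HasFDerivAt f (fderiv ℂ f c) c :=
    ((hd c hc).differentiableAt (ball_mem_nhds c hr)).hasFDerivAt
  -- Schwarz lemma of order `n + 1 = 2` for the first-order Taylor remainder, which is `o(‖z - c‖)`
  -- and bounded by `2M + 2M`.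
  have key := Complex.dist_le_mul_div_pow_of_mapsTo_ball_of_isLittleO
    (f := fun z => f z - f c - fderiv ℂ f c (z - c)) (c := c) (z := w) (R₁ := r) (R₂ := 4 * M)
    (n := 1) ?_ ?_ ?_ hw
  · simpa [dist_eq_norm] using key
  · exact (hd.sub_const _).sub
      ((fderiv ℂ f c).differentiable.comp (differentiable_id.sub_const c)).differentiableOn
  · intro z hz
    have h1 : ‖fderiv ℂ f c (z - c)‖ ≤ 2 * M := by
      have h2 : ‖z - c‖ ≤ r := by rw [← dist_eq_norm]; exact (mem_ball.1 hz).le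
      calc _ ≤ ‖fderiv ℂ f c‖ * ‖z - c‖ := (fderiv ℂ f c).le_opNorm _
        _ ≤ (2 * M / r) * r := by gcongr; exact (norm_nonneg _).trans hD
        _ = 2 * M := by field_simp
    simp only [mem_closedBall, dist_eq_norm, sub_self, map_zero, sub_zero]
    have := norm_sub_le (f z - f c) (fderiv ℂ f c (z - c))
    linarith [norm_sub_le (f z) (f c), hb z hz, hb c hc]
  · simpa [hasFDerivAt_iff_isLittleO] using (hasFDerivAt_iff_isLittleO.1 hfc).norm_right

/-- A pointwise limit of uniformly bounded holomorphic maps is holomorphic. -/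
theorem differentiableAt_of_tendsto_of_bounded [FiniteDimensional ℂ E] [FiniteDimensional ℂ F]
    {ι : Type*} {l : Filter ι} [l.NeBot] {T : ι → E → F} {N : E → F} {c : E} {r M : ℝ}
    (hr : 0 < r) (hd : ∀ᶠ i in l, DifferentiableOn ℂ (T i) (ball c r))
    (hb : ∀ᶠ i in l, ∀ z ∈ ball c r, ‖T i z‖ ≤ M)
    (hlim : ∀ z ∈ ball c r, Tendsto (fun i => T i z) l (𝓝 (N z))) :
    DifferentiableAt ℂ N c := by
  have hc : c ∈ ball c r := mem_ball_self hr
  have : ProperSpace (E →L[ℂ] F) := FiniteDimensional.proper ℂ _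
  -- By Cauchy's estimate the derivatives at `c` stay in a compact ball, so they converge along an
  -- ultrafilter. The quadratic remainder bound passes to the limit and identifies the limit as the
  -- derivative of `N`.
  set u : Ultrafilter ι := Ultrafilter.of l
  have hu : (u : Filter ι) ≤ l := Ultrafilter.of_le l
  have hbd : ∀ᶠ i in (u : Filter ι),
      fderiv ℂ (T i) c ∈ closedBall (0 : E →L[ℂ] F) (2 * M / r) := by
    filter_upwards [hu hd, hu hb] with i h1 h2
    rw [mem_closedBall_zero_iff]
    exact (norm_sub_sub_fderiv_le_of_bounded hr h1 h2 hc).1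
  obtain ⟨A, -, hA⟩ := (isCompact_closedBall (0 : E →L[ℂ] F) (2 * M / r)).ultrafilter_le_nhds
    (u.map fun i => fderiv ℂ (T i) c) (le_principal_iff.2 hbd)
  have hA' : Tendsto (fun i => fderiv ℂ (T i) c) u (𝓝 A) := hA
  have key : ∀ w ∈ ball c r, ‖N w - N c - A (w - c)‖ ≤ 4 * M * (dist w c / r) ^ 2 := by
    intro w hw
    have h1 : Tendsto (fun i => ‖T i w - T i c - fderiv ℂ (T i) c (w - c)‖) u
        (𝓝 ‖N w - N c - A (w - c)‖) :=
      ((((hlim w hw).mono_left hu).sub ((hlim c hc).mono_left hu)).sub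
        (((ContinuousLinearMap.apply ℂ F (w - c)).continuous.tendsto A).comp hA')).norm
    refine le_of_tendsto h1 ?_
    filter_upwards [hu hd, hu hb] with i h1 h2
    exact (norm_sub_sub_fderiv_le_of_bounded hr h1 h2 hw).2
  refine HasFDerivAt.differentiableAt (f' := A) (hasFDerivAt_iff_isLittleO.2 ?_)
  have h2 : (fun w => N w - N c - A (w - c)) =O[𝓝 c] fun w => ‖w - c‖ ^ 2 := by
    refine Asymptotics.IsBigO.of_bound (4 * M / r ^ 2) ?_
    filter_upwards [ball_mem_nhds c hr] with w hw
    refine (key w hw).trans (le_of_eq ?_)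
    rw [dist_eq_norm, norm_pow, norm_norm]
    ring
  refine h2.trans_isLittleO ?_
  have h3 := (Asymptotics.isLittleO_norm_pow_id (E' := E) one_lt_two).comp_tendsto
    (show Tendsto (fun w => w - c) (𝓝 c) (𝓝 0) by
      simpa using (show Continuous fun w : E => w - c by fun_prop).tendsto c)
  exact h3

/-- A bounded holomorphic map is Lipschitz on smaller balls. -/
theorem dist_le_of_bounded_holomorphic {f : E → F} {c : E} {r M : ℝ}
    (hd : DifferentiableOn ℂ f (ball c (2 * r))) (hb : ∀ z ∈ ball c (2 * r), ‖f z‖ ≤ M)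
    {x y : E} (hx : x ∈ ball c (r / 2)) (hy : y ∈ ball c (r / 2)) :
    dist (f x) (f y) ≤ 2 * M / r * dist x y := by
  have hr : 0 < r := by
    have := (dist_nonneg.trans_lt (mem_ball.1 hx)); linarith
  have hsub : ball y r ⊆ ball c (2 * r) :=
    ball_subset_ball' (by have := mem_ball.1 hy; linarith)
  refine Complex.dist_le_div_mul_dist_of_mapsTo_ball (hd.mono hsub) (fun z hz => ?_) ?_
  · rw [mem_closedBall, dist_eq_norm]
    linarith [norm_sub_le (f z) (f y), hb z (hsub hz), hb y (hsub (mem_ball_self hr))]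
  · rw [mem_ball]
    have := dist_triangle_right x y c
    linarith [mem_ball.1 hx, mem_ball.1 hy]

/-- A family of linear maps on a finite-dimensional space is differentiable if all its
evaluations are. -/
theorem differentiableOn_of_clm_apply {D : Type*} [NormedAddCommGroup D] [NormedSpace ℂ D]
    [FiniteDimensional ℂ E] {f : D → E →L[ℂ] F} {s : Set D}
    (h : ∀ v, DifferentiableOn ℂ (fun x => f x v) s) : DifferentiableOn ℂ f s := by
  let d := Module.finrank ℂ E
  have hd : d = Module.finrank ℂ (Fin d → ℂ) := (Module.finrank_fin_fun ℂ).symm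
  let e₁ := ContinuousLinearEquiv.ofFinrankEq hd
  let e₂ := (e₁.arrowCongr (1 : F ≃L[ℂ] F)).trans (ContinuousLinearEquiv.piRing (Fin d))
  rw [← Function.id_comp f, ← e₂.symm_comp_self]
  exact e₂.symm.differentiable.comp_differentiableOn (differentiableOn_pi.2 fun i => h _)

/-- Derivatives of holomorphic maps are holomorphic. -/
theorem DifferentiableOn.fderiv_complex [FiniteDimensional ℂ E] [FiniteDimensional ℂ F]
    {f : E → F} {U : Set E} (hU : IsOpen U) (hf : DifferentiableOn ℂ f U) :
    DifferentiableOn ℂ (fderiv ℂ f) U := by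
  refine differentiableOn_of_clm_apply fun v c hc => ?_
  refine DifferentiableAt.differentiableWithinAt ?_
  have hcont : ContinuousAt f c := (hf c hc).continuousWithinAt.continuousAt (hU.mem_nhds hc)
  obtain ⟨ρ, hρ, hρU⟩ := Metric.mem_nhds_iff.1 (Filter.inter_mem (hU.mem_nhds hc)
    (hcont.preimage_mem_nhds (ball_mem_nhds (f c) one_pos)))
  have hball : ∀ z ∈ ball c ρ, z ∈ U ∧ ‖f z‖ ≤ ‖f c‖ + 1 := fun z hz => by
    refine ⟨(hρU hz).1, ?_⟩
    have h1 := mem_ball.1 (mem_preimage.1 (hρU hz).2)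
    rw [dist_eq_norm] at h1
    linarith [norm_le_norm_add_norm_sub' (f z) (f c)]
  set r : ℝ := ρ / 4 with hr
  have hrpos : 0 < r := by positivity
  have e2 : ∀ z ∈ ball c (2 * r), z ∈ ball c ρ := fun z hz =>
    ball_subset_ball (by rw [hr]; linarith) hz
  set M : ℝ := ‖f c‖ + 1
  have hM : 0 ≤ M := by positivity
  -- The derivative in direction `v` is the limit of difference quotients, which are holomorphic in
  -- `z` and, by the Lipschitz bound for `f`, uniformly bounded.
  refine differentiableAt_of_tendsto_of_bounded (l := 𝓝[≠] (0 : ℂ))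
    (T := fun s z => s⁻¹ • (f (z + s • v) - f z)) (r := r / 4) (M := 2 * M / r * ‖v‖)
    (by positivity) ?_ ?_ ?_
  · have hs : ∀ᶠ s in 𝓝[≠] (0 : ℂ), ‖s • v‖ < r / 4 := by
      have : Tendsto (fun s : ℂ => ‖s • v‖) (𝓝 0) (𝓝 0) := by
        have h := (show Continuous fun s : ℂ => ‖s • v‖ by fun_prop).tendsto 0
        simpa using h
      exact (this.mono_left nhdsWithin_le_nhds).eventually_lt_const (by positivity)
    filter_upwards [hs] with s hs
    refine DifferentiableOn.const_smul (DifferentiableOn.sub ?_ ?_) _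
    · refine hf.comp (differentiableOn_id.add_const _) fun z hz => ?_
      refine (hball _ ?_).1
      rw [mem_ball, dist_eq_norm] at hz ⊢
      calc ‖z + s • v - c‖ = ‖(z - c) + s • v‖ := by congr 1; abel
        _ ≤ ‖z - c‖ + ‖s • v‖ := norm_add_le _ _
        _ < ρ := by linarith
    · exact hf.mono fun z hz => (hball z (ball_subset_ball (by linarith) hz)).1
  · have hs : ∀ᶠ s in 𝓝[≠] (0 : ℂ), ‖s • v‖ < r / 4 := by
      have : Tendsto (fun s : ℂ => ‖s • v‖) (𝓝 0) (𝓝 0) := by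
        have h := (show Continuous fun s : ℂ => ‖s • v‖ by fun_prop).tendsto 0
        simpa using h
      exact (this.mono_left nhdsWithin_le_nhds).eventually_lt_const (by positivity)
    filter_upwards [hs, self_mem_nhdsWithin] with s hs hs0 z hz
    have h1 : z ∈ ball c (r / 2) := ball_subset_ball (by linarith) hz
    have h2 : z + s • v ∈ ball c (r / 2) := by
      rw [mem_ball, dist_eq_norm] at hz ⊢
      calc ‖z + s • v - c‖ = ‖(z - c) + s • v‖ := by congr 1; abel
        _ ≤ ‖z - c‖ + ‖s • v‖ := norm_add_le _ _
        _ < r / 2 := by linarith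
    have h3 := dist_le_of_bounded_holomorphic (f := f) (c := c) (r := r) (M := M)
      (hf.mono fun z hz => (hball z (e2 z hz)).1) (fun z hz => (hball z (e2 z hz)).2) h2 h1
    rw [dist_eq_norm, dist_eq_norm, add_sub_cancel_left, norm_smul] at h3
    rw [norm_smul, norm_inv]
    have h4 : 0 < ‖s‖ := norm_pos_iff.2 hs0
    rw [inv_mul_le_iff₀ h4]
    linarith
  · intro z hz
    have hzU := (hball z (ball_subset_ball (by linarith) hz)).1
    have h1 := ((hf z hzU).differentiableAt (hU.mem_nhds hzU)).hasFDerivAt.hasLineDerivAt v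
    have h2 := hasDerivAt_iff_tendsto_slope.1 h1
    refine h2.congr fun s => ?_
    simp [slope_def_module]

/-- Holomorphic maps are smooth. -/
theorem DifferentiableOn.contDiffOn_complex {E F : Type u} [NormedAddCommGroup E]
    [NormedSpace ℂ E] [NormedAddCommGroup F] [NormedSpace ℂ F]
    [FiniteDimensional ℂ E] [FiniteDimensional ℂ F]
    {f : E → F} {U : Set E} (hU : IsOpen U) (hf : DifferentiableOn ℂ f U) (k : ℕ) :
    ContDiffOn ℂ k f U := by
  induction k generalizing F with
  | zero => simpa using hf.continuousOn
  | succ k ih =>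
    rw [show ((k + 1 : ℕ) : WithTop ℕ∞) = (k : WithTop ℕ∞) + 1 by simp,
      contDiffOn_succ_iff_fderiv_of_isOpen hU]
    exact ⟨hf, by simp, ih (hf.fderiv_complex hU)⟩

/-- Identity theorem: a holomorphic function on a connected open set which vanishes on a nonempty
open subset vanishes identically. -/
theorem eqOn_zero_of_holomorphic {f : E → ℂ} {U : Set E}
    (hU : IsOpen U) (hUc : IsPreconnected U) (hf : DifferentiableOn ℂ f U) {c : E} (hc : c ∈ U)
    (h0 : f =ᶠ[𝓝 c] 0) : ∀ z ∈ U, f z = 0 := by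
  suffices h : U ⊆ interior {z | f z = 0} from fun z hz => interior_subset (s := {z | f z = 0}) (h hz)
  refine hUc.subset_of_closure_inter_subset isOpen_interior
    ⟨c, hc, mem_interior_iff_mem_nhds.2 h0⟩ ?_
  rintro w ⟨hw, hwU⟩
  obtain ⟨r, hr, hrU⟩ := Metric.isOpen_iff.1 hU w hwU
  obtain ⟨p, hp, hpw⟩ := Metric.mem_closure_iff.1 hw r hr
  refine mem_interior.2 ⟨ball w r, fun z hz => ?_, isOpen_ball, mem_ball_self hr⟩
  have hpb : p ∈ ball w r := by rwa [mem_ball, dist_comm]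
  -- The complex line from `p`, an interior point of the zero set, to `z` meets the ball in a convex
  -- set, where the one-variable identity theorem applies.
  set L : ℂ → E := fun ζ => p + ζ • (z - p)
  have hL : Differentiable ℂ L := by fun_prop
  have hLc : Continuous L := hL.continuous
  set V : Set ℂ := L ⁻¹' ball w r
  have hVo : IsOpen V := isOpen_ball.preimage hLc
  have hVc : Convex ℝ V := by
    intro a ha b hb s t hs ht hst
    have : L (s • a + t • b) = s • L a + t • L b := by
      have h1 : (p : E) = (s + t) • p := by rw [hst, one_smul]
      simp only [L, smul_add, add_smul, smul_assoc]
      nth_rewrite 1 [h1]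
      rw [add_smul]; abel
    change L (s • a + t • b) ∈ ball w r
    rw [this]
    exact convex_ball w r ha hb hs ht hst
  have hVa : AnalyticOnNhd ℂ (f ∘ L) V :=
    ((hf.mono hrU).comp hL.differentiableOn fun ζ hζ => hζ).analyticOnNhd hVo
  have h0V : (0 : ℂ) ∈ V := by simpa [V, L] using hpb
  have h1V : (1 : ℂ) ∈ V := by simpa [V, L] using hz
  have hev : f ∘ L =ᶠ[𝓝 0] 0 := by
    have : L 0 = p := by simp [L]
    exact hLc.continuousAt.eventually (p := fun y => f y = 0)
      (by rw [this]; exact mem_interior_iff_mem_nhds.1 hp)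
  have := hVa.eqOn_zero_of_preconnected_of_eventuallyEq_zero hVc.isPreconnected h0V hev h1V
  simpa [L] using this

end SeveralComplexVariables

/-! ### The Piola identity and the weak equation `∂̄ = 0` for push-forwards. -/

noncomputable section Piola

open Filter Topology Metric Set MeasureTheory Complex
open scoped ComplexConjugate

variable {n : ℕ}

/-- The determinant as a continuous multilinear function of the rows. -/
def detCML (n : ℕ) : ContinuousMultilinearMap ℂ (fun _ : Fin n => Fin n → ℂ) ℂ where
  toMultilinearMap := (Matrix.detRowAlternating : (Fin n → ℂ) [⋀^Fin n]→ₗ[ℂ] ℂ).toMultilinearMap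
  cont := by
    change Continuous fun M : Fin n → Fin n → ℂ => Matrix.det (Matrix.of M)
    exact Continuous.matrix_det (continuous_id (X := Fin n → Fin n → ℂ))

theorem detCML_apply (M : Fin n → Fin n → ℂ) : detCML n M = Matrix.det (Matrix.of M) := rfl

/-- The sign that makes the second-derivative terms cancel in pairs in the Piola identity. -/
theorem detCML_update_update_swap (M : Fin n → Fin n → ℂ) {k i : Fin n} (hki : k ≠ i)
    (v s : Fin n → ℂ) :
    detCML n (Function.update (Function.update M k v) i s) =
      -detCML n (Function.update (Function.update M i v) k s) := by
  have h := (Matrix.detRowAlternating : (Fin n → ℂ) [⋀^Fin n]→ₗ[ℂ] ℂ).map_swap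
    (Function.update (Function.update M i v) k s) hki
  have e : (Function.update (Function.update M i v) k s) ∘ Equiv.swap k i =
      Function.update (Function.update M k v) i s := by
    funext j
    by_cases h1 : j = k
    · subst h1; simp [hki, hki.symm]
    · by_cases h2 : j = i
      · subst h2; simp
      · simp [h1, h2, Equiv.swap_apply_of_ne_of_ne]
  rw [e] at h
  exact h

/-- The complex Jacobian determinant. -/
def jacDet (f : (Fin n → ℂ) → (Fin n → ℂ)) (w : Fin n → ℂ) : ℂ := (fderiv ℂ f w).det

/-- The partial derivatives of `f`. -/
def jacRows (f : (Fin n → ℂ) → (Fin n → ℂ)) (w : Fin n → ℂ) : Fin n → Fin n → ℂ :=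
  fun l => fderiv ℂ f w (Pi.single l 1)

/-- The vector field `adj(f') v`, given by Cramer's rule. -/
def cramerField (f : (Fin n → ℂ) → (Fin n → ℂ)) (v w : Fin n → ℂ) : Fin n → ℂ :=
  fun k => detCML n (Function.update (jacRows f w) k v)

theorem jacDet_eq (f : (Fin n → ℂ) → (Fin n → ℂ)) (w : Fin n → ℂ) :
    jacDet f w = detCML n (jacRows f w) := by
  rw [detCML_apply, ← Matrix.det_transpose, jacDet, ContinuousLinearMap.det,
    ← LinearMap.det_toMatrix']
  congr 1

/-- Cramer's rule `A adj(A) = det(A)`: the field lifts the constant vector `v`, up to the factor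
`J`. -/
theorem fderiv_cramerField (f : (Fin n → ℂ) → (Fin n → ℂ)) (v w : Fin n → ℂ) :
    fderiv ℂ f w (cramerField f v w) = jacDet f w • v := by
  have h := Matrix.mulVec_cramer (Matrix.of (jacRows f w)).transpose v
  rw [Matrix.det_transpose, ← detCML_apply, ← jacDet_eq] at h
  rw [← h]
  have e : Matrix.cramer (Matrix.of (jacRows f w)).transpose v = cramerField f v w := by
    funext k
    rw [Matrix.cramer_transpose_apply]
    rfl
  rw [e]
  conv_lhs => rw [pi_eq_sum_univ' (cramerField f v w)]
  rw [map_sum]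
  funext i
  simp [Matrix.mulVec, dotProduct, jacRows, mul_comm]

variable {f : (Fin n → ℂ) → (Fin n → ℂ)} {U : Set (Fin n → ℂ)}

theorem differentiableOn_jacRows (hU : IsOpen U) (hf : DifferentiableOn ℂ f U) (l : Fin n) :
    DifferentiableOn ℂ (fun w => jacRows f w l) U :=
  (hf.fderiv_complex hU).clm_apply (differentiableOn_const _)

theorem differentiableOn_jacDet (hU : IsOpen U) (hf : DifferentiableOn ℂ f U) :
    DifferentiableOn ℂ (jacDet f) U := by
  have h : jacDet f = fun w => detCML n fun l => jacRows f w l := by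
    funext w; exact jacDet_eq f w
  rw [h]
  intro w hw
  exact (HasFDerivAt.multilinear_comp (detCML n) fun l =>
    (((differentiableOn_jacRows hU hf l) w hw).differentiableAt
      (hU.mem_nhds hw)).hasFDerivAt).differentiableAt.differentiableWithinAt

/-- The determinant is multilinear in the rows. Row `k` is the constant `v`, so its term vanishes.
-/
theorem hasFDerivAt_cramerField (hU : IsOpen U) (hf : DifferentiableOn ℂ f U) {w : Fin n → ℂ}
    (hw : w ∈ U) (v : Fin n → ℂ) (k : Fin n) :
    HasFDerivAt (fun w => cramerField f v w k)
      (∑ i, (detCML n).toContinuousLinearMap (Function.update (jacRows f w) k v) i ∘SL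
        (if i = k then 0 else fderiv ℂ (fun w => jacRows f w i) w)) w := by
  have h := HasFDerivAt.multilinear_comp (detCML n) (x := w)
    (g := fun i w => Function.update (jacRows f w) k v i)
    (g' := fun i => if i = k then 0 else fderiv ℂ (fun w => jacRows f w i) w) ?_
  · exact h
  · intro i
    by_cases hi : i = k
    · subst hi
      simpa using hasFDerivAt_const (𝕜 := ℂ) v w
    · simpa [hi] using (((differentiableOn_jacRows hU hf i) w hw).differentiableAt
        (hU.mem_nhds hw)).hasFDerivAt

theorem differentiableOn_cramerField (hU : IsOpen U) (hf : DifferentiableOn ℂ f U)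
    (v : Fin n → ℂ) (k : Fin n) : DifferentiableOn ℂ (fun w => cramerField f v w k) U :=
  fun _ hw => (hasFDerivAt_cramerField hU hf hw v k).differentiableAt.differentiableWithinAt

/-- The Piola identity: `adj(f') v` is divergence free. -/
theorem sum_fderiv_cramerField (hU : IsOpen U) (hf : DifferentiableOn ℂ f U) {w : Fin n → ℂ}
    (hw : w ∈ U) (v : Fin n → ℂ) :
    ∑ k, fderiv ℂ (fun w => cramerField f v w k) w (Pi.single k 1) = 0 := by
  set H := fderiv ℂ (fderiv ℂ f) w
  have hH : HasFDerivAt (fderiv ℂ f) H w :=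
    ((hf.fderiv_complex hU w hw).differentiableAt (hU.mem_nhds hw)).hasFDerivAt
  have hsymm : ∀ a b, H a b = H b a := second_derivative_symmetric_of_eventually
    (Filter.eventually_of_mem (hU.mem_nhds hw) fun y hy =>
      ((hf y hy).differentiableAt (hU.mem_nhds hy)).hasFDerivAt) hH
  have hrow : ∀ i a, fderiv ℂ (fun w => jacRows f w i) w a = H a (Pi.single i 1) := by
    intro i a
    have := (hH.clm_apply (hasFDerivAt_const (Pi.single i (1 : ℂ) : Fin n → ℂ) w)).fderiv
    unfold jacRows
    rw [this]
    simp
  -- `a k i` is the contribution of row `i` to the derivative of component `k` along the `k`-th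
  -- basis vector. Symmetry of second derivatives and alternation of the determinant make `a`
  -- antisymmetric, so its double sum vanishes.
  set a : Fin n → Fin n → ℂ := fun k i => if i = k then 0 else
    detCML n (Function.update (Function.update (jacRows f w) k v) i
      (H (Pi.single k 1) (Pi.single i 1))) with ha
  have hterm : ∀ k, fderiv ℂ (fun w => cramerField f v w k) w (Pi.single k 1) = ∑ i, a k i := by
    intro k
    rw [(hasFDerivAt_cramerField hU hf hw v k).fderiv, sum_apply]
    refine Finset.sum_congr rfl fun i _ => ?_
    by_cases hi : i = k
    · simp [hi, ha]
    · simp only [ha, hi, if_false, ContinuousLinearMap.comp_apply, hrow]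
      rfl
  have hanti : ∀ k i, a k i = -a i k := by
    intro k i
    by_cases hi : i = k
    · simp [ha, hi]
    · simp only [ha, hi, Ne.symm hi, if_false]
      rw [detCML_update_update_swap _ (Ne.symm hi), hsymm]
  have hS : ∑ k, ∑ i, a k i = -∑ k, ∑ i, a k i := by
    conv_lhs => rw [Finset.sum_comm]
    rw [← Finset.sum_neg_distrib]
    refine Finset.sum_congr rfl fun i _ => ?_
    rw [← Finset.sum_neg_distrib]
    exact Finset.sum_congr rfl fun k _ => hanti k i
  simp_rw [hterm]
  exact self_eq_neg.1 hS

/-- Twice the `∂̄`-part of a real-linear functional. -/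
def dbarPart (A : (Fin n → ℂ) →L[ℝ] ℂ) (v : Fin n → ℂ) : ℂ := A v + I * A (I • v)

theorem dbarPart_smul (A : (Fin n → ℂ) →L[ℝ] ℂ) (c : ℂ) (v : Fin n → ℂ) :
    dbarPart A (c • v) = conj c * dbarPart A v := by
  have h1 : c • v = c.re • v + c.im • (I • v) := by
    conv_lhs => rw [← Complex.re_add_im c]
    rw [add_smul, mul_smul]
    rfl
  have h2 : I • c • v = c.re • (I • v) - c.im • v := by
    ext i
    simp only [Pi.smul_apply, Pi.sub_apply, smul_eq_mul, Complex.real_smul]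
    conv_lhs => rw [← Complex.re_add_im c]
    linear_combination (c.im * v i) * I_mul_I
  have hc : conj c = c.re - c.im * I := by
    apply Complex.ext <;> simp
  have e1 : A (c • v) = c.re * A v + c.im * A (I • v) := by
    rw [h1, map_add, A.map_smul, A.map_smul, Complex.real_smul, Complex.real_smul]
  have e2 : A (I • c • v) = c.re * A (I • v) - c.im * A v := by
    rw [h2, map_sub, A.map_smul, A.map_smul, Complex.real_smul, Complex.real_smul]
  rw [dbarPart, dbarPart, e1, e2, hc]
  linear_combination (c.im * A (I • v)) * I_mul_I

theorem dbarPart_add (A : (Fin n → ℂ) →L[ℝ] ℂ) (v w : Fin n → ℂ) :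
    dbarPart A (v + w) = dbarPart A v + dbarPart A w := by
  simp only [dbarPart, smul_add, map_add]; ring

theorem dbarPart_sum (A : (Fin n → ℂ) →L[ℝ] ℂ) (c : Fin n → ℂ) :
    dbarPart A c = ∑ k, conj (c k) * dbarPart A (Pi.single k 1) := by
  let φ : (Fin n → ℂ) →+ ℂ :=
    { toFun := dbarPart A
      map_zero' := by simp [dbarPart]
      map_add' := dbarPart_add A }
  have h : φ c = ∑ k, φ (c k • Pi.single k 1) := by
    conv_lhs => rw [pi_eq_sum_univ' c]
    rw [map_sum]
  refine h.trans (Finset.sum_congr rfl fun k _ => ?_)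
  exact dbarPart_smul A _ _

theorem integral_fderiv_eq_zero_of_hasCompactSupport {p : (Fin n → ℂ) → ℂ}
    (hp : ContDiff ℝ 1 p) (hc : HasCompactSupport p) (v : Fin n → ℂ) :
    ∫ w, fderiv ℝ p w v = 0 := by
  have h1 : Integrable (fun w => fderiv ℝ p w v) :=
    (((hp.continuous_fderiv one_ne_zero).clm_apply continuous_const)).integrable_of_hasCompactSupport
      (hc.fderiv_apply (𝕜 := ℝ) v)
  have h2 : Integrable p := hp.continuous.integrable_of_hasCompactSupport hc
  have := integral_mul_fderiv_eq_neg_fderiv_mul_of_integrable (μ := volume)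
    (f := fun _ : Fin n → ℂ => (1 : ℂ)) (g := p) (v := v) (by simp) (by simpa using h1)
    (by simpa using h2) (fun x _ => by fun_prop)
    (fun x _ => hp.differentiable one_ne_zero x)
  simpa using this

/-- The function `∂̄φ` in the direction `v`, up to the factor `2`. -/
def dbar (φ : (Fin n → ℂ) → ℂ) (z v : Fin n → ℂ) : ℂ := dbarPart (fderiv ℝ φ z) v

theorem dbarPart_restrictScalars (A : (Fin n → ℂ) →L[ℂ] ℂ) (v : Fin n → ℂ) :
    dbarPart (A.restrictScalars ℝ) v = 0 := by
  simp only [dbarPart, ContinuousLinearMap.coe_restrictScalars', map_smul, smul_eq_mul]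
  linear_combination A v * I_mul_I

/-- Product rule with `∂̄H = 0` and `∂̄(conj X) = conj(∂X)`; the `2` is the normalisation of
`dbarPart`. -/
theorem dbar_mul_holomorphic_mul_conj {u H X : (Fin n → ℂ) → ℂ} {w : Fin n → ℂ}
    (hu : DifferentiableAt ℝ u w) (hH : DifferentiableAt ℂ H w) (hX : DifferentiableAt ℂ X w)
    (v : Fin n → ℂ) :
    dbar (fun w => u w * (H w * conj (X w))) w v =
      H w * conj (X w) * dbar u w v + 2 * u w * H w * conj (fderiv ℂ X w v) := by
  have h1 := hu.hasFDerivAt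
  have h2 := hH.hasFDerivAt.restrictScalars ℝ
  have h3 : HasFDerivAt (fun w => conj (X w))
      ((Complex.conjCLE : ℂ →L[ℝ] ℂ).comp ((fderiv ℂ X w).restrictScalars ℝ)) w :=
    (Complex.conjCLE : ℂ →L[ℝ] ℂ).hasFDerivAt.comp w (hX.hasFDerivAt.restrictScalars ℝ)
  have h4 : HasFDerivAt (fun w => u w * (H w * conj (X w))) _ w := h1.mul (h2.mul h3)
  rw [dbar, h4.fderiv]
  have h5 := dbarPart_restrictScalars (fderiv ℂ H w) v
  simp only [dbar, dbarPart, add_apply, smul_apply,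
    ContinuousLinearMap.comp_apply, ContinuousLinearMap.coe_restrictScalars', map_smul,
    smul_eq_mul, ContinuousLinearEquiv.coe_coe, Complex.conjCLE_apply, map_mul, conj_I] at h5 ⊢
  linear_combination (u w * conj (X w)) * h5 -
    u w * H w * conj (fderiv ℂ X w v) * I_mul_I

theorem dbar_comp {φ : (Fin n → ℂ) → ℂ} {w : Fin n → ℂ} (hφ : DifferentiableAt ℝ φ (f w))
    (hf : DifferentiableAt ℂ f w) (v : Fin n → ℂ) :
    dbar (fun w => φ (f w)) w v = dbar φ (f w) (fderiv ℂ f w v) := by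
  have h := hφ.hasFDerivAt.comp w (hf.hasFDerivAt.restrictScalars ℝ)
  rw [dbar, show (fun w => φ (f w)) = φ ∘ f from rfl, h.fderiv]
  simp [dbar, dbarPart]

/-- The weak form of the holomorphy of the push-forward of a holomorphic function. -/
theorem integral_mul_dbar_comp_eq_zero {h φ : (Fin n → ℂ) → ℂ} {K : Set (Fin n → ℂ)}
    (hU : IsOpen U) (hf : DifferentiableOn ℂ f U) (hh : DifferentiableOn ℂ h U)
    (hφ : ContDiff ℝ 1 φ) (hK : IsCompact K) (hKU : K ⊆ U)
    (hsupp : ∀ w ∈ U, w ∉ K → φ (f w) = 0) (v : Fin n → ℂ) :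
    ∫ w in U, h w * (jacDet f w * conj (jacDet f w)) * dbar φ (f w) v = 0 := by
  classical
  set H : (Fin n → ℂ) → ℂ := fun w => h w * jacDet f w with hHdef
  have hH : DifferentiableOn ℂ H U := hh.mul (differentiableOn_jacDet hU hf)
  -- With `X = adj(f')v`, the integrand is `∑ₖ ∂̄ₖ(φ∘f · H · conj Xₖ)`: `H` is holomorphic and `∑ₖ
  -- ∂̄ₖ(conj Xₖ)` is the conjugate of the divergence of `X`, which is zero. The products extend by
  -- zero to compactly supported `C¹` functions, so the integral vanishes.
  set q : Fin n → (Fin n → ℂ) → ℂ := fun k w =>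
    φ (f w) * (H w * conj (cramerField f v w k)) with hq
  set p : Fin n → (Fin n → ℂ) → ℂ := fun k => U.indicator (q k) with hp
  have hpU : ∀ k, ∀ w ∈ U, p k =ᶠ[𝓝 w] q k := fun k w hw => by
    filter_upwards [hU.mem_nhds hw] with y hy
    exact indicator_of_mem hy _
  have hpK : ∀ k, ∀ w ∉ K, p k w = 0 := fun k w hw => by
    by_cases hwU : w ∈ U
    · simp [hp, hq, hwU, hsupp w hwU hw]
    · simp [hp, hwU]
  have hp0 : ∀ k, ∀ w ∉ U, p k =ᶠ[𝓝 w] fun _ => 0 := fun k w hw => by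
    filter_upwards [hK.isClosed.isOpen_compl.mem_nhds fun hwK => hw (hKU hwK)] with y hy
    exact hpK k y hy
  have hcd : ∀ k, ContDiff ℝ 1 (p k) := fun k => contDiff_iff_contDiffAt.2 fun w => by
    by_cases hw : w ∈ U
    · refine ContDiffAt.congr_of_eventuallyEq ?_ (hpU k w hw)
      have hnh := hU.mem_nhds hw
      have c1 : ContDiffAt ℝ 1 f w :=
        ((hf.contDiffOn_complex hU 1).restrict_scalars ℝ).contDiffAt hnh
      have c2 : ContDiffAt ℝ 1 H w :=
        ((hH.contDiffOn_complex hU 1).restrict_scalars ℝ).contDiffAt hnh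
      have c3 : ContDiffAt ℝ 1 (fun w => cramerField f v w k) w :=
        (((differentiableOn_cramerField hU hf v k).contDiffOn_complex hU 1).restrict_scalars
          ℝ).contDiffAt hnh
      exact (hφ.contDiffAt.comp w c1).mul
        (c2.mul ((Complex.conjCLE : ℂ →L[ℝ] ℂ).contDiff.contDiffAt.comp w c3))
    · exact contDiffAt_const.congr_of_eventuallyEq (hp0 k w hw)
  have hcs : ∀ k, HasCompactSupport (p k) := fun k => HasCompactSupport.intro hK (hpK k)
  have hint : ∀ k a, Integrable (fun w => fderiv ℝ (p k) w a) := fun k a =>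
    ((((hcd k).continuous_fderiv one_ne_zero).clm_apply
      continuous_const)).integrable_of_hasCompactSupport ((hcs k).fderiv_apply (𝕜 := ℝ) a)
  have hzero : ∫ w, ∑ k, dbar (p k) w (Pi.single k 1) = 0 := by
    rw [integral_finsetSum]
    · refine Finset.sum_eq_zero fun k _ => ?_
      simp only [dbar, dbarPart]
      rw [integral_add (hint _ _) ((hint _ _).const_mul _), integral_const_mul,
        integral_fderiv_eq_zero_of_hasCompactSupport (hcd k) (hcs k),
        integral_fderiv_eq_zero_of_hasCompactSupport (hcd k) (hcs k)]
      simp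
    · intro k _
      exact (hint _ _).add ((hint _ _).const_mul _)
  rw [← hzero, ← setIntegral_eq_integral_of_forall_compl_eq_zero (s := U)
    (f := fun w => ∑ k, dbar (p k) w (Pi.single k 1))]
  · refine setIntegral_congr_fun hU.measurableSet fun w hw => ?_
    have hnh := hU.mem_nhds hw
    have hfw := (hf w hw).differentiableAt hnh
    have hterm : ∀ k, dbar (p k) w (Pi.single k 1) =
        H w * (conj (cramerField f v w k) *
          dbarPart (fderiv ℝ (fun w => φ (f w)) w) (Pi.single k 1)) +
        2 * φ (f w) * H w *
          conj (fderiv ℂ (fun w => cramerField f v w k) w (Pi.single k 1)) := by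
      intro k
      rw [dbar, (hpU k w hw).fderiv_eq]
      refine (dbar_mul_holomorphic_mul_conj (u := fun w => φ (f w)) (H := H)
        (X := fun w => cramerField f v w k) ?_ ((hH w hw).differentiableAt hnh)
        ((differentiableOn_cramerField hU hf v k w hw).differentiableAt hnh) _).trans ?_
      · exact (hφ.differentiable one_ne_zero _).comp w (hfw.restrictScalars ℝ)
      · rw [dbar]; ring
    simp only [hterm, Finset.sum_add_distrib, ← Finset.mul_sum, ← map_sum,
      sum_fderiv_cramerField hU hf hw v, ← dbarPart_sum]
    -- `f'X = J v` and conjugate-linearity of `dbarPart` produce the factor `conj J`.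
    have hd := dbar_comp (hφ.differentiable one_ne_zero (f w)) hfw (cramerField f v w)
    rw [fderiv_cramerField, dbar, dbar, dbarPart_smul] at hd
    rw [hd, dbar, hHdef]
    simp only [map_zero]
    ring
  · intro w hw
    refine Finset.sum_eq_zero fun k _ => ?_
    rw [dbar, (hp0 k w hw).fderiv_eq]
    simp [dbarPart]

end Piola

/-! ### Smoothed traces: holomorphy, and convergence at regular values. -/

noncomputable section SmoothTrace

open Filter Topology Metric Set MeasureTheory Complex
open scoped ComplexConjugate

variable {n : ℕ} {f : (Fin n → ℂ) → (Fin n → ℂ)} {U : Set (Fin n → ℂ)} {h : (Fin n → ℂ) → ℂ}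

/-- The push-forward of `h` under `f`, smoothened by the kernel `φ`. -/
def smoothTrace (f : (Fin n → ℂ) → (Fin n → ℂ)) (U : Set (Fin n → ℂ)) (h φ : (Fin n → ℂ) → ℂ)
    (z : Fin n → ℂ) : ℂ :=
  ∫ w in U, h w * (jacDet f w * conj (jacDet f w)) * φ (f w - z)

/-- The Cauchy–Riemann equations `A(Iv) = I A(v)`; used to upgrade a real derivative to a complex
one. -/
theorem map_complex_smul_of_dbarPart_eq_zero {A : (Fin n → ℂ) →L[ℝ] ℂ}
    (hA : ∀ v, dbarPart A v = 0) (c : ℂ) (v : Fin n → ℂ) : A (c • v) = c * A v := by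
  have h1 : c • v = c.re • v + c.im • (I • v) := by
    conv_lhs => rw [← Complex.re_add_im c]
    rw [add_smul, mul_smul]
    rfl
  have h2 := hA v
  rw [dbarPart] at h2
  rw [h1, map_add, A.map_smul, A.map_smul, Complex.real_smul, Complex.real_smul]
  conv_rhs => rw [← Complex.re_add_im c]
  linear_combination (-I * c.im) * h2 + c.im * A (I • v) * I_mul_I

/-- The smoothened push-forward of a holomorphic function is holomorphic. -/
theorem differentiableOn_smoothTrace (hU : IsOpen U) (hf : DifferentiableOn ℂ f U)
    (hh : DifferentiableOn ℂ h U) {φ : (Fin n → ℂ) → ℂ} (hφ : ContDiff ℝ 1 φ)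
    (hφc : HasCompactSupport φ) {K B : Set (Fin n → ℂ)} (hK : IsCompact K) (hKU : K ⊆ U)
    (hB : IsOpen B) (hsupp : ∀ z ∈ B, ∀ w ∈ U, f w - z ∈ tsupport φ → w ∈ K) :
    DifferentiableOn ℂ (smoothTrace f U h φ) B := by
  intro z hz
  set g : (Fin n → ℂ) → ℂ := fun w => h w * (jacDet f w * conj (jacDet f w)) with hg
  have hJ := (differentiableOn_jacDet hU hf).continuousOn
  have hgc : ContinuousOn g K := (hh.continuousOn.mul
    (hJ.mul (Complex.continuous_conj.comp_continuousOn hJ))).mono hKU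
  have hfc : ContinuousOn f K := hf.continuousOn.mono hKU
  obtain ⟨C₁, hC₁⟩ := hK.exists_bound_of_continuousOn hgc
  obtain ⟨C₂, hC₂⟩ := (hφ.continuous_fderiv one_ne_zero).bounded_above_of_compact_support
    (hφc.fderiv (𝕜 := ℝ))
  have hKm := hK.isClosed.measurableSet
  have hTK : ∀ z ∈ B, smoothTrace f U h φ z = ∫ w in K, g w * φ (f w - z) := fun z hz =>
    setIntegral_eq_of_subset_of_forall_sdiff_eq_zero hU.measurableSet hKU fun w hw => by
      rw [image_eq_zero_of_notMem_tsupport fun hmem => hw.2 (hsupp z hz w hw.1 hmem), mul_zero]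
  have hF : ∀ z, ContinuousOn (fun w => g w * φ (f w - z)) K := fun z =>
    hgc.mul (hφ.continuous.comp_continuousOn (hfc.sub continuousOn_const))
  have hder : HasFDerivAt (fun z => ∫ w in K, g w * φ (f w - z))
      (∫ w in K, g w • -(fderiv ℝ φ (f w - z))) z := by
    refine hasFDerivAt_integral_of_dominated_of_fderiv_le (𝕜 := ℝ)
      (F := fun z w => g w * φ (f w - z)) (F' := fun z w => g w • -(fderiv ℝ φ (f w - z)))
      (bound := fun _ => C₁ * C₂) (s := univ) univ_mem ?_ ?_ ?_ ?_ ?_ ?_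
    · exact Eventually.of_forall fun z => (hF z).aestronglyMeasurable hKm
    · exact (hF z).integrableOn_compact hK
    · exact ContinuousOn.aestronglyMeasurable (hgc.smul
        (((hφ.continuous_fderiv one_ne_zero).comp_continuousOn
          (hfc.sub continuousOn_const)).neg)) hKm
    · filter_upwards [ae_restrict_mem hKm] with w hw y _
      rw [norm_smul, norm_neg]
      exact mul_le_mul (hC₁ w hw) (hC₂ _) (norm_nonneg _) ((norm_nonneg _).trans (hC₁ w hw))
    · have : IsFiniteMeasure (volume.restrict K) := ⟨by simpa using hK.measure_lt_top⟩
      exact integrable_const _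
    · refine Eventually.of_forall fun w y _ => ?_
      have h1 : HasFDerivAt (fun y => φ (f w - y)) (-(fderiv ℝ φ (f w - y))) y := by
        have := ((hφ.differentiable one_ne_zero (f w - y)).hasFDerivAt).comp y
          ((hasFDerivAt_id y).const_sub (f w))
        simpa [Function.comp_def] using this
      exact h1.const_mul (g w)
  set A := ∫ w in K, g w • -(fderiv ℝ φ (f w - z)) with hA
  have hAint : IntegrableOn (fun w => g w • -(fderiv ℝ φ (f w - z))) K :=
    (hgc.smul (((hφ.continuous_fderiv one_ne_zero).comp_continuousOn
      (hfc.sub continuousOn_const)).neg)).integrableOn_compact hK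
  -- Differentiating `φ(f w - z)` in `z` is, up to sign, differentiating `φ` at `f w - z`, so the
  -- weak equation applies with the translated test function `φ(· - z)`.
  have hdbar : ∀ v, dbarPart A v = 0 := by
    intro v
    have key := integral_mul_dbar_comp_eq_zero (φ := fun y => φ (y - z)) hU hf hh
      (hφ.comp (contDiff_id.sub contDiff_const)) hK hKU
      (fun w hw hwK => image_eq_zero_of_notMem_tsupport fun hmem =>
        hwK (hsupp z hz w hw hmem)) v
    have e1 : ∀ w, dbar (fun y => φ (y - z)) (f w) v = dbarPart (fderiv ℝ φ (f w - z)) v := by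
      intro w; rw [dbar, fderiv_comp_sub]
    have e2 : ∫ w in K, g w * dbarPart (fderiv ℝ φ (f w - z)) v = 0 := by
      rw [← key]
      simp only [e1]
      refine (setIntegral_eq_of_subset_of_forall_sdiff_eq_zero hU.measurableSet hKU
        fun w hw => ?_).symm
      have : fderiv ℝ φ (f w - z) = 0 := by
        by_contra hne
        exact hw.2 (hsupp z hz w hw.1 (support_fderiv_subset ℝ hne))
      simp [this, dbarPart]
    have hint : ∀ a, IntegrableOn (fun w => g w * fderiv ℝ φ (f w - z) a) K := fun a =>
      (hgc.mul ((((hφ.continuous_fderiv one_ne_zero).comp_continuousOn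
        (hfc.sub continuousOn_const))).clm_apply continuousOn_const)).integrableOn_compact hK
    have e3 : ∀ a, A a = -∫ w in K, g w * fderiv ℝ φ (f w - z) a := by
      intro a
      rw [hA, ContinuousLinearMap.integral_apply hAint, ← integral_neg]
      simp
    rw [dbarPart, e3, e3]
    have e4 : ∫ w in K, g w * dbarPart (fderiv ℝ φ (f w - z)) v =
        (∫ w in K, g w * fderiv ℝ φ (f w - z) v) +
          I * ∫ w in K, g w * fderiv ℝ φ (f w - z) (I • v) := by
      rw [← integral_const_mul, ← integral_add (hint _) ((hint _).const_mul _)]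
      congr 1
      funext w
      rw [dbarPart]; ring
    rw [e4] at e2
    linear_combination -e2
  let A' : (Fin n → ℂ) →L[ℂ] ℂ :=
    { toFun := A
      map_add' := A.map_add
      map_smul' := map_complex_smul_of_dbarPart_eq_zero hdbar
      cont := A.continuous }
  have h1 : HasFDerivAt (fun z => ∫ w in K, g w * φ (f w - z)) A' z :=
    hasFDerivAt_of_restrictScalars ℝ hder (by ext; rfl)
  have h2 : smoothTrace f U h φ =ᶠ[𝓝 z] fun z => ∫ w in K, g w * φ (f w - z) := by
    filter_upwards [hB.mem_nhds hz] with y hy using hTK y hy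
  exact (h1.congr_of_eventuallyEq h2).differentiableAt.differentiableWithinAt

theorem hasStrictFDerivAt_of_holomorphic (hU : IsOpen U) (hf : DifferentiableOn ℂ f U)
    {w : Fin n → ℂ} (hw : w ∈ U) : HasStrictFDerivAt f (fderiv ℂ f w) w :=
  ((hf.contDiffOn_complex hU 1).contDiffAt (hU.mem_nhds hw)).hasStrictFDerivAt (by simp)

/-- Inverse function theorem: `f` is locally injective and open where the Jacobian is not zero. -/
theorem exists_injOn_of_jacDet_ne_zero (hU : IsOpen U) (hf : DifferentiableOn ℂ f U)
    {w : Fin n → ℂ} (hw : w ∈ U) (hJ : jacDet f w ≠ 0) :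
    (∃ V ∈ 𝓝 w, InjOn f V) ∧ Filter.map f (𝓝 w) = 𝓝 (f w) := by
  have h1 := hasStrictFDerivAt_of_holomorphic hU hf hw
  rw [← ContinuousLinearMap.coe_toContinuousLinearEquivOfDetNeZero (fderiv ℂ f w) hJ] at h1
  refine ⟨⟨(h1.toOpenPartialHomeomorph f).source,
    (h1.toOpenPartialHomeomorph f).open_source.mem_nhds h1.mem_toOpenPartialHomeomorph_source,
    (h1.toOpenPartialHomeomorph f).injOn⟩, h1.map_nhds_eq_of_equiv⟩

/-- This is why the weight `J * conj J` occurs in `smoothTrace`: it is the real Jacobian of `f`. -/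
theorem abs_det_restrictScalars (A : (Fin n → ℂ) →L[ℂ] (Fin n → ℂ)) :
    |(A.restrictScalars ℝ).det| = normSq A.det := by
  have h : (A.restrictScalars ℝ).det = normSq A.det := by
    rw [ContinuousLinearMap.det, ContinuousLinearMap.det, ← Algebra.norm_complex_apply]
    exact LinearMap.det_restrictScalars
  rw [h, abs_of_nonneg (normSq_nonneg _)]

/-- Change of variables on a set where `f` is injective. -/
theorem setIntegral_normSq_jacDet_mul {V : Set (Fin n → ℂ)} (hV : IsOpen V)
    (hf : DifferentiableOn ℂ f V) (hinj : InjOn f V) {φ : (Fin n → ℂ) → ℝ} (hφ : Integrable φ)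
    {z : Fin n → ℂ} (hsupp : ∀ y, y - z ∈ Function.support φ → y ∈ f '' V) :
    IntegrableOn (fun w => normSq (jacDet f w) * φ (f w - z)) V ∧
      ∫ w in V, normSq (jacDet f w) * φ (f w - z) = ∫ y, φ y := by
  have hder : ∀ w ∈ V, HasFDerivWithinAt f ((fderiv ℂ f w).restrictScalars ℝ) V w :=
    fun w hw => (((hf w hw).differentiableAt
      (hV.mem_nhds hw)).hasFDerivAt.restrictScalars ℝ).hasFDerivWithinAt
  have hi := (integrableOn_image_iff_integrableOn_abs_det_fderiv_smul volume hV.measurableSet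
    hder hinj (fun y => φ (y - z))).1 (hφ.comp_sub_right z).integrableOn
  have he := integral_image_eq_integral_abs_det_fderiv_smul volume hV.measurableSet
    hder hinj (fun y => φ (y - z))
  simp only [abs_det_restrictScalars, smul_eq_mul] at hi he
  refine ⟨hi, ?_⟩
  rw [setIntegral_eq_integral_of_forall_compl_eq_zero, integral_sub_right_eq_self] at he
  · exact he.symm
  · intro y hy
    by_contra hne
    exact hy (hsupp y hne)

/-- `z` is a regular value of the restriction of `f` to `U`. -/
def IsRegularValue (f : (Fin n → ℂ) → (Fin n → ℂ)) (U : Set (Fin n → ℂ)) (z : Fin n → ℂ) :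
    Prop := ∀ w ∈ U, f w = z → jacDet f w ≠ 0

/-- Local injectivity isolates the points of the fiber, and the fiber is compact. -/
theorem IsRegularValue.finite_fiber {z : Fin n → ℂ} (hz : IsRegularValue f U z) (hU : IsOpen U)
    (hf : DifferentiableOn ℂ f U) (hc : IsCompact (U ∩ f ⁻¹' {z})) : (U ∩ f ⁻¹' {z}).Finite := by
  have hloc : ∀ w ∈ U ∩ f ⁻¹' {z}, ∃ V ∈ 𝓝 w, InjOn f V := fun w hw =>
    (exists_injOn_of_jacDet_ne_zero hU hf hw.1 (hz w hw.1 hw.2)).1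
  choose! V hV hinj using hloc
  obtain ⟨t, ht, hcov⟩ := hc.elim_nhds_subcover V hV
  refine t.finite_toSet.subset fun w hw => ?_
  obtain ⟨y, hy, hwy⟩ := mem_iUnion₂.1 (hcov hw)
  have : w = y := hinj y (ht y hy) hwy (mem_of_mem_nhds (hV y (ht y hy)))
    ((mem_singleton_iff.1 hw.2).trans (mem_singleton_iff.1 (ht y hy).2).symm)
  rwa [this]

/-- The sum of `h` over the fiber of `f` over `z`. -/
def fiberSum (f : (Fin n → ℂ) → (Fin n → ℂ)) (U : Set (Fin n → ℂ)) (h : (Fin n → ℂ) → ℂ)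
    (z : Fin n → ℂ) : ℂ := ∑ᶠ w ∈ U ∩ f ⁻¹' {z}, h w

/-- A sequence of bump functions shrinking to the origin. -/
def shrinkingBump (n : ℕ) (i : ℕ) : ContDiffBump (0 : Fin n → ℂ) where
  rIn := 1 / (i + 2)
  rOut := 1 / (i + 1)
  rIn_pos := by positivity
  rIn_lt_rOut := by gcongr; linarith

theorem tendsto_shrinkingBump_rOut :
    Tendsto (fun i => (shrinkingBump n i).rOut) atTop (𝓝 0) :=
  tendsto_one_div_add_atTop_nhds_zero_nat

/-- The kernels of a shrinking approximate identity. -/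
def shrinkingKernel (n : ℕ) (i : ℕ) (y : Fin n → ℂ) : ℂ :=
  ((shrinkingBump n i).normed volume y : ℝ)

theorem contDiff_shrinkingKernel (i : ℕ) : ContDiff ℝ 1 (shrinkingKernel n i) :=
  Complex.ofRealCLM.contDiff.comp (ContDiffBump.contDiff_normed (n := 1) _)

theorem tsupport_shrinkingKernel (i : ℕ) :
    tsupport (shrinkingKernel n i) ⊆ closedBall 0 (shrinkingBump n i).rOut := by
  rw [← (shrinkingBump n i).tsupport_normed_eq (μ := volume)]
  refine closure_mono fun y hy => ?_
  simpa [shrinkingKernel] using hy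

theorem hasCompactSupport_shrinkingKernel (i : ℕ) : HasCompactSupport (shrinkingKernel n i) :=
  (isCompact_closedBall _ _).of_isClosed_subset (isClosed_tsupport _) (tsupport_shrinkingKernel i)

theorem smoothTrace_shrinkingKernel (i : ℕ) (z : Fin n → ℂ) :
    smoothTrace f U h (shrinkingKernel n i) z = ∫ w in U, h w *
      ((normSq (jacDet f w) * (shrinkingBump n i).normed volume (f w - z) : ℝ) : ℂ) := by
  simp only [smoothTrace, shrinkingKernel, Complex.mul_conj, ofReal_mul, mul_assoc]

/-- Fibers near `z` stay near the fiber over `z`: the part of a compact preimage outside `V` has a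
closed image which misses `z`. -/
theorem exists_ball_preimage_subset {G : Set (Fin n → ℂ)} (hG : IsOpen G)
    (hf : ContinuousOn f U) (hprop : ∀ C ⊆ G, IsCompact C → IsCompact (U ∩ f ⁻¹' C))
    {z : Fin n → ℂ} (hz : z ∈ G) {V : Set (Fin n → ℂ)} (hV : IsOpen V)
    (hfib : U ∩ f ⁻¹' {z} ⊆ V) : ∃ δ > 0, U ∩ f ⁻¹' (ball z δ) ⊆ V := by
  obtain ⟨R, hR, hRG⟩ := Metric.nhds_basis_closedBall.mem_iff.1 (hG.mem_nhds hz)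
  have hK := hprop _ hRG (isCompact_closedBall z R)
  have hK' : IsCompact ((U ∩ f ⁻¹' (closedBall z R)) \ V) := hK.diff hV
  have him : IsCompact (f '' ((U ∩ f ⁻¹' (closedBall z R)) \ V)) :=
    hK'.image_of_continuousOn (hf.mono fun w hw => hw.1.1)
  have hzn : z ∉ f '' ((U ∩ f ⁻¹' (closedBall z R)) \ V) := by
    rintro ⟨w, hw, hwz⟩
    exact hw.2 (hfib ⟨hw.1.1, hwz⟩)
  obtain ⟨δ, hδ, hδs⟩ := Metric.isOpen_iff.1 him.isClosed.isOpen_compl z hzn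
  refine ⟨min δ R, lt_min hδ hR, fun w hw => ?_⟩
  by_contra hwV
  have hw2 := mem_ball.1 (mem_preimage.1 hw.2)
  exact hδs (mem_ball.2 (hw2.trans_le (min_le_left _ _)))
    ⟨w, ⟨⟨hw.1, mem_closedBall.2 (hw2.le.trans (min_le_right _ _))⟩, hwV⟩, rfl⟩

/-- At regular values the smoothened traces converge to the sum over the fiber. -/
theorem tendsto_smoothTrace {G : Set (Fin n → ℂ)} (hU : IsOpen U) (hG : IsOpen G)
    (hf : DifferentiableOn ℂ f U) (hprop : ∀ C ⊆ G, IsCompact C → IsCompact (U ∩ f ⁻¹' C))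
    (hh : ContinuousOn h U) {z : Fin n → ℂ} (hz : z ∈ G) (hreg : IsRegularValue f U z) :
    Tendsto (fun i => smoothTrace f U h (shrinkingKernel n i) z) atTop
      (𝓝 (fiberSum f U h z)) := by
  have hfin := hreg.finite_fiber hU hf (hprop _ (by simpa using hz) isCompact_singleton)
  set S := hfin.toFinset with hS
  have hSmem : ∀ w ∈ S, w ∈ U ∧ f w = z := fun w hw => by simpa [hS] using hw
  have hsum : fiberSum f U h z = ∑ w ∈ S, h w := finsum_mem_eq_finite_toFinset_sum _ hfin
  rw [hsum, Metric.tendsto_atTop]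
  intro ε hε
  -- The error allowed on each sheet; `+ 1` keeps the denominator nonzero when the fiber is empty.
  set η : ℝ := ε / (S.card + 1) with hη
  have hηpos : 0 < η := by positivity
  obtain ⟨W, hW, hWd⟩ := Set.Finite.t2_separation hfin
  have hloc : ∀ w ∈ S, ∃ V, IsOpen V ∧ w ∈ V ∧ V ⊆ U ∧ V ⊆ W w ∧ InjOn f V ∧
      (∀ y ∈ V, ‖h y - h w‖ ≤ η) ∧ f '' V ∈ 𝓝 z := by
    intro w hw
    obtain ⟨hwU, hwz⟩ := hSmem w hw
    obtain ⟨⟨V₀, hV₀, hinj⟩, hmap⟩ := exists_injOn_of_jacDet_ne_zero hU hf hwU (hreg w hwU hwz)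
    have h1 : {y | ‖h y - h w‖ ≤ η} ∈ 𝓝 w := by
      have := (hh w hwU).continuousAt (hU.mem_nhds hwU) |>.preimage_mem_nhds
        (closedBall_mem_nhds (h w) hηpos)
      filter_upwards [this] with y hy
      simpa [dist_eq_norm] using hy
    obtain ⟨V, hVsub, hVo, hwV⟩ := _root_.mem_nhds_iff.1
      (inter_mem (inter_mem hV₀ h1) (inter_mem (hU.mem_nhds hwU) ((hW w).2.mem_nhds (hW w).1)))
    refine ⟨V, hVo, hwV, fun y hy => (hVsub hy).2.1, fun y hy => (hVsub hy).2.2,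
      hinj.mono fun y hy => (hVsub hy).1.1, fun y hy => (hVsub hy).1.2, ?_⟩
    rw [← hwz, ← hmap]
    exact image_mem_map (hVo.mem_nhds hwV)
  choose! V hVo hwV hVU hVW hVinj hVh hVz using hloc
  obtain ⟨δ₁, hδ₁, hδ₁V⟩ := exists_ball_preimage_subset hG hf.continuousOn hprop hz
    (V := ⋃ w ∈ S, V w) (isOpen_biUnion hVo) fun w hw =>
      mem_biUnion (show w ∈ S by simpa [hS] using hw) (hwV w (by simpa [hS] using hw))
  obtain ⟨δ₂, hδ₂, hδ₂V⟩ := Metric.mem_nhds_iff.1 ((Filter.biInter_finset_mem S).2 hVz)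
  obtain ⟨N, hN⟩ := (tendsto_shrinkingBump_rOut (n := n)).eventually_lt_const
    (lt_min hδ₁ hδ₂) |>.exists_forall_of_atTop
  refine ⟨N, fun i hi => ?_⟩
  have hr := hN i hi
  set φ := (shrinkingBump n i).normed volume with hφ
  set k : (Fin n → ℂ) → ℝ := fun w => normSq (jacDet f w) * φ (f w - z) with hk
  have hφsupp : ∀ y, φ (y - z) ≠ 0 → y ∈ ball z (shrinkingBump n i).rOut := fun y hy => by
    have : y - z ∈ Function.support φ := hy
    rw [hφ, ContDiffBump.support_normed_eq] at this
    simpa [dist_eq_norm] using this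
  -- On each sheet the change of variables makes `k` a density of total mass `1`, and `h` differs
  -- from `h w` by at most `η` there.
  have hmass : ∀ w ∈ S, IntegrableOn k (V w) ∧ ∫ y in V w, k y = 1 := fun w hw => by
    have := setIntegral_normSq_jacDet_mul (hVo w hw) (hf.mono (hVU w hw)) (hVinj w hw)
      (φ := φ) (shrinkingBump n i).integrable_normed (z := z) fun y hy =>
        mem_iInter₂.1 (hδ₂V (ball_subset_ball (hr.le.trans (min_le_right _ _))
          (hφsupp y hy))) w hw
    rwa [ContDiffBump.integral_normed] at this
  have hknn : ∀ w, 0 ≤ k w := fun w =>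
    mul_nonneg (normSq_nonneg _) (ContDiffBump.nonneg_normed _ _)
  have hint : ∀ w ∈ S, IntegrableOn (fun y => (h y - h w) * (k y : ℂ)) (V w) ∧
      ‖∫ y in V w, (h y - h w) * (k y : ℂ)‖ ≤ η := fun w hw => by
    have hb : ∀ᵐ y ∂(volume.restrict (V w)), ‖(h y - h w) * (k y : ℂ)‖ ≤ η * k y := by
      filter_upwards [ae_restrict_mem (hVo w hw).measurableSet] with y hy
      rw [norm_mul, Complex.norm_real, Real.norm_of_nonneg (hknn y)]
      exact mul_le_mul_of_nonneg_right (hVh w hw y hy) (hknn y)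
    have hki := (hmass w hw).1.const_mul η
    refine ⟨hki.mono' ?_ hb, (norm_integral_le_of_norm_le hki hb).trans (le_of_eq ?_)⟩
    · exact AEStronglyMeasurable.mul
        (((hh.mono (hVU w hw)).sub continuousOn_const).aestronglyMeasurable
          (hVo w hw).measurableSet) (hmass w hw).1.ofReal.aestronglyMeasurable
    · rw [integral_const_mul, (hmass w hw).2, mul_one]
  have hkc : ∀ w ∈ S, IntegrableOn (fun y => h w * (k y : ℂ)) (V w) := fun w hw =>
    (hmass w hw).1.ofReal.const_mul (h w)
  have hsplit : smoothTrace f U h (shrinkingKernel n i) z =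
      ∑ w ∈ S, ∫ y in V w, h y * (k y : ℂ) := by
    rw [smoothTrace_shrinkingKernel, ← integral_biUnion_finset S
      (fun w hw => (hVo w hw).measurableSet)]
    · refine setIntegral_eq_of_subset_of_forall_sdiff_eq_zero hU.measurableSet
        (iUnion₂_subset hVU) fun w hw => ?_
      by_cases hne : φ (f w - z) = 0
      · simp [← hφ, hne]
      · exact absurd (hδ₁V ⟨hw.1, ball_subset_ball (hr.le.trans (min_le_left _ _))
          (hφsupp _ hne)⟩) hw.2
    · intro a ha b hb hab
      exact (hWd (hfin.mem_toFinset.1 ha) (hfin.mem_toFinset.1 hb) hab).mono (hVW a ha) (hVW b hb)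
    · intro w hw
      have := (hint w hw).1.add (hkc w hw)
      refine this.congr_fun (fun y _ => ?_) (hVo w hw).measurableSet
      simp only [Pi.add_apply]; ring
  have hdiff : smoothTrace f U h (shrinkingKernel n i) z - ∑ w ∈ S, h w =
      ∑ w ∈ S, ∫ y in V w, (h y - h w) * (k y : ℂ) := by
    rw [hsplit, ← Finset.sum_sub_distrib]
    refine Finset.sum_congr rfl fun w hw => ?_
    have e1 : ∫ y in V w, h w * (k y : ℂ) = h w := by
      rw [integral_const_mul, integral_complex_ofReal, (hmass w hw).2]; simp
    have e2 := integral_add (hint w hw).1 (hkc w hw)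
    rw [e1] at e2
    rw [sub_eq_iff_eq_add, ← e2]
    congr 1
    funext y
    ring
  rw [dist_eq_norm, hdiff]
  calc ‖∑ w ∈ S, ∫ y in V w, (h y - h w) * (k y : ℂ)‖ ≤ ∑ w ∈ S, η :=
        norm_sum_le_of_le _ fun w hw => (hint w hw).2
    _ = S.card * η := by simp
    _ < (S.card + 1) * η := by linarith
    _ = ε := by rw [hη]; field_simp

end SmoothTrace

/-! ### Density of regular values and the degree of a proper map. -/

noncomputable section Degree

open Filter Topology Metric Set MeasureTheory Complex
open scoped ComplexConjugate

variable {n : ℕ} {f : (Fin n → ℂ) → (Fin n → ℂ)} {U G : Set (Fin n → ℂ)}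
  {h : (Fin n → ℂ) → ℂ}

/-- Sard's theorem: regular values are dense. -/
theorem exists_isRegularValue (hU : IsOpen U) (hf : DifferentiableOn ℂ f U)
    {W : Set (Fin n → ℂ)} (hW : IsOpen W) (hne : W.Nonempty) :
    ∃ z ∈ W, IsRegularValue f U z := by
  have h0 : volume (f '' {w ∈ U | jacDet f w = 0}) = 0 := by
    refine addHaar_image_eq_zero_of_det_fderivWithin_eq_zero volume
      (f' := fun w => (fderiv ℂ f w).restrictScalars ℝ) (fun w hw => ?_) fun w hw => ?_
    · exact (((hf w hw.1).differentiableAt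
        (hU.mem_nhds hw.1)).hasFDerivAt.restrictScalars ℝ).hasFDerivWithinAt
    · rw [← abs_eq_zero, abs_det_restrictScalars]
      exact (map_eq_zero normSq).2 hw.2
  by_contra! hcon
  refine (hW.measure_pos volume hne).ne' (measure_mono_null (fun z hz => ?_) h0)
  have := hcon z hz
  simp only [IsRegularValue, not_forall, not_not] at this
  obtain ⟨w, hw, hwz, hJ⟩ := this
  exact ⟨w, ⟨hw, hJ⟩, hwz⟩

section Local

variable {z₀ : Fin n → ℂ} {R : ℝ}

theorem mem_of_sub_mem_tsupport_shrinkingKernel {i : ℕ} (hi : (shrinkingBump n i).rOut ≤ R)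
    {z : Fin n → ℂ} (hz : z ∈ ball z₀ (2 * R)) {w : Fin n → ℂ} (hw : w ∈ U)
    (h : f w - z ∈ tsupport (shrinkingKernel n i)) :
    w ∈ U ∩ f ⁻¹' closedBall z₀ (3 * R) := by
  have h1 := mem_closedBall_zero_iff.1 (tsupport_shrinkingKernel i h)
  refine ⟨hw, mem_closedBall.2 ?_⟩
  have h2 := dist_triangle (f w) z z₀
  rw [dist_eq_norm (f w) z] at h2
  linarith [mem_ball.1 hz]

variable (hU : IsOpen U) (hfP : IsProperHolomorphic f U G) (hball : closedBall z₀ (3 * R) ⊆ G)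

include hU hfP hball

theorem differentiableOn_smoothTrace_ball (hh : DifferentiableOn ℂ h U) {i : ℕ}
    (hi : (shrinkingBump n i).rOut ≤ R) :
    DifferentiableOn ℂ (smoothTrace f U h (shrinkingKernel n i)) (ball z₀ (2 * R)) :=
  differentiableOn_smoothTrace hU hfP.1 hh (contDiff_shrinkingKernel i)
    (hasCompactSupport_shrinkingKernel i) (hfP.2.2 _ hball (isCompact_closedBall _ _))
    inter_subset_left isOpen_ball fun _ hz _ hw h =>
      mem_of_sub_mem_tsupport_shrinkingKernel hi hz hw h

/-- For `h = 1` the trace is both real-valued and holomorphic, hence constant on the ball. The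
constancy of the degree rests on this. -/
theorem smoothTrace_one_eq {i : ℕ} (hi : (shrinkingBump n i).rOut ≤ R) {x y : Fin n → ℂ}
    (hx : x ∈ ball z₀ (2 * R)) (hy : y ∈ ball z₀ (2 * R)) :
    smoothTrace f U (fun _ => 1) (shrinkingKernel n i) x =
      smoothTrace f U (fun _ => 1) (shrinkingKernel n i) y := by
  set T := smoothTrace f U (fun _ => 1) (shrinkingKernel n i) with hT
  have hd := differentiableOn_smoothTrace_ball (h := fun _ => 1) hU hfP hball
    (differentiableOn_const _) hi
  have hreal : ∀ z, (T z).im = 0 := by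
    intro z
    rw [hT, smoothTrace_shrinkingKernel]
    simp only [one_mul]
    rw [integral_complex_ofReal]
    exact ofReal_im _
  refine isOpen_ball.is_const_of_fderiv_eq_zero (convex_ball _ _).isPreconnected hd
    (fun z hz => ?_) hx hy
  have hA := ((hd z hz).differentiableAt (isOpen_ball.mem_nhds hz)).hasFDerivAt
  have h1 := (Complex.imCLM.hasFDerivAt.comp z (hA.restrictScalars ℝ))
  have h2 : HasFDerivAt (Complex.imCLM ∘ T) (0 : (Fin n → ℂ) →L[ℝ] ℝ) z := by
    have : Complex.imCLM ∘ T = fun _ => 0 := funext hreal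
    rw [this]
    exact hasFDerivAt_const _ _
  have h3 := h1.unique h2
  have him : ∀ v, (fderiv ℂ T z v).im = 0 := fun v => by
    simpa using congrArg (fun L => L v) h3
  ext1 v
  apply Complex.ext
  · have := him (I • v)
    rw [map_smul] at this
    simpa using this
  · simpa using him v

/-- The weight `|J|² φ` is nonnegative, so the trace of `h` is dominated by the trace of `1`. The
latter is constant and converges, which makes bounds uniform in `i`. -/
theorem norm_smoothTrace_le {M : ℝ}
    (hM : ∀ w ∈ U ∩ f ⁻¹' closedBall z₀ (3 * R), ‖h w‖ ≤ M) {i : ℕ}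
    (hi : (shrinkingBump n i).rOut ≤ R) {z : Fin n → ℂ} (hz : z ∈ ball z₀ (2 * R)) :
    ‖smoothTrace f U h (shrinkingKernel n i) z‖ ≤
      M * ‖smoothTrace f U (fun _ => 1) (shrinkingKernel n i) z‖ := by
  set K := U ∩ f ⁻¹' closedBall z₀ (3 * R)
  have hK : IsCompact K := hfP.2.2 _ hball (isCompact_closedBall _ _)
  set k : (Fin n → ℂ) → ℝ := fun w =>
    normSq (jacDet f w) * (shrinkingBump n i).normed volume (f w - z) with hk
  have hknn : ∀ w, 0 ≤ k w := fun w =>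
    mul_nonneg (normSq_nonneg _) (ContDiffBump.nonneg_normed _ _)
  have hk0 : ∀ w ∈ U, w ∉ K → k w = 0 := fun w hw hwK => by
    have : (shrinkingBump n i).normed volume (f w - z) = 0 := by
      by_contra hne
      refine hwK (mem_of_sub_mem_tsupport_shrinkingKernel hi hz hw (subset_tsupport _ ?_))
      simpa [shrinkingKernel] using hne
    simp [hk, this]
  have hkc : ContinuousOn k K := by
    have hJ := (differentiableOn_jacDet hU hfP.1).continuousOn.mono
      (inter_subset_left : K ⊆ U)
    exact (Complex.continuous_normSq.comp_continuousOn hJ).mul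
      ((ContDiffBump.continuous_normed _).comp_continuousOn
        ((hfP.1.continuousOn.mono inter_subset_left).sub continuousOn_const))
  have hint : IntegrableOn k U := by
    refine (hkc.integrableOn_compact hK).of_forall_sdiff_eq_zero hU.measurableSet fun w hw =>
      hk0 w hw.1 hw.2
  have e1 : ‖smoothTrace f U (fun _ => 1) (shrinkingKernel n i) z‖ = ∫ w in U, k w := by
    rw [smoothTrace_shrinkingKernel]
    simp only [one_mul]
    rw [integral_complex_ofReal, Complex.norm_real,
      Real.norm_of_nonneg (integral_nonneg hknn)]
  rw [e1, smoothTrace_shrinkingKernel, ← integral_const_mul]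
  refine norm_integral_le_of_norm_le (hint.const_mul M) ?_
  filter_upwards [ae_restrict_mem hU.measurableSet] with w hw
  rw [norm_mul, Complex.norm_real, Real.norm_of_nonneg (hknn w)]
  by_cases hwK : w ∈ K
  · exact mul_le_mul_of_nonneg_right (hM w hwK) (hknn w)
  · have := hk0 w hw hwK
    simp only [hk] at this
    simp [this, hk]

theorem fiberSum_one_eq (hG : IsOpen G) {x y : Fin n → ℂ}
    (hx : x ∈ ball z₀ (2 * R)) (hy : y ∈ ball z₀ (2 * R)) (hxr : IsRegularValue f U x)
    (hyr : IsRegularValue f U y) :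
    fiberSum f U (fun _ => 1) x = fiberSum f U (fun _ => 1) y := by
  have hR : 0 < R := by linarith [dist_nonneg.trans_lt (mem_ball.1 hx)]
  have hsub : ball z₀ (2 * R) ⊆ G :=
    ((ball_subset_ball (by linarith)).trans ball_subset_closedBall).trans hball
  refine tendsto_nhds_unique (tendsto_smoothTrace hU hG hfP.1 hfP.2.2 continuousOn_const
    (hsub hx) hxr) ?_
  refine (tendsto_smoothTrace hU hG hfP.1 hfP.2.2 continuousOn_const (hsub hy) hyr).congr' ?_
  filter_upwards [(tendsto_shrinkingBump_rOut (n := n)).eventually_le_const hR] with i hi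
  exact smoothTrace_one_eq hU hfP hball hi hy hx

/-- The smoothened traces are uniformly bounded. -/
theorem exists_bound_smoothTrace (hG : IsOpen G) (hR : 0 < R) : ∃ C : ℝ, 0 ≤ C ∧
    ∀ (h : (Fin n → ℂ) → ℂ) (M : ℝ), 0 ≤ M →
      (∀ w ∈ U ∩ f ⁻¹' closedBall z₀ (3 * R), ‖h w‖ ≤ M) →
      ∀ᶠ i in atTop, ∀ z ∈ ball z₀ (2 * R),
        ‖smoothTrace f U h (shrinkingKernel n i) z‖ ≤ M * C := by
  obtain ⟨z₁, hz₁, hreg⟩ := exists_isRegularValue hU hfP.1 (isOpen_ball (x := z₀) (ε := 2 * R))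
    ⟨z₀, mem_ball_self (by positivity)⟩
  have hz₁G : z₁ ∈ G := hball (ball_subset_closedBall (ball_subset_ball (by linarith) hz₁))
  have h1 := (tendsto_smoothTrace (h := fun _ => 1) hU hG hfP.1 hfP.2.2 continuousOn_const
    hz₁G hreg).norm
  refine ⟨‖fiberSum f U (fun _ => 1) z₁‖ + 1, by positivity, fun h M hM0 hM => ?_⟩
  filter_upwards [h1.eventually_le_const (lt_add_one _),
    (tendsto_shrinkingBump_rOut (n := n)).eventually_le_const hR] with i hi hiR z hz
  refine (norm_smoothTrace_le hU hfP hball hM hiR hz).trans ?_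
  rw [smoothTrace_one_eq hU hfP hball hiR hz hz₁]
  gcongr

/-- Traces of holomorphic functions are Lipschitz on the regular values of a small ball. -/
theorem exists_lipschitz_fiberSum (hG : IsOpen G) (hR : 0 < R) (hh : DifferentiableOn ℂ h U) :
    ∃ C : ℝ, ∀ x ∈ ball z₀ (R / 2), ∀ y ∈ ball z₀ (R / 2), IsRegularValue f U x →
      IsRegularValue f U y → dist (fiberSum f U h x) (fiberSum f U h y) ≤ C * dist x y := by
  obtain ⟨C, hC, hbd⟩ := exists_bound_smoothTrace hU hfP hball hG hR
  obtain ⟨M, hM⟩ := (hfP.2.2 _ hball (isCompact_closedBall _ _)).exists_bound_of_continuousOn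
    (hh.continuousOn.mono inter_subset_left)
  have hsub : ball z₀ (R / 2) ⊆ G :=
    ((ball_subset_ball (by linarith)).trans ball_subset_closedBall).trans hball
  refine ⟨2 * (max M 0 * C) / R, fun x hx y hy hxr hyr => ?_⟩
  refine le_of_tendsto ((tendsto_smoothTrace hU hG hfP.1 hfP.2.2 hh.continuousOn (hsub hx)
    hxr).dist (tendsto_smoothTrace hU hG hfP.1 hfP.2.2 hh.continuousOn (hsub hy) hyr)) ?_
  filter_upwards [hbd h (max M 0) (le_max_right _ _)
    fun w hw => (hM w hw).trans (le_max_left _ _),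
    (tendsto_shrinkingBump_rOut (n := n)).eventually_le_const hR] with i hi hiR
  exact dist_le_of_bounded_holomorphic (differentiableOn_smoothTrace_ball hU hfP hball hh hiR)
    hi hx hy

end Local

theorem fiberSum_one {z : Fin n → ℂ} (hfin : (U ∩ f ⁻¹' {z}).Finite) :
    fiberSum f U (fun _ => 1) z = (U ∩ f ⁻¹' {z}).ncard := by
  rw [fiberSum, finsum_mem_eq_finite_toFinset_sum _ hfin, ncard_eq_toFinset_card _ hfin]
  simp

theorem IsProperHolomorphic.finite_fiber (hU : IsOpen U) (hfP : IsProperHolomorphic f U G)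
    {z : Fin n → ℂ} (hz : z ∈ G) (hreg : IsRegularValue f U z) : (U ∩ f ⁻¹' {z}).Finite :=
  hreg.finite_fiber hU hfP.1 (hfP.2.2 _ (by simpa using hz) isCompact_singleton)

theorem exists_ball_ncard_eq (hU : IsOpen U) (hG : IsOpen G) (hfP : IsProperHolomorphic f U G)
    {z : Fin n → ℂ} (hz : z ∈ G) : ∃ ε > 0, ball z ε ⊆ G ∧ ∀ x ∈ ball z ε, ∀ y ∈ ball z ε,
      IsRegularValue f U x → IsRegularValue f U y →
        (U ∩ f ⁻¹' {x}).ncard = (U ∩ f ⁻¹' {y}).ncard := by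
  obtain ⟨ρ, hρ, hρG⟩ := Metric.nhds_basis_closedBall.mem_iff.1 (hG.mem_nhds hz)
  have hb : ball z (2 * (ρ / 3)) ⊆ G :=
    ((ball_subset_ball (by linarith)).trans ball_subset_closedBall).trans hρG
  refine ⟨2 * (ρ / 3), by positivity, hb, fun x hx y hy hxr hyr => ?_⟩
  have := fiberSum_one_eq hU hfP (R := ρ / 3) (by rwa [mul_div_cancel₀ ρ three_ne_zero]) hG hx hy
    hxr hyr
  rw [fiberSum_one (hfP.finite_fiber hU (hb hx) hxr),
    fiberSum_one (hfP.finite_fiber hU (hb hy) hyr)] at this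
  exact_mod_cast this

/-- The degree of a proper holomorphic map: all regular values have the same number of
preimages. -/
theorem exists_degree (hU : IsOpen U) (hG : IsOpen G) (hGc : IsPreconnected G)
    (hfP : IsProperHolomorphic f U G) :
    ∃ m : ℕ, ∀ z ∈ G, IsRegularValue f U z → (U ∩ f ⁻¹' {z}).ncard = m := by
  rcases G.eq_empty_or_nonempty with rfl | hne
  · exact ⟨0, fun z hz => absurd hz (notMem_empty z)⟩
  obtain ⟨z₁, hz₁, hreg⟩ := exists_isRegularValue hU hfP.1 hG hne
  set m := (U ∩ f ⁻¹' {z₁}).ncard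
  -- `A` is open by its form. It is relatively closed in `G` because a ball on which the count is
  -- constant, centred at a limit point, contains regular values near a point of `A`.
  set A : Set (Fin n → ℂ) := {z | ∀ᶠ y in 𝓝 z, IsRegularValue f U y →
    (U ∩ f ⁻¹' {y}).ncard = m} with hA
  have hAo : IsOpen A := isOpen_setOfPred_eventually_nhds
  suffices hGA : G ⊆ A from ⟨m, fun z hz hzr => (hGA hz).self_of_nhds hzr⟩
  refine hGc.subset_of_closure_inter_subset hAo ⟨z₁, hz₁, ?_⟩ ?_
  · obtain ⟨ε, hε, -, hcon⟩ := exists_ball_ncard_eq hU hG hfP hz₁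
    filter_upwards [ball_mem_nhds z₁ hε] with y hy hyr
    exact hcon y hy z₁ (mem_ball_self hε) hyr hreg
  · rintro z ⟨hzc, hzG⟩
    obtain ⟨ε, hε, -, hcon⟩ := exists_ball_ncard_eq hU hG hfP hzG
    obtain ⟨p, hpA, hp⟩ := Metric.mem_closure_iff.1 hzc ε hε
    obtain ⟨δ, hδ, hδA⟩ := Metric.mem_nhds_iff.1 (inter_mem hpA
      (isOpen_ball.mem_nhds (show p ∈ ball z ε by rwa [mem_ball, dist_comm])))
    obtain ⟨q, hq, hqr⟩ := exists_isRegularValue hU hfP.1 (isOpen_ball (x := p) (ε := δ))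
      ⟨p, mem_ball_self hδ⟩
    have hqm := (hδA hq).1 hqr
    filter_upwards [ball_mem_nhds z hε] with y hy hyr
    rw [hcon y hy q (hδA hq).2 hyr hqr, hqm]

end Degree

/-! ### Openness and surjectivity of proper holomorphic maps. -/

noncomputable section Openness

open Filter Topology Metric Set MeasureTheory Complex

variable {n : ℕ} {f : (Fin n → ℂ) → (Fin n → ℂ)} {U G : Set (Fin n → ℂ)}

theorem image_mem_nhds_of_jacDet_ne_zero (hU : IsOpen U) (hf : DifferentiableOn ℂ f U)
    {V : Set (Fin n → ℂ)} {w : Fin n → ℂ} (hV : V ∈ 𝓝 w) (hw : w ∈ U) (hJ : jacDet f w ≠ 0) :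
    f '' V ∈ 𝓝 (f w) := by
  rw [← (exists_injOn_of_jacDet_ne_zero hU hf hw hJ).2]
  exact image_mem_map hV

/-- `f` is open at a noncritical point, so some regular value has a nonempty fiber. -/
theorem one_le_degree (hU : IsOpen U) (hfP : IsProperHolomorphic f U G) {m : ℕ}
    (hm : ∀ z ∈ G, IsRegularValue f U z → (U ∩ f ⁻¹' {z}).ncard = m)
    {w₀ : Fin n → ℂ} (hw₀ : w₀ ∈ U) (hJ : jacDet f w₀ ≠ 0) : m ≠ 0 := by
  obtain ⟨W, hW, hWo, hwW⟩ := _root_.mem_nhds_iff.1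
    (image_mem_nhds_of_jacDet_ne_zero hU hfP.1 (hU.mem_nhds hw₀) hw₀ hJ)
  obtain ⟨z, hz, hreg⟩ := exists_isRegularValue hU hfP.1 hWo ⟨_, hwW⟩
  obtain ⟨w, hw, hwz⟩ := hW hz
  have hzG : z ∈ G := hwz ▸ hfP.2.1 hw
  rw [← hm z hzG hreg]
  exact (ncard_pos (hfP.finite_fiber hU hzG hreg)).2 ⟨w, hw, hwz⟩ |>.ne'

/-- Positive degree puts all regular values in the image. They are dense, and images of compact
preimages are closed. -/
theorem subset_image_of_jacDet_ne_zero (hU : IsOpen U) (hG : IsOpen G) (hGc : IsPreconnected G)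
    (hfP : IsProperHolomorphic f U G) {w₀ : Fin n → ℂ} (hw₀ : w₀ ∈ U) (hJ : jacDet f w₀ ≠ 0) :
    G ⊆ f '' U := by
  obtain ⟨m, hm⟩ := exists_degree hU hG hGc hfP
  have hm0 := one_le_degree hU hfP hm hw₀ hJ
  intro z hz
  obtain ⟨R, hR, hRG⟩ := Metric.nhds_basis_closedBall.mem_iff.1 (hG.mem_nhds hz)
  set K := U ∩ f ⁻¹' closedBall z R
  have hK : IsCompact K := hfP.2.2 _ hRG (isCompact_closedBall _ _)
  have hcl : IsClosed (f '' K) :=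
    (hK.image_of_continuousOn (hfP.1.continuousOn.mono inter_subset_left)).isClosed
  suffices z ∈ f '' K from image_mono inter_subset_left this
  rw [← hcl.closure_eq, Metric.mem_closure_iff]
  intro ε hε
  obtain ⟨y, hy, hyr⟩ := exists_isRegularValue hU hfP.1 (isOpen_ball (x := z) (ε := min ε R))
    ⟨z, mem_ball_self (lt_min hε hR)⟩
  have hyR : y ∈ closedBall z R :=
    mem_closedBall.2 ((mem_ball.1 hy).le.trans (min_le_right _ _))
  have hne : (U ∩ f ⁻¹' {y}).Nonempty := by
    refine (ncard_pos (hfP.finite_fiber hU (hRG hyR) hyr)).1 ?_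
    rw [hm y (hRG hyR) hyr]
    exact Nat.pos_of_ne_zero hm0
  obtain ⟨w, hw, hwy⟩ := hne
  refine ⟨y, ⟨w, ⟨hw, ?_⟩, hwy⟩, ?_⟩
  · rw [mem_preimage, mem_singleton_iff.1 hwy]; exact hyR
  · rw [dist_comm]; exact (mem_ball.1 hy).trans_le (min_le_left _ _)

/-- `det(f' + s)` is the characteristic polynomial of `-f'` at `s`, which has finitely many roots. A
small perturbation thus makes a given point noncritical. -/
theorem eventually_jacDet_add_smul_ne_zero {w : Fin n → ℂ} (hf : DifferentiableAt ℂ f w) :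
    ∀ᶠ s in 𝓝[≠] (0 : ℂ), jacDet (fun w => f w + s • w) w ≠ 0 := by
  set P := LinearMap.charpoly (-(fderiv ℂ f w : (Fin n → ℂ) →ₗ[ℂ] (Fin n → ℂ)))
  have hP : P ≠ 0 := (LinearMap.charpoly_monic _).ne_zero
  have hfin : ({s : ℂ | P.IsRoot s} \ {0}).Finite :=
    (Polynomial.finite_setOfPred_isRoot hP).subset sdiff_subset
  have hmem : ({s : ℂ | P.IsRoot s} \ {0})ᶜ ∈ 𝓝 (0 : ℂ) :=
    hfin.isClosed.isOpen_compl.mem_nhds (by simp)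
  filter_upwards [mem_nhdsWithin_of_mem_nhds hmem, self_mem_nhdsWithin] with s hs hs0 hJ
  refine hs ⟨?_, hs0⟩
  have hd : fderiv ℂ (fun w => f w + s • w) w =
      fderiv ℂ f w + s • ContinuousLinearMap.id ℂ (Fin n → ℂ) :=
    (hf.hasFDerivAt.add ((hasFDerivAt_id w).const_smul s)).fderiv
  change P.eval s = 0
  rw [LinearMap.eval_charpoly, ← hJ, jacDet, hd, ContinuousLinearMap.det]
  congr 1
  ext v i
  simp [add_comm]

/-- The perturbation moves values on the compact preimage of the ball of radius `2r` by less than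
`r`. Points of that preimage with new value within `r` therefore had old value strictly within `2r`,
so none escape through the boundary. -/
theorem isProperHolomorphic_perturbation (hfP : IsProperHolomorphic f U G)
    {z₀ : Fin n → ℂ} {r M : ℝ} (hrG : closedBall z₀ (2 * r) ⊆ G)
    (hM : ∀ w ∈ U ∩ f ⁻¹' closedBall z₀ (2 * r), ‖w‖ ≤ M) {s : ℂ} (hs : ‖s‖ * M < r) :
    IsProperHolomorphic (fun w => f w + s • w)
      {w ∈ U ∩ f ⁻¹' ball z₀ (2 * r) | f w + s • w ∈ ball z₀ r} (ball z₀ r) := by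
  set K := U ∩ f ⁻¹' closedBall z₀ (2 * r)
  have hK : IsCompact K := hfP.2.2 _ hrG (isCompact_closedBall _ _)
  have hdiff : DifferentiableOn ℂ (fun w => f w + s • w) U :=
    hfP.1.add (differentiableOn_id.const_smul s)
  refine ⟨hdiff.mono fun w hw => hw.1.1, fun w hw => hw.2, fun C hC hCc => ?_⟩
  have he : {w ∈ U ∩ f ⁻¹' ball z₀ (2 * r) | f w + s • w ∈ ball z₀ r} ∩
      (fun w => f w + s • w) ⁻¹' C = K ∩ (fun w => f w + s • w) ⁻¹' C := by
    ext w
    constructor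
    · rintro ⟨⟨⟨h1, h2⟩, -⟩, h3⟩
      exact ⟨⟨h1, ball_subset_closedBall h2⟩, h3⟩
    · rintro ⟨hwK, h3⟩
      have h4 := mem_ball.1 (hC h3)
      refine ⟨⟨⟨hwK.1, ?_⟩, hC h3⟩, h3⟩
      rw [mem_preimage, mem_ball]
      have h5 : dist (f w) (f w + s • w) ≤ ‖s‖ * M := by
        rw [dist_self_add_right, norm_smul]
        gcongr
        exact hM w hwK
      linarith [dist_triangle (f w) (f w + s • w) z₀]
  rw [he]
  exact hK.of_isClosed_subset ((hdiff.continuousOn.mono inter_subset_left).preimage_isClosed_of_isClosed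
    hK.isClosed hCc.isClosed) inter_subset_left

/-- Proper holomorphic maps between open sets of the same dimension are open. -/
theorem IsProperHolomorphic.image_mem_nhds (hU : IsOpen U) (hG : IsOpen G)
    (hfP : IsProperHolomorphic f U G) {w₀ : Fin n → ℂ} (hw₀ : w₀ ∈ U) :
    f '' U ∈ 𝓝 (f w₀) := by
  set z₀ := f w₀
  obtain ⟨ρ, hρ, hρG⟩ := Metric.nhds_basis_closedBall.mem_iff.1 (hG.mem_nhds (hfP.2.1 hw₀))
  set r := ρ / 2 with hrdef
  have hr : 0 < r := by positivity
  have hrG : closedBall z₀ (2 * r) ⊆ G := by rwa [hrdef, mul_div_cancel₀ ρ two_ne_zero]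
  set K := U ∩ f ⁻¹' closedBall z₀ (2 * r)
  have hK : IsCompact K := hfP.2.2 _ hrG (isCompact_closedBall _ _)
  obtain ⟨M, hM⟩ := hK.exists_bound_of_continuousOn continuousOn_id
  simp only [id_eq] at hM
  have hw₀K : w₀ ∈ K := ⟨hw₀, mem_closedBall_self (by positivity)⟩
  have hsmall : ∀ᶠ s in 𝓝[≠] (0 : ℂ), ‖s‖ * M < r := by
    have : Tendsto (fun s : ℂ => ‖s‖ * M) (𝓝 0) (𝓝 0) := by
      have h := (show Continuous fun s : ℂ => ‖s‖ * M by fun_prop).tendsto 0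
      simpa using h
    exact (this.mono_left nhdsWithin_le_nhds).eventually_lt_const hr
  refine mem_of_superset (ball_mem_nhds z₀ hr) fun z hz => ?_
  -- The perturbed map is noncritical at `w₀`, hence onto the ball. Its solutions of the equation
  -- with value `z` stay in the compact `K` and, as `s → 0`, accumulate at a preimage of `z` under
  -- `f`.
  have hev : ∀ᶠ s in 𝓝[≠] (0 : ℂ), ∃ w ∈ K, f w + s • w = z := by
    filter_upwards [hsmall, eventually_jacDet_add_smul_ne_zero
      ((hfP.1 w₀ hw₀).differentiableAt (hU.mem_nhds hw₀))] with s hs hJ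
    have hP := isProperHolomorphic_perturbation hfP hrG hM hs
    have hO1 : IsOpen (U ∩ f ⁻¹' ball z₀ (2 * r)) :=
      hfP.1.continuousOn.isOpen_inter_preimage hU isOpen_ball
    have hO : IsOpen {w ∈ U ∩ f ⁻¹' ball z₀ (2 * r) | f w + s • w ∈ ball z₀ r} :=
      ((hfP.1.continuousOn.add (continuousOn_id.const_smul s)).mono
        inter_subset_left).isOpen_inter_preimage hO1 isOpen_ball
    have hmem : w₀ ∈ {w ∈ U ∩ f ⁻¹' ball z₀ (2 * r) | f w + s • w ∈ ball z₀ r} := by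
      refine ⟨⟨hw₀, mem_ball_self (by positivity)⟩, ?_⟩
      rw [mem_ball, dist_self_add_left, norm_smul]
      exact (mul_le_mul_of_nonneg_left (hM w₀ hw₀K) (norm_nonneg s)).trans_lt hs
    obtain ⟨w, hw, hwz⟩ := subset_image_of_jacDet_ne_zero hO isOpen_ball
      (convex_ball z₀ r).isPreconnected hP hmem hJ hz
    exact ⟨w, ⟨hw.1.1, ball_subset_closedBall hw.1.2⟩, hwz⟩
  obtain ⟨g, hg⟩ := hev.choice
  set u : Ultrafilter ℂ := Ultrafilter.of (𝓝[≠] (0 : ℂ))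
  have hu : (u : Filter ℂ) ≤ 𝓝[≠] 0 := Ultrafilter.of_le _
  obtain ⟨w, hwK, hgw⟩ := hK.ultrafilter_le_nhds (u.map g)
    (le_principal_iff.2 (hu (hg.mono fun s hs => hs.1)))
  have hgw' : Tendsto g u (𝓝[K] w) :=
    tendsto_nhdsWithin_iff.2 ⟨hgw, hu (hg.mono fun s hs => hs.1)⟩
  have hlim : Tendsto (fun s => f (g s) + s • g s) u (𝓝 (f w + (0 : ℂ) • w)) :=
    (((hfP.1.continuousOn.mono inter_subset_left) w hwK).tendsto.comp hgw').add
      (((tendsto_id.mono_left nhdsWithin_le_nhds).mono_left hu).smul hgw)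
  refine ⟨w, hwK.1, ?_⟩
  have hconst : Tendsto (fun s => f (g s) + s • g s) u (𝓝 z) :=
    tendsto_const_nhds.congr' (hu (hg.mono fun s hs => hs.2.symm))
  simpa using tendsto_nhds_unique hlim hconst

/-- By openness the image has interior points, and by Sard one of them is a regular value. -/
theorem IsProperHolomorphic.exists_jacDet_ne_zero (hU : IsOpen U) (hG : IsOpen G)
    (hfP : IsProperHolomorphic f U G) (hne : U.Nonempty) : ∃ w ∈ U, jacDet f w ≠ 0 := by
  obtain ⟨w₀, hw₀⟩ := hne
  obtain ⟨W, hW, hWo, hwW⟩ := _root_.mem_nhds_iff.1 (hfP.image_mem_nhds hU hG hw₀)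
  obtain ⟨z, hz, hreg⟩ := exists_isRegularValue hU hfP.1 hWo ⟨_, hwW⟩
  obtain ⟨w, hw, hwz⟩ := hW hz
  exact ⟨w, hw, hreg w hw hwz⟩

/-- Proper holomorphic maps between domains are surjective. -/
theorem IsProperHolomorphic.subset_image (hU : IsOpen U) (hG : IsOpen G) (hGc : IsPreconnected G)
    (hfP : IsProperHolomorphic f U G) (hne : U.Nonempty) : G ⊆ f '' U := by
  obtain ⟨w, hw, hJ⟩ := hfP.exists_jacDet_ne_zero hU hG hne
  exact subset_image_of_jacDet_ne_zero hU hG hGc hfP hw hJ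

/-- Preimages of regular values are dense. -/
theorem IsProperHolomorphic.exists_mem_isRegularValue (hU : IsOpen U) (hUc : IsPreconnected U)
    (hG : IsOpen G) (hfP : IsProperHolomorphic f U G) {V : Set (Fin n → ℂ)} (hV : IsOpen V)
    (hVU : V ⊆ U) (hne : V.Nonempty) : ∃ w ∈ V, IsRegularValue f U (f w) := by
  obtain ⟨w₁, hw₁, hJ₁⟩ := hfP.exists_jacDet_ne_zero hU hG (hne.mono hVU)
  have hex : ∃ w ∈ V, jacDet f w ≠ 0 := by
    by_contra! hcon
    obtain ⟨c, hc⟩ := hne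
    exact hJ₁ (eqOn_zero_of_holomorphic hU hUc (differentiableOn_jacDet hU hfP.1) (hVU hc)
      (Filter.eventually_of_mem (hV.mem_nhds hc) hcon) w₁ hw₁)
  obtain ⟨w, hw, hJ⟩ := hex
  obtain ⟨W, hW, hWo, hwW⟩ := _root_.mem_nhds_iff.1
    (image_mem_nhds_of_jacDet_ne_zero hU hfP.1 (hV.mem_nhds hw) (hVU hw) hJ)
  obtain ⟨z, hz, hreg⟩ := exists_isRegularValue hU hfP.1 hWo ⟨_, hwW⟩
  obtain ⟨y, hy, hyz⟩ := hW hz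
  exact ⟨y, hy, hyz ▸ hreg⟩

end Openness

/-! ### Fibers with multiplicities and traces of functions in the algebra. -/

noncomputable section Trace

open Filter Topology Metric Set MeasureTheory Complex

variable {n : ℕ} {f : (Fin n → ℂ) → (Fin n → ℂ)} {U G L : Set (Fin n → ℂ)}

/-- Interpolation at finitely many points by entire functions. -/
theorem exists_differentiable_interpolation (P : Finset (Fin n → ℂ)) (h : (Fin n → ℂ) → ℂ) :
    ∃ p : (Fin n → ℂ) → ℂ, Differentiable ℂ p ∧ ∀ a ∈ P, p a = h a := by
  classical
  induction P using Finset.induction_on with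
  | empty => exact ⟨fun _ => 0, by fun_prop, by simp⟩
  | insert a P ha ih =>
    obtain ⟨p, hp, hpP⟩ := ih
    have hsep : ∀ b ∈ P, ∃ q : (Fin n → ℂ) → ℂ, Differentiable ℂ q ∧ q b = 0 ∧ q a = 1 := by
      intro b hb
      obtain ⟨i, hi⟩ := Function.ne_iff.1 (ne_of_mem_of_not_mem hb ha).symm
      exact ⟨fun w => (w i - b i) / (a i - b i), by fun_prop, by simp,
        div_self (sub_ne_zero.2 hi)⟩
    choose! q hq hqb hqa using hsep
    have hprod : Differentiable ℂ fun w => ∏ b ∈ P, q b w := fun w => by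
      classical
      exact (HasFDerivAt.finsetProd fun b hb => (hq b hb w).hasFDerivAt).differentiableAt
    refine ⟨fun w => p w + (h a - p a) * ∏ b ∈ P, q b w, by fun_prop, ?_⟩
    intro x hx
    rcases Finset.mem_insert.1 hx with rfl | hx
    · simp [Finset.prod_eq_one hqa]
    · have := Finset.prod_eq_zero (f := fun b => q b x) hx (hqb x hx)
      simp [this, hpP x hx]

/-- Only finitely many values of `h` matter, and an entire function can match them: entire functions
separate finite multisets. -/
theorem sum_eq_of_forall_differentiable {m : ℕ} {s t : Fin m → Fin n → ℂ}
    (H : ∀ p : (Fin n → ℂ) → ℂ, Differentiable ℂ p → ∑ j, p (s j) = ∑ j, p (t j))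
    (h : (Fin n → ℂ) → ℂ) : ∑ j, h (s j) = ∑ j, h (t j) := by
  classical
  obtain ⟨p, hp, hph⟩ := exists_differentiable_interpolation
    (Finset.univ.image s ∪ Finset.univ.image t) h
  have h1 := H p hp
  rwa [Finset.sum_congr rfl fun j _ => hph (s j) (by simp),
    Finset.sum_congr rfl fun j _ => hph (t j) (by simp)] at h1

theorem exists_eq_of_forall_sum_eq {m : ℕ} {s t : Fin m → Fin n → ℂ}
    (H : ∀ h : (Fin n → ℂ) → ℂ, ∑ j, h (s j) = ∑ j, h (t j)) (j : Fin m) : ∃ i, s i = t j := by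
  classical
  by_contra! hcon
  have h1 := H fun x => if x = t j then 1 else 0
  rw [Finset.sum_eq_zero fun i _ => if_neg (hcon i), Finset.sum_boole] at h1
  have h2 : (Finset.univ.filter fun i => t i = t j).card = 0 := by exact_mod_cast h1.symm
  rw [Finset.card_eq_zero] at h2
  exact Finset.notMem_empty j (h2 ▸ Finset.mem_filter.2 ⟨Finset.mem_univ j, rfl⟩)

/-- `t` enumerates, with multiplicities, the fibers of the proper map `f : U → G`. -/
structure IsFiberTuple {m : ℕ} (f : (Fin n → ℂ) → (Fin n → ℂ)) (U G : Set (Fin n → ℂ))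
    (t : (Fin n → ℂ) → Fin m → Fin n → ℂ) : Prop where
  mem : ∀ z ∈ G, ∀ j, t z j ∈ U ∧ f (t z j) = z
  injective : ∀ z ∈ G, IsRegularValue f U z → Function.Injective (t z)
  range_eq : ∀ z ∈ G, IsRegularValue f U z → range (t z) = U ∩ f ⁻¹' {z}
  -- Continuity is asked of symmetric sums only, since the labelling of the fiber need not be
  -- continuous. It says that the multiset of the `t z j` varies continuously.
  continuousOn : ∀ p : (Fin n → ℂ) → ℂ, Differentiable ℂ p →
    ContinuousOn (fun z => ∑ j, p (t z j)) G

theorem exists_enum_of_isRegularValue (hU : IsOpen U) (hfP : IsProperHolomorphic f U G) {m : ℕ}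
    (hm : ∀ z ∈ G, IsRegularValue f U z → (U ∩ f ⁻¹' {z}).ncard = m) {z : Fin n → ℂ}
    (hz : z ∈ G) (hreg : IsRegularValue f U z) :
    ∃ s : Fin m → Fin n → ℂ, Function.Injective s ∧ range s = U ∩ f ⁻¹' {z} := by
  have hfin := hfP.finite_fiber hU hz hreg
  have hcard : hfin.toFinset.card = m := by
    rw [← ncard_eq_toFinset_card _ hfin]; exact hm z hz hreg
  set e := hfin.toFinset.equivFinOfCardEq hcard
  refine ⟨fun j => (e.symm j : Fin n → ℂ), fun a b hab => e.symm.injective (Subtype.ext hab), ?_⟩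
  ext w
  constructor
  · rintro ⟨j, rfl⟩
    exact hfin.mem_toFinset.1 (e.symm j).2
  · intro hw
    exact ⟨e ⟨w, hfin.mem_toFinset.2 hw⟩, by simp⟩

theorem fiberSum_eq_sum {m : ℕ} {s : Fin m → Fin n → ℂ} {z : Fin n → ℂ}
    (hs : Function.Injective s) (hr : range s = U ∩ f ⁻¹' {z}) (h : (Fin n → ℂ) → ℂ) :
    fiberSum f U h z = ∑ j, h (s j) := by
  rw [fiberSum, ← hr, finsum_mem_range hs, finsum_eq_sum_of_fintype]

theorem exists_isFiberTuple (hU : IsOpen U) (hG : IsOpen G) (hGc : IsPreconnected G)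
    (hfP : IsProperHolomorphic f U G) :
    ∃ (m : ℕ) (t : (Fin n → ℂ) → Fin m → Fin n → ℂ), IsFiberTuple f U G t := by
  classical
  obtain ⟨m, hm⟩ := exists_degree hU hG hGc hfP
  set A : Set (Fin n → ℂ) := {z | z ∈ G ∧ IsRegularValue f U z}
  have henum : ∀ z ∈ A, ∃ s : Fin m → Fin n → ℂ,
      Function.Injective s ∧ range s = U ∩ f ⁻¹' {z} := fun z hz =>
    exists_enum_of_isRegularValue hU hfP hm hz.1 hz.2
  choose! t₀ ht₀i ht₀r using henum
  have ht₀m : ∀ z ∈ A, ∀ j, t₀ z j ∈ U ∧ f (t₀ z j) = z := fun z hz j => by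
    have : t₀ z j ∈ U ∩ f ⁻¹' {z} := ht₀r z hz ▸ mem_range_self j
    exact this
  -- Over a critical value the tuple is a limit, along an ultrafilter, of tuples over regular
  -- values. Over a regular value the principal ultrafilter is used, so that every point is
  -- described as such a limit.
  have hlim : ∀ z ∈ G, ∃ s : Fin m → Fin n → ℂ, (∀ j, s j ∈ U ∧ f (s j) = z) ∧
      (z ∈ A → s = t₀ z) ∧
      ∃ u : Ultrafilter (Fin n → ℂ), (u : Filter (Fin n → ℂ)) ≤ 𝓝[A] z ∧ Tendsto t₀ u (𝓝 s) := by
    intro z hz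
    by_cases hzA : z ∈ A
    · exact ⟨t₀ z, ht₀m z hzA, fun _ => rfl, pure z, pure_le_nhdsWithin hzA,
        tendsto_pure_nhds t₀ z⟩
    have hcl : z ∈ closure A := by
      refine mem_closure_iff_nhds.2 fun V hV => ?_
      obtain ⟨W, hW, hWo, hzW⟩ := _root_.mem_nhds_iff.1 (inter_mem hV (hG.mem_nhds hz))
      obtain ⟨y, hy, hyr⟩ := exists_isRegularValue hU hfP.1 hWo ⟨z, hzW⟩
      exact ⟨y, (hW hy).1, (hW hy).2, hyr⟩
    have : (𝓝[A] z).NeBot := mem_closure_iff_nhdsWithin_neBot.1 hcl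
    set u := Ultrafilter.of (𝓝[A] z)
    have hu : (u : Filter _) ≤ 𝓝[A] z := Ultrafilter.of_le _
    obtain ⟨R, hR, hRG⟩ := Metric.nhds_basis_closedBall.mem_iff.1 (hG.mem_nhds hz)
    set K := U ∩ f ⁻¹' closedBall z R
    have hK : IsCompact K := hfP.2.2 _ hRG (isCompact_closedBall _ _)
    have hev : ∀ᶠ y in (u : Filter _), y ∈ A ∧ y ∈ closedBall z R :=
      hu ((eventually_mem_nhdsWithin).and
        (mem_nhdsWithin_of_mem_nhds (closedBall_mem_nhds z hR)))
    have hj : ∀ j, ∃ a ∈ K, Tendsto (fun y => t₀ y j) u (𝓝 a) := fun j =>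
      hK.ultrafilter_le_nhds (u.map fun y => t₀ y j) (le_principal_iff.2 (by
        refine hev.mono fun y hy => ⟨(ht₀m y hy.1 j).1, ?_⟩
        rw [mem_preimage, (ht₀m y hy.1 j).2]
        exact hy.2))
    choose s hsK hs using hj
    refine ⟨s, fun j => ⟨(hsK j).1, ?_⟩, fun h => absurd h hzA, u, hu, tendsto_pi_nhds.2 hs⟩
    have h1 : Tendsto (fun y => f (t₀ y j)) u (𝓝 (f (s j))) :=
      ((hfP.1.continuousOn (s j) (hsK j).1).continuousAt (hU.mem_nhds (hsK j).1)).tendsto.comp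
        (hs j)
    have h2 : Tendsto (fun y => f (t₀ y j)) u (𝓝 z) := by
      have : Tendsto (fun y : Fin n → ℂ => y) u (𝓝 z) := hu.trans nhdsWithin_le_nhds
      exact this.congr' (hev.mono fun y hy => (ht₀m y hy.1 j).2.symm)
    exact tendsto_nhds_unique h1 h2
  choose! t ht htA u hu htu using hlim
  refine ⟨m, t, ⟨ht, fun z hz hreg => ?_, fun z hz hreg => ?_, fun p hp z₀ hz₀ => ?_⟩⟩
  · rw [htA z hz ⟨hz, hreg⟩]; exact ht₀i z ⟨hz, hreg⟩
  · rw [htA z hz ⟨hz, hreg⟩]; exact ht₀r z ⟨hz, hreg⟩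
  refine ContinuousAt.continuousWithinAt ?_
  obtain ⟨ρ, hρ, hρG⟩ := Metric.nhds_basis_closedBall.mem_iff.1 (hG.mem_nhds hz₀)
  set R := ρ / 3 with hRdef
  have hR : 0 < R := by positivity
  obtain ⟨C, hC⟩ := exists_lipschitz_fiberSum hU hfP (z₀ := z₀) (R := R)
    (by rwa [hRdef, mul_div_cancel₀ ρ three_ne_zero]) hG hR hp.differentiableOn
  have hsub : ball z₀ (R / 2) ⊆ G :=
    ((ball_subset_ball (by linarith)).trans ball_subset_closedBall).trans hρG
  have hN : ∀ x ∈ G, Tendsto (fun y => fiberSum f U p y) (u x) (𝓝 (∑ j, p (t x j))) := by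
    intro x hx
    have h1 : Tendsto (fun y => ∑ j, p (t₀ y j)) (u x) (𝓝 (∑ j, p (t x j))) :=
      tendsto_finsetSum _ fun j _ => (hp.continuous.tendsto _).comp
        (((continuous_apply j).tendsto _).comp (htu x hx))
    refine h1.congr' ((hu x hx) ?_)
    filter_upwards [self_mem_nhdsWithin] with y hy
    exact (fiberSum_eq_sum (ht₀i y hy) (ht₀r y hy) p).symm
  have hid : ∀ x ∈ G, Tendsto (fun y : Fin n → ℂ => y) (u x) (𝓝 x) := fun x hx =>
    (hu x hx).trans nhdsWithin_le_nhds
  -- The Lipschitz bound on regular values extends to all points by taking the limits along `u x`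
  -- and `u y` together; this also removes the dependence on the chosen ultrafilters.
  have hlip : ∀ x ∈ ball z₀ (R / 2), ∀ y ∈ ball z₀ (R / 2),
      dist (∑ j, p (t x j)) (∑ j, p (t y j)) ≤ C * dist x y := by
    intro x hx y hy
    have hxG := hsub hx
    have hyG := hsub hy
    have l1 := ((hN x hxG).comp (tendsto_fst (g := (u y : Filter (Fin n → ℂ))))).dist
      ((hN y hyG).comp (tendsto_snd (f := (u x : Filter (Fin n → ℂ)))))
    have l2 := (((hid x hxG).comp (tendsto_fst (g := (u y : Filter (Fin n → ℂ))))).dist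
      ((hid y hyG).comp (tendsto_snd (f := (u x : Filter (Fin n → ℂ)))))).const_mul C
    refine le_of_tendsto_of_tendsto l1 l2 ?_
    have e1 : ∀ x ∈ ball z₀ (R / 2), ∀ᶠ a in (u x : Filter (Fin n → ℂ)),
        a ∈ A ∧ a ∈ ball z₀ (R / 2) := fun x hx =>
      (hu x (hsub hx)) ((eventually_mem_nhdsWithin).and
        (mem_nhdsWithin_of_mem_nhds (isOpen_ball.mem_nhds hx)))
    filter_upwards [(e1 x hx).prod_mk (e1 y hy)] with q hq
    exact hC q.1 hq.1.2 q.2 hq.2.2 hq.1.1.2 hq.2.1.2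
  refine tendsto_iff_dist_tendsto_zero.2 (squeeze_zero' (Eventually.of_forall fun _ =>
    dist_nonneg) (g := fun x => C * dist x z₀) ?_ ?_)
  · filter_upwards [ball_mem_nhds z₀ (by positivity : (0:ℝ) < R / 2)] with x hx
    exact hlip x hx z₀ (mem_ball_self (by positivity))
  · have := (show Continuous fun x => C * dist x z₀ by fun_prop).tendsto z₀
    simpa using this

section Tuple

variable {m : ℕ} {t : (Fin n → ℂ) → Fin m → Fin n → ℂ}

/-- Properness gives a limit tuple along any ultrafilter. Its sums against entire functions agree
with those of `t z₀`, so it is `t z₀` up to order. -/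
theorem IsFiberTuple.exists_tendsto (ht : IsFiberTuple f U G t) (hG : IsOpen G)
    (hfP : IsProperHolomorphic f U G) {z₀ : Fin n → ℂ} (hz₀ : z₀ ∈ G)
    {u : Ultrafilter (Fin n → ℂ)} (hu : (u : Filter (Fin n → ℂ)) ≤ 𝓝 z₀) :
    ∃ s : Fin m → Fin n → ℂ, Tendsto t u (𝓝 s) ∧
      ∀ h : (Fin n → ℂ) → ℂ, ∑ j, h (s j) = ∑ j, h (t z₀ j) := by
  obtain ⟨R, hR, hRG⟩ := Metric.nhds_basis_closedBall.mem_iff.1 (hG.mem_nhds hz₀)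
  have hK : IsCompact (U ∩ f ⁻¹' closedBall z₀ R) := hfP.2.2 _ hRG (isCompact_closedBall _ _)
  have hj : ∀ j, ∃ a ∈ U ∩ f ⁻¹' closedBall z₀ R, Tendsto (fun y => t y j) u (𝓝 a) := fun j =>
    hK.ultrafilter_le_nhds (u.map fun y => t y j) (le_principal_iff.2 (by
      refine hu ?_
      filter_upwards [closedBall_mem_nhds z₀ hR] with y hy
      have := ht.mem y (hRG hy) j
      refine ⟨this.1, ?_⟩
      rw [mem_preimage, this.2]
      exact hy))
  choose s hsK hs using hj
  refine ⟨s, tendsto_pi_nhds.2 hs, sum_eq_of_forall_differentiable fun p hp => ?_⟩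
  have h1 : Tendsto (fun y => ∑ j, p (t y j)) u (𝓝 (∑ j, p (s j))) :=
    tendsto_finsetSum _ fun j _ => (hp.continuous.tendsto _).comp (hs j)
  have h2 : Tendsto (fun y => ∑ j, p (t y j)) u (𝓝 (∑ j, p (t z₀ j))) :=
    ((ht.continuousOn p hp).continuousAt (hG.mem_nhds hz₀)).tendsto.mono_left hu
  exact tendsto_nhds_unique h1 h2

/-- Fiber points over the boundary of `L` are limits of points over `L`; functions of the algebra
are controlled only on the closure of the preimage. -/
theorem IsFiberTuple.mem_closure (ht : IsFiberTuple f U G t) (hG : IsOpen G)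
    (hfP : IsProperHolomorphic f U G) (hLG : closure L ⊆ G) {z : Fin n → ℂ} (hz : z ∈ closure L)
    (j : Fin m) : t z j ∈ closure (U ∩ f ⁻¹' L) := by
  obtain ⟨u, huL, hu⟩ := mem_closure_iff_ultrafilter.1 hz
  obtain ⟨s, hs, hsum⟩ := ht.exists_tendsto hG hfP (hLG hz) hu
  obtain ⟨i, hi⟩ := exists_eq_of_forall_sum_eq hsum j
  rw [← hi]
  refine mem_closure_of_tendsto (((continuous_apply i).tendsto s).comp hs) ?_
  filter_upwards [huL] with y hy
  have := ht.mem y (hLG (subset_closure hy)) i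
  refine ⟨this.1, ?_⟩
  rw [mem_preimage, Function.comp_apply, this.2]
  exact hy

theorem IsFiberTuple.continuousOn_sum (ht : IsFiberTuple f U G t) (hG : IsOpen G)
    (hfP : IsProperHolomorphic f U G) (hLG : closure L ⊆ G) {h : (Fin n → ℂ) → ℂ}
    (hh : ContinuousOn h (closure (U ∩ f ⁻¹' L))) :
    ContinuousOn (fun z => ∑ j, h (t z j)) (closure L) := by
  intro z₀ hz₀
  refine tendsto_iff_ultrafilter _ _ _ |>.2 fun u hu => ?_
  obtain ⟨s, hs, hsum⟩ := ht.exists_tendsto hG hfP (hLG hz₀) (hu.trans nhdsWithin_le_nhds)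
  change Tendsto _ _ (𝓝 (∑ j, h (t z₀ j)))
  rw [← hsum h]
  have hmem : ∀ j, ∀ᶠ y in (u : Filter (Fin n → ℂ)), t y j ∈ closure (U ∩ f ⁻¹' L) := fun j =>
    hu (eventually_mem_nhdsWithin.mono fun y hy => ht.mem_closure hG hfP hLG hy j)
  refine tendsto_finsetSum _ fun j _ => ?_
  have hsj : Tendsto (fun y => t y j) u (𝓝 (s j)) := ((continuous_apply j).tendsto s).comp hs
  have hsmem : s j ∈ closure (U ∩ f ⁻¹' L) :=
    isClosed_closure.mem_of_tendsto hsj (hmem j)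
  exact (hh (s j) hsmem).tendsto.comp (tendsto_nhdsWithin_iff.2 ⟨hsj, hmem j⟩)

/-- The trace of a function of the algebra of the preimage is in the algebra of the target. -/
theorem IsFiberTuple.diffContOnCl_sum (ht : IsFiberTuple f U G t) (hU : IsOpen U) (hG : IsOpen G)
    (hfP : IsProperHolomorphic f U G) (hL : IsOpen L) (hLG : closure L ⊆ G)
    {h : (Fin n → ℂ) → ℂ} (hh : DiffContOnCl ℂ h (U ∩ f ⁻¹' L)) :
    DiffContOnCl ℂ (fun z => ∑ j, h (t z j)) L := by
  have hcont := ht.continuousOn_sum hG hfP hLG hh.continuousOn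
  refine ⟨fun z₀ hz₀ => DifferentiableAt.differentiableWithinAt ?_, hcont⟩
  have hLsub : L ⊆ G := subset_closure.trans hLG
  set Λ := U ∩ f ⁻¹' L with hΛ
  have hΛo : IsOpen Λ := hfP.1.continuousOn.isOpen_inter_preimage hU hL
  have hP : IsProperHolomorphic f Λ L := by
    refine ⟨hfP.1.mono inter_subset_left, fun w hw => hw.2, fun C hC hCc => ?_⟩
    have : Λ ∩ f ⁻¹' C = U ∩ f ⁻¹' C := by
      ext w
      exact ⟨fun hw => ⟨hw.1.1, hw.2⟩, fun hw => ⟨⟨hw.1, hC hw.2⟩, hw.2⟩⟩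
    rw [this]
    exact hfP.2.2 C (hC.trans hLsub) hCc
  have hsumreg : ∀ z ∈ L, IsRegularValue f U z →
      IsRegularValue f Λ z ∧ fiberSum f Λ h z = ∑ j, h (t z j) := by
    intro z hz hreg
    refine ⟨fun w hw => hreg w hw.1, fiberSum_eq_sum (ht.injective z (hLsub hz) hreg) ?_ h⟩
    rw [ht.range_eq z (hLsub hz) hreg]
    ext w
    refine ⟨fun hw => ⟨⟨hw.1, ?_⟩, hw.2⟩, fun hw => ⟨hw.1.1, hw.2⟩⟩
    rw [mem_preimage, mem_singleton_iff.1 hw.2]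
    exact hz
  obtain ⟨ρ, hρ, hρL⟩ := Metric.nhds_basis_closedBall.mem_iff.1 (hL.mem_nhds hz₀)
  set R := ρ / 3 with hRdef
  have hR : 0 < R := by positivity
  have hball : closedBall z₀ (3 * R) ⊆ L := by
    rwa [hRdef, mul_div_cancel₀ ρ three_ne_zero]
  have hsub : ball z₀ (R / 2) ⊆ L :=
    ((ball_subset_ball (by linarith)).trans ball_subset_closedBall).trans hρL
  obtain ⟨C, hC, hbd⟩ := exists_bound_smoothTrace hΛo hP hball hL hR
  obtain ⟨M, hM⟩ := (hP.2.2 _ hball (isCompact_closedBall _ _)).exists_bound_of_continuousOn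
    (hh.differentiableOn.continuousOn.mono inter_subset_left)
  have hbd' := hbd h (max M 0) (le_max_right _ _)
    fun w hw => (hM w hw).trans (le_max_left _ _)
  set T := fun i => smoothTrace f Λ h (shrinkingKernel n i) with hT
  have hTd : ∀ᶠ i in atTop, DifferentiableOn ℂ (T i) (ball z₀ (2 * R)) := by
    filter_upwards [(tendsto_shrinkingBump_rOut (n := n)).eventually_le_const hR] with i hi
    exact differentiableOn_smoothTrace_ball hΛo hP hball hh.differentiableOn hi
  -- It remains to prove convergence at every `z`, regular or not: compare with a nearby regular
  -- value `y`, using the common Lipschitz constant `B` of the smoothed traces and the continuity of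
  -- the trace.
  refine differentiableAt_of_tendsto_of_bounded (T := T) (r := R / 2) (l := atTop)
    (M := max M 0 * C) (by positivity)
    (hTd.mono fun i hi => hi.mono (ball_subset_ball (by linarith)))
    (hbd'.mono fun i hi z hz => hi z (ball_subset_ball (by linarith) hz)) fun z hz => ?_
  set B := 2 * (max M 0 * C) / R with hB
  have hB0 : 0 ≤ B := by positivity
  rw [Metric.tendsto_nhds]
  intro ε hε
  have hcz : ContinuousAt (fun z => ∑ j, h (t z j)) z :=
    (hcont z (subset_closure (hsub hz))).continuousAt
      (mem_of_superset (hL.mem_nhds (hsub hz)) subset_closure)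
  obtain ⟨δ, hδ, hδs⟩ := Metric.mem_nhds_iff.1 (inter_mem (isOpen_ball.mem_nhds hz)
    (hcz.preimage_mem_nhds (ball_mem_nhds _ (by positivity : 0 < ε / 3))))
  obtain ⟨y, hy, hyr⟩ := exists_isRegularValue hU hfP.1
    (isOpen_ball (x := z) (ε := min δ (ε / (3 * (B + 1))))) ⟨z, mem_ball_self (by positivity)⟩
  have hyz := mem_ball.1 hy
  have hyδ := hδs (mem_ball.2 (hyz.trans_le (min_le_left _ _)))
  obtain ⟨hyr', hysum⟩ := hsumreg y (hsub hyδ.1) hyr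
  have hlim := tendsto_smoothTrace hΛo hL hP.1 hP.2.2 hh.differentiableOn.continuousOn
    (hsub hyδ.1) hyr'
  rw [hysum] at hlim
  filter_upwards [Metric.tendsto_nhds.1 hlim (ε / 3) (by positivity), hbd', hTd] with i h1 h2 h3
  have h4 : dist (T i z) (T i y) ≤ B * dist z y :=
    dist_le_of_bounded_holomorphic h3 h2 hz hyδ.1
  have h5 : B * dist z y ≤ ε / 3 := by
    have h6 : dist z y ≤ ε / (3 * (B + 1)) := by
      rw [dist_comm]; exact hyz.le.trans (min_le_right _ _)
    calc B * dist z y ≤ (B + 1) * (ε / (3 * (B + 1))) := by gcongr; linarith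
      _ = ε / 3 := by field_simp
  have h7 := mem_ball.1 (mem_preimage.1 hyδ.2)
  have h8 := dist_triangle4 (T i z) (T i y) (∑ j, h (t y j)) (∑ j, h (t z j))
  have h1' : dist (T i y) (∑ j, h (t y j)) < ε / 3 := h1
  linarith

end Tuple

end Trace

/-! ### Existence of the Shilov boundary and its behaviour under proper maps. -/

noncomputable section Shilov

open Filter Topology Metric Set

section General

variable {V : Type*} [NormedAddCommGroup V] [NormedSpace ℂ V] {D S : Set V}

theorem DiffContOnCl.mul_complex {g h : V → ℂ} (hg : DiffContOnCl ℂ g D)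
    (hh : DiffContOnCl ℂ h D) : DiffContOnCl ℂ (fun x => g x * h x) D :=
  ⟨hg.1.mul hh.1, hg.2.mul hh.2⟩

theorem DiffContOnCl.pow_complex {g : V → ℂ} (hg : DiffContOnCl ℂ g D) (k : ℕ) :
    DiffContOnCl ℂ (fun x => g x ^ k) D :=
  ⟨hg.1.pow k, hg.2.pow k⟩

theorem isClosedBoundary_closure : IsClosedBoundary D (closure D) :=
  ⟨isClosed_closure, Subset.rfl, fun _ _ x hx => ⟨x, hx, le_rfl⟩⟩

theorem shilovBoundary_subset (h : IsClosedBoundary D S) : shilovBoundary D ⊆ S :=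
  sInter_subset_of_mem h

theorem isShilovBoundary_of_isClosedBoundary (h : IsClosedBoundary D (shilovBoundary D)) :
    IsShilovBoundary D (shilovBoundary D) :=
  ⟨h, fun _ hT => shilovBoundary_subset hT⟩

/-- A closed boundary consisting of peak points is the Shilov boundary. -/
theorem isShilovBoundary_of_peak (h : IsClosedBoundary D S)
    (hpeak : ∀ u ∈ S, ∃ g : V → ℂ, DiffContOnCl ℂ g D ∧
      ∀ y ∈ closure D, ‖g u‖ ≤ ‖g y‖ → y = u) : IsShilovBoundary D S := by
  refine ⟨h, fun T hT u hu => ?_⟩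
  obtain ⟨g, hg, hgu⟩ := hpeak u hu
  obtain ⟨y, hy, hle⟩ := hT.2.2 g hg u (h.2.1 hu)
  rwa [← hgu y (hT.2.1 hy) hle]

end General

section Existence

variable {n : ℕ} {D : Set (Fin n → ℂ)}

/-- A ball which misses one closed boundary can be removed from all closed boundaries. -/
theorem IsClosedBoundary.sdiff_ball (hD : IsCompact (closure D)) {E F : Set (Fin n → ℂ)}
    (hE : IsClosedBoundary D E) (hF : IsClosedBoundary D F) {p : Fin n → ℂ} {r : ℝ} (hr : 0 < r)
    (hFp : Disjoint F (ball p r)) : IsClosedBoundary D (E \ ball p r) := by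
  refine ⟨hE.1.sdiff isOpen_ball, sdiff_subset.trans hE.2.1, fun g₀ hg₀ x₀ hx₀ => ?_⟩
  by_contra! hcon
  have hEc : IsCompact (E \ ball p r) :=
    hD.of_isClosed_subset (hE.1.sdiff isOpen_ball) (sdiff_subset.trans hE.2.1)
  obtain ⟨g, hg, x, hx, c, hc0, hc, hcE⟩ : ∃ g : (Fin n → ℂ) → ℂ, DiffContOnCl ℂ g D ∧
      ∃ x ∈ closure D, ∃ c : ℝ, 0 ≤ c ∧ c < ‖g x‖ ∧ ∀ y ∈ E \ ball p r, ‖g y‖ ≤ c := by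
    rcases (E \ ball p r).eq_empty_or_nonempty with hemp | hne
    · exact ⟨fun _ => 1, diffContOnCl_const, x₀, hx₀, 0, le_rfl, by simp, by simp [hemp]⟩
    · obtain ⟨y, hy, hmax⟩ := hEc.exists_isMaxOn hne
        (hg₀.continuousOn.norm.mono (sdiff_subset.trans hE.2.1))
      exact ⟨g₀, hg₀, x₀, hx₀, ‖g₀ y‖, norm_nonneg _, hcon y hy, fun z hz => hmax hz⟩
  obtain ⟨x₁, hx₁, hmax⟩ := hD.exists_isMaxOn ⟨x, hx⟩ hg.continuousOn.norm
  set M := ‖g x₁‖ with hM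
  have hcM : c < M := hc.trans_le (hmax hx)
  have hM0 : 0 < M := hc0.trans_lt hcM
  obtain ⟨C, hC⟩ := hD.exists_bound_of_continuousOn (f := fun y : Fin n → ℂ => y - p) (by fun_prop)
  have hlim : Tendsto (fun k : ℕ => (c / M) ^ k * (C / r)) atTop (𝓝 (0 * (C / r))) :=
    (tendsto_pow_atTop_nhds_zero_of_lt_one (by positivity) ((div_lt_one hM0).2 hcM)).mul_const _
  rw [zero_mul] at hlim
  obtain ⟨k, hk⟩ := (hlim.eventually_lt_const one_pos).exists
  obtain ⟨y, hyF, hy⟩ := hF.2.2 g hg x₁ hx₁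
  have hyD := hF.2.1 hyF
  have hyM : ‖g y‖ = M := le_antisymm (hmax hyD) hy
  refine Set.disjoint_left.1 hFp hyF ?_
  rw [mem_ball, dist_eq_norm, pi_norm_lt_iff hr]
  intro i
  -- On `E`, `|q| < 1`: inside the ball by the factor `(w i - p i) / r`, outside because `(c / M) ^
  -- k` is small. As `E` is a boundary, `|q y| < 1` too, and `|g y| = M` gives `|y i - p i| < r`. In
  -- the sup norm, all coordinates together put `y` in the ball, which `F` misses.
  set q : (Fin n → ℂ) → ℂ := fun w => (g w / M) ^ k * ((w i - p i) / r) with hq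
  have hqd : DiffContOnCl ℂ q D := by
    have h1 : DiffContOnCl ℂ (fun w => g w / M) D := by
      simpa only [div_eq_mul_inv] using hg.mul_complex (diffContOnCl_const (c := (M : ℂ)⁻¹))
    refine (h1.pow_complex k).mul_complex (Differentiable.diffContOnCl ?_)
    fun_prop
  have hqn : ∀ w, ‖q w‖ = (‖g w‖ / M) ^ k * (‖w i - p i‖ / r) := fun w => by
    simp [hq, abs_of_pos hM0, abs_of_pos hr]
  have hqE : ∀ w ∈ E, ‖q w‖ < 1 := by
    intro w hw
    rw [hqn]
    by_cases hwb : w ∈ ball p r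
    · have h1 : ‖w i - p i‖ < r := by
        rw [mem_ball, dist_eq_norm, pi_norm_lt_iff hr] at hwb
        exact hwb i
      have h2 : (‖g w‖ / M) ^ k ≤ 1 :=
        pow_le_one₀ (by positivity) ((div_le_one hM0).2 (hmax (hE.2.1 hw)))
      have h3 : ‖w i - p i‖ / r < 1 := (div_lt_one hr).2 h1
      exact (mul_le_of_le_one_left (by positivity) h2).trans_lt h3
    · have h1 : ‖w i - p i‖ ≤ C := (norm_le_pi_norm (w - p) i).trans (hC w (hE.2.1 hw))
      have h2 := hcE w ⟨hw, hwb⟩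
      refine lt_of_le_of_lt ?_ hk
      gcongr
  obtain ⟨w, hw, hle⟩ := hE.2.2 q hqd y hyD
  have h1 := hle.trans_lt (hqE w hw)
  rw [hqn, hyM, div_self hM0.ne', one_pow, one_mul, div_lt_one hr] at h1
  exact h1

/-- The Shilov boundary exists. -/
theorem isShilovBoundary_shilovBoundary (hD : IsCompact (closure D)) :
    IsShilovBoundary D (shilovBoundary D) := by
  refine isShilovBoundary_of_isClosedBoundary ⟨isClosed_sInter fun S hS => hS.1,
    shilovBoundary_subset isClosedBoundary_closure, fun g hg x hx => ?_⟩
  by_contra! hcon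
  obtain ⟨x₁, hx₁, hmax⟩ := hD.exists_isMaxOn ⟨x, hx⟩ hg.continuousOn.norm
  set K := closure D ∩ (fun y => ‖g y‖) ⁻¹' {‖g x₁‖} with hK
  have hKc : IsCompact K := hD.of_isClosed_subset
    (hg.continuousOn.norm.preimage_isClosed_of_isClosed isClosed_closure isClosed_singleton)
    inter_subset_left
  -- If `g` does not peak on the intersection of all closed boundaries, each point of its compact
  -- maximum set `K` is missed by one of them. Finitely many balls cover `K`; removing them one by
  -- one leaves a closed boundary disjoint from `K`.
  have hmiss : ∀ p ∈ K, ∃ r > 0, ∃ F, IsClosedBoundary D F ∧ Disjoint F (ball p r) := by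
    intro p hp
    have hpS : p ∉ shilovBoundary D := fun h => by
      have h1 := hcon p h
      have h2 : ‖g p‖ = ‖g x₁‖ := hp.2
      have h3 : ‖g x‖ ≤ ‖g x₁‖ := hmax hx
      linarith
    simp only [shilovBoundary, mem_sInter, not_forall] at hpS
    obtain ⟨F, hF, hpF⟩ := hpS
    obtain ⟨r, hr, hrF⟩ := Metric.isOpen_iff.1 hF.1.isOpen_compl p hpF
    exact ⟨r, hr, F, hF, Set.disjoint_left.2 fun y hy hyb => hrF hyb hy⟩
  choose! r hr F hF hdisj using hmiss
  obtain ⟨t, ht, hcov⟩ := hKc.elim_nhds_subcover (fun p => ball p (r p))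
    fun p hp => ball_mem_nhds p (hr p hp)
  have hrem : ∀ s : Finset (Fin n → ℂ), (∀ p ∈ s, p ∈ K) →
      IsClosedBoundary D (closure D \ ⋃ p ∈ s, ball p (r p)) := by
    classical
    intro s
    induction s using Finset.induction_on with
    | empty => intro _; simpa using isClosedBoundary_closure
    | insert a s _ ih =>
      intro hs
      have h1 := ih fun p hp => hs p (Finset.mem_insert_of_mem hp)
      have ha := hs a (Finset.mem_insert_self a s)
      have h2 := h1.sdiff_ball hD (hF a ha) (hr a ha) (hdisj a ha)
      convert h2 using 1
      rw [Finset.set_biUnion_insert, sdiff_sdiff, union_comm]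
  obtain ⟨y, hy, hle⟩ := (hrem t ht).2.2 g hg x₁ hx₁
  have hyK : y ∈ K := ⟨hy.1, le_antisymm (hmax hy.1) hle⟩
  exact hy.2 (hcov hyK)

end Existence

section Proper

variable {n : ℕ} {D G L : Set (Fin n → ℂ)} {f : (Fin n → ℂ) → (Fin n → ℂ)}

theorem closure_preimage_subset (hf : IsProperHolomorphic f D G) (hL : RelCompactIn L G) :
    closure (D ∩ f ⁻¹' L) ⊆ D ∩ f ⁻¹' closure L :=
  closure_minimal (inter_subset_inter_right D (preimage_mono subset_closure))
    (hf.2.2 _ hL.2 hL.1).isClosed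

theorem isCompact_closure_preimage (hf : IsProperHolomorphic f D G) (hL : RelCompactIn L G) :
    IsCompact (closure (D ∩ f ⁻¹' L)) :=
  (hf.2.2 _ hL.2 hL.1).of_isClosed_subset isClosed_closure (closure_preimage_subset hf hL)

/-- The image of a closed boundary under a proper map is a closed boundary. -/
theorem IsClosedBoundary.image (hD : IsDomainSet D) (hG : IsDomainSet G)
    (hf : IsProperHolomorphic f D G) (hL : RelCompactIn L G) {S : Set (Fin n → ℂ)}
    (hS : IsClosedBoundary (D ∩ f ⁻¹' L) S) : IsClosedBoundary L (f '' S) := by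
  have hcl := closure_preimage_subset hf hL
  have hc := isCompact_closure_preimage hf hL
  have hfc : ContinuousOn f (closure (D ∩ f ⁻¹' L)) :=
    hf.1.continuousOn.mono (hcl.trans inter_subset_left)
  have hmaps : MapsTo f (D ∩ f ⁻¹' L) L := fun w hw => hw.2
  refine ⟨((hc.of_isClosed_subset hS.1 hS.2.1).image_of_continuousOn
    (hfc.mono hS.2.1)).isClosed, ?_, fun g hg x hx => ?_⟩
  · rintro _ ⟨w, hw, rfl⟩
    exact (hcl (hS.2.1 hw)).2
  · have hLim : closure L ⊆ f '' closure (D ∩ f ⁻¹' L) := by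
      refine closure_minimal (fun z hz => ?_) (hc.image_of_continuousOn hfc).isClosed
      obtain ⟨w, hw, rfl⟩ := hf.subset_image hD.1 hG.1 hG.2.isPreconnected hD.2.nonempty
        (hL.2 (subset_closure hz))
      exact ⟨w, subset_closure ⟨hw, hz⟩, rfl⟩
    obtain ⟨w, hw, rfl⟩ := hLim hx
    have hgf : DiffContOnCl ℂ (g ∘ f) (D ∩ f ⁻¹' L) :=
      ⟨hg.1.comp (hf.1.mono inter_subset_left) hmaps,
        hg.2.comp hfc fun w hw => (hcl hw).2⟩
    obtain ⟨y, hy, hle⟩ := hS.2.2 (g ∘ f) hgf w hw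
    exact ⟨f y, mem_image_of_mem f hy, hle⟩

/-- The preimage of a closed boundary under a proper map is a closed boundary. -/
theorem IsClosedBoundary.preimage (hD : IsDomainSet D) (hG : IsDomainSet G)
    (hf : IsProperHolomorphic f D G) (hLo : IsOpen L) (hL : RelCompactIn L G)
    {S : Set (Fin n → ℂ)} (hS : IsClosedBoundary L S) :
    IsClosedBoundary (D ∩ f ⁻¹' L) (closure (D ∩ f ⁻¹' L) ∩ f ⁻¹' S) := by
  have hcl := closure_preimage_subset hf hL
  have hc := isCompact_closure_preimage hf hL
  have hfc : ContinuousOn f (closure (D ∩ f ⁻¹' L)) :=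
    hf.1.continuousOn.mono (hcl.trans inter_subset_left)
  have hΛo : IsOpen (D ∩ f ⁻¹' L) := hf.1.continuousOn.isOpen_inter_preimage hD.1 hLo
  have hclosed := hfc.preimage_isClosed_of_isClosed isClosed_closure hS.1
  refine ⟨hclosed, inter_subset_left, fun h hh x hx => ?_⟩
  by_contra! hcon
  obtain ⟨c, hc0, hcx, hcS⟩ : ∃ c : ℝ, 0 < c ∧ c < ‖h x‖ ∧
      ∀ y ∈ closure (D ∩ f ⁻¹' L) ∩ f ⁻¹' S, ‖h y‖ ≤ c := by
    have hne : ∃ c : ℝ, 0 ≤ c ∧ c < ‖h x‖ ∧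
        ∀ y ∈ closure (D ∩ f ⁻¹' L) ∩ f ⁻¹' S, ‖h y‖ ≤ c := by
      rcases (closure (D ∩ f ⁻¹' L) ∩ f ⁻¹' S).eq_empty_or_nonempty with hemp | hne
      -- The preimage of `S` cannot be empty: testing `S` with a constant yields a point of `S`, and
      -- fiber tuples have at least one entry.
      · exfalso
        obtain ⟨m, t, ht⟩ := exists_isFiberTuple hD.1 hG.1 hG.2.isPreconnected hf
        obtain ⟨w₀, hw₀⟩ := closure_nonempty_iff.1 ⟨x, hx⟩
        obtain ⟨w, hw, hreg⟩ := hf.exists_mem_isRegularValue hD.1 hD.2.isPreconnected hG.1 hΛo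
          inter_subset_left ⟨w₀, hw₀⟩
        obtain ⟨j, -⟩ : w ∈ range (t (f w)) := by
          rw [ht.range_eq _ (hf.2.1 hw.1) hreg]; exact ⟨hw.1, rfl⟩
        obtain ⟨y, hyS, -⟩ := hS.2.2 (fun _ => 1) diffContOnCl_const (f w) (subset_closure hw.2)
        have : t y j ∈ closure (D ∩ f ⁻¹' L) ∩ f ⁻¹' S := by
          refine ⟨ht.mem_closure hG.1 hf hL.2 (hS.2.1 hyS) j, ?_⟩
          rw [mem_preimage, (ht.mem y (hL.2 (hS.2.1 hyS)) j).2]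
          exact hyS
        rw [hemp] at this
        exact this
      · obtain ⟨y, hy, hmax⟩ := (hc.of_isClosed_subset hclosed inter_subset_left).exists_isMaxOn
          hne (hh.continuousOn.norm.mono inter_subset_left)
        exact ⟨‖h y‖, norm_nonneg _, hcon y hy, fun z hz => hmax hz⟩
    obtain ⟨c, h0, h1, h2⟩ := hne
    obtain ⟨c', h3, h4⟩ := exists_between h1
    exact ⟨c', h0.trans_lt h3, h4, fun y hy => (h2 y hy).trans h3.le⟩
  have hopen : IsOpen ((D ∩ f ⁻¹' L) ∩ (fun w => ‖h w‖) ⁻¹' Ioi c) :=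
    hh.differentiableOn.continuousOn.norm.isOpen_inter_preimage hΛo isOpen_Ioi
  have hnonempty : ((D ∩ f ⁻¹' L) ∩ (fun w => ‖h w‖) ⁻¹' Ioi c).Nonempty := by
    have h1 := (hh.continuousOn.norm x hx).mono subset_closure
    have h2 : (𝓝[D ∩ f ⁻¹' L] x).NeBot := mem_closure_iff_nhdsWithin_neBot.1 hx
    obtain ⟨w, hw1, hw2⟩ := ((h1.tendsto.eventually_const_lt hcx).and
      eventually_mem_nhdsWithin).exists
    exact ⟨w, hw2, hw1⟩
  obtain ⟨w, ⟨hwΛ, hwc⟩, hreg⟩ := hf.exists_mem_isRegularValue hD.1 hD.2.isPreconnected hG.1 hopen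
    (inter_subset_left.trans inter_subset_left) hnonempty
  obtain ⟨m, t, ht⟩ := exists_isFiberTuple hD.1 hG.1 hG.2.isPreconnected hf
  have hzG : f w ∈ G := hf.2.1 hwΛ.1
  have hrange := ht.range_eq _ hzG hreg
  obtain ⟨j₀, hj₀⟩ : w ∈ range (t (f w)) := by rw [hrange]; exact ⟨hwΛ.1, rfl⟩
  classical
  -- `p` isolates `w` in its fiber, so the trace of `p * h ^ k` at `f w` is `h w ^ k`.
  obtain ⟨p, hp, hpv⟩ := exists_differentiable_interpolation (Finset.univ.image (t (f w)))
    fun a => if a = w then 1 else 0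
  obtain ⟨B, hB⟩ := hc.exists_bound_of_continuousOn hp.continuous.continuousOn
  have hB0 : 0 ≤ B := (norm_nonneg _).trans (hB x hx)
  have hsum : ∀ k : ℕ, ∑ j, p (t (f w) j) * h (t (f w) j) ^ k = h w ^ k := by
    intro k
    rw [Finset.sum_eq_single j₀]
    · rw [hpv _ (by simp), hj₀, if_pos rfl, one_mul]
    · intro j _ hj
      rw [hpv _ (by simp), if_neg, zero_mul]
      exact fun h => hj (ht.injective _ hzG hreg (h.trans hj₀.symm))
    · simp
  -- Over `S` every fiber point lies where `‖h‖ ≤ c`, so the trace has modulus at most `m * B * c ^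
  -- k` there, and `S` is a boundary for `L`.
  have hbound : ∀ k : ℕ, ‖h w‖ ^ k ≤ m * B * c ^ k := by
    intro k
    have hA := ht.diffContOnCl_sum hD.1 hG.1 hf hLo hL.2
      (hp.diffContOnCl.mul_complex (hh.pow_complex k))
    obtain ⟨y, hyS, hle⟩ := hS.2.2 _ hA (f w) (subset_closure hwΛ.2)
    simp only [hsum, norm_pow] at hle
    refine hle.trans ((norm_sum_le_of_le _ (f := fun j => p (t y j) * h (t y j) ^ k)
      (n := fun _ => B * c ^ k) fun j _ => ?_).trans (le_of_eq ?_))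
    · have hmem := ht.mem_closure hG.1 hf hL.2 (hS.2.1 hyS) j
      rw [norm_mul, norm_pow]
      have h1 := hB _ hmem
      have h2 : ‖h (t y j)‖ ≤ c := hcS _ ⟨hmem, by
        rw [mem_preimage, (ht.mem y (hL.2 (hS.2.1 hyS)) j).2]; exact hyS⟩
      gcongr
    · simp [mul_assoc]
  have hratio : 1 < ‖h w‖ / c := (one_lt_div hc0).2 hwc
  obtain ⟨k, hk⟩ := pow_unbounded_of_one_lt (m * B) hratio
  rw [div_pow, lt_div_iff₀ (by positivity)] at hk
  exact absurd (hbound k) (not_le.2 hk)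

/-- Proper holomorphic maps preserve Shilov boundaries of relatively compact subdomains. -/
theorem shilovBoundary_eq_image (hD : IsDomainSet D) (hG : IsDomainSet G)
    (hf : IsProperHolomorphic f D G) (hLd : IsDomainSet L) (hL : RelCompactIn L G) :
    IsShilovBoundary L (shilovBoundary L) ∧
      IsShilovBoundary (D ∩ f ⁻¹' L) (shilovBoundary (D ∩ f ⁻¹' L)) ∧
      shilovBoundary L = f '' shilovBoundary (D ∩ f ⁻¹' L) := by
  have h1 := isShilovBoundary_shilovBoundary hL.1
  have h2 := isShilovBoundary_shilovBoundary (isCompact_closure_preimage hf hL)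
  refine ⟨h1, h2, Subset.antisymm (shilovBoundary_subset (h2.1.image hD hG hf hL)) ?_⟩
  rintro _ ⟨w, hw, rfl⟩
  exact (shilovBoundary_subset (h1.1.preimage hD hG hf hLd.1 hL) hw).2

end Proper

end Shilov

/-! ### Closed boundaries of unit balls via discs; the polydisc. -/

noncomputable section UnitBalls

open Filter Topology Metric Set

section Disc

variable {V : Type*} [NormedAddCommGroup V] [NormedSpace ℂ V] [ProperSpace V] {S : Set V}

/-- Among the maximum points of `|g|` take one, `z`, with `q` largest. If `z ∉ S`, then `|g|` is
constant on a disc centred at `z` by the maximum principle, but strict convexity makes `q` larger at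
`z + v` or `z - v`. Such discs may lie in the sphere, so `g` is required to be holomorphic beyond
the open ball. -/
theorem exists_mem_norm_le_of_disc (q : V → ℝ) (hq : Continuous q)
    (hq2 : ∀ z v, v ≠ 0 → 2 * q z < q (z + v) + q (z - v))
    (hdisc : ∀ z ∈ closedBall (0 : V) 1, z ∉ S → ∃ v ≠ 0, ∀ ζ : ℂ, ‖ζ‖ ≤ 1 →
      z + ζ • v ∈ closedBall (0 : V) 1)
    {g : V → ℂ} {U : Set V} (hU : closedBall (0 : V) 1 ⊆ U) (hg : DifferentiableOn ℂ g U)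
    {x : V} (hx : x ∈ closedBall (0 : V) 1) : ∃ y ∈ closedBall (0 : V) 1 ∩ S, ‖g x‖ ≤ ‖g y‖ := by
  have hc := isCompact_closedBall (0 : V) 1
  have hgc : ContinuousOn g (closedBall 0 1) := hg.continuousOn.mono hU
  obtain ⟨x₁, hx₁, hmax⟩ := hc.exists_isMaxOn ⟨x, hx⟩ hgc.norm
  have hFc : IsCompact (closedBall (0 : V) 1 ∩ (fun y => ‖g y‖) ⁻¹' {‖g x₁‖}) :=
    hc.of_isClosed_subset
      (hgc.norm.preimage_isClosed_of_isClosed isClosed_closedBall isClosed_singleton)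
      inter_subset_left
  obtain ⟨z, ⟨hz, hzg⟩, hzmax⟩ := hFc.exists_isMaxOn ⟨x₁, hx₁, rfl⟩ hq.continuousOn
  have hzg' : ‖g z‖ = ‖g x₁‖ := hzg
  by_cases hzS : z ∈ S
  · exact ⟨z, ⟨hz, hzS⟩, (hmax hx).trans hzg'.ge⟩
  exfalso
  obtain ⟨v, hv, hdv⟩ := hdisc z hz hzS
  set k : ℂ → ℂ := fun ζ => g (z + ζ • v) with hk
  have hmaps : ∀ ζ ∈ closedBall (0 : ℂ) 1, z + ζ • v ∈ closedBall (0 : V) 1 := fun ζ hζ =>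
    hdv ζ (mem_closedBall_zero_iff.1 hζ)
  have hkd : DiffContOnCl ℂ k (ball 0 1) := by
    refine DifferentiableOn.diffContOnCl ?_
    refine hg.comp (f := fun ζ : ℂ => z + ζ • v) (by fun_prop) fun ζ hζ => hU (hmaps ζ ?_)
    exact closure_ball_subset_closedBall hζ
  have hkmax : IsMaxOn (norm ∘ k) (ball 0 1) 0 := by
    intro ζ hζ
    have h1 : ‖g (z + ζ • v)‖ ≤ ‖g x₁‖ := hmax (hmaps ζ (ball_subset_closedBall hζ))
    have h2 : k 0 = g z := by simp [hk]
    change ‖k ζ‖ ≤ ‖k 0‖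
    rw [h2, hzg']
    exact h1
  have heq := Complex.norm_eqOn_closedBall_of_isMaxOn hkd hkmax
  have hle : ∀ ζ ∈ closedBall (0 : ℂ) 1, q (z + ζ • v) ≤ q z := fun ζ hζ => by
    refine hzmax ⟨hmaps ζ hζ, ?_⟩
    have h1 : ‖k ζ‖ = ‖k 0‖ := heq hζ
    have h2 : k 0 = g z := by simp [hk]
    rw [h2, hzg'] at h1
    exact h1
  have h1 := hle 1 (by simp)
  have h2 := hle (-1) (by simp)
  have h3 := hq2 z v hv
  rw [one_smul] at h1
  rw [neg_one_smul, ← sub_eq_add_neg] at h2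
  linarith

/-- A closed subset of the closed unit ball such that all other points are centers of complex
discs in the closed ball is a closed boundary of the ball. -/
theorem isClosedBoundary_ball_of_disc (hS : IsClosed S) (hSb : S ⊆ closedBall (0 : V) 1)
    (q : V → ℝ) (hq : Continuous q)
    (hq2 : ∀ z v, v ≠ 0 → 2 * q z < q (z + v) + q (z - v))
    (hdisc : ∀ z ∈ closedBall (0 : V) 1, z ∉ S → ∃ v ≠ 0, ∀ ζ : ℂ, ‖ζ‖ ≤ 1 →
      z + ζ • v ∈ closedBall (0 : V) 1) : IsClosedBoundary (ball (0 : V) 1) S := by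
  let _ : NormedSpace ℝ V := NormedSpace.restrictScalars ℝ ℂ V
  have hcl : closure (ball (0 : V) 1) = closedBall 0 1 := closure_ball 0 one_ne_zero
  have hSc : IsCompact S := (isCompact_closedBall 0 1).of_isClosed_subset hS hSb
  refine ⟨hS, hcl ▸ hSb, fun g hg x hx => ?_⟩
  have hgc : ContinuousOn g (closedBall 0 1) := hcl ▸ hg.continuousOn
  rw [hcl] at hx
  -- The dilates `g(r ·)` are holomorphic on a larger ball. Compactness of `S` permits `r → 1`.
  have hr : ∀ r ∈ Ioo (0 : ℝ) 1, ∃ y ∈ S, ‖g ((r : ℂ) • x)‖ ≤ ‖g ((r : ℂ) • y)‖ := by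
    intro r hr
    have hmaps : ∀ y ∈ ball (0 : V) (1 / r), (r : ℂ) • y ∈ ball (0 : V) 1 := fun y hy => by
      rw [mem_ball_zero_iff] at hy ⊢
      rw [norm_smul, Complex.norm_real, Real.norm_of_nonneg hr.1.le]
      rwa [lt_div_iff₀' hr.1] at hy
    obtain ⟨y, hy, hle⟩ := exists_mem_norm_le_of_disc q hq hq2 hdisc
      (g := fun y => g ((r : ℂ) • y)) (U := ball (0 : V) (1 / r))
      (closedBall_subset_ball ((one_lt_div hr.1).2 hr.2))
      (hg.differentiableOn.comp (f := fun y : V => (r : ℂ) • y) (by fun_prop) hmaps) hx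
    exact ⟨y, hy.2, hle⟩
  choose! y hyS hy using hr
  set u : Ultrafilter ℝ := Ultrafilter.of (𝓝[<] (1 : ℝ))
  have hu : (u : Filter ℝ) ≤ 𝓝[<] 1 := Ultrafilter.of_le _
  have hev : ∀ᶠ r in (u : Filter ℝ), r ∈ Ioo (0 : ℝ) 1 :=
    hu (Ioo_mem_nhdsLT zero_lt_one)
  obtain ⟨a, haS, ha⟩ := hSc.ultrafilter_le_nhds (u.map y)
    (le_principal_iff.2 (hev.mono fun r hr => hyS r hr))
  have hid : Tendsto (fun r : ℝ => (r : ℂ)) u (𝓝 1) := by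
    have h := (Complex.continuous_ofReal.tendsto 1).mono_left (hu.trans nhdsWithin_le_nhds)
    simpa using h
  have hcont : ∀ {b : V} {c : ℝ → V}, b ∈ closedBall (0 : V) 1 →
      (∀ᶠ r in (u : Filter ℝ), c r ∈ closedBall (0 : V) 1) → Tendsto c u (𝓝 b) →
      Tendsto (fun r : ℝ => ‖g ((r : ℂ) • c r)‖) u (𝓝 ‖g b‖) := by
    intro b c hb hc hcb
    have h1 : Tendsto (fun r : ℝ => (r : ℂ) • c r) u (𝓝 b) := by
      simpa using hid.smul hcb
    refine ((hgc b hb).tendsto.comp (tendsto_nhdsWithin_iff.2 ⟨h1, ?_⟩)).norm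
    filter_upwards [hc, hev] with r hr hr01
    rw [mem_closedBall_zero_iff] at hr ⊢
    rw [norm_smul, Complex.norm_real, Real.norm_of_nonneg hr01.1.le]
    exact mul_le_one₀ hr01.2.le (norm_nonneg _) hr
  refine ⟨a, haS, le_of_tendsto_of_tendsto (hcont hx (Eventually.of_forall fun _ => hx)
    tendsto_const_nhds) (hcont (hSb haS) (hev.mono fun r hr => hSb (hyS r hr)) ha) ?_⟩
  filter_upwards [hev] with r hr using hy r hr

end Disc

theorem eq_one_of_two_le_norm_one_add {a : ℂ} (ha : ‖a‖ ≤ 1) (h : 2 ≤ ‖1 + a‖) : a = 1 := by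
  have h1 : ‖1 + a‖ ^ 2 = 1 + 2 * a.re + ‖a‖ ^ 2 := by
    rw [← Complex.normSq_eq_norm_sq, ← Complex.normSq_eq_norm_sq, Complex.normSq_apply,
      Complex.normSq_apply]
    simp
    ring
  have h2 : ‖a‖ ^ 2 = a.re ^ 2 + a.im ^ 2 := by
    rw [← Complex.normSq_eq_norm_sq, Complex.normSq_apply]; ring
  have h3 : ‖a‖ ^ 2 ≤ 1 := pow_le_one₀ (norm_nonneg _) ha
  have hre : a.re = 1 := by nlinarith [sq_nonneg a.im]
  have him : a.im = 0 := by nlinarith [sq_nonneg a.im]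
  exact Complex.ext (by simpa using hre) (by simpa using him)

/-- Equality case of the triangle inequality for `∑ (1 + a i)` with `‖a i‖ ≤ 1`. -/
theorem eq_one_of_le_norm_sum {n : ℕ} {a : Fin n → ℂ} (ha : ∀ i, ‖a i‖ ≤ 1)
    (h : 2 * n ≤ ‖∑ i, (1 + a i)‖) (i : Fin n) : a i = 1 := by
  refine eq_one_of_two_le_norm_one_add (ha i) ?_
  by_contra! hlt
  have hle : ∀ j, ‖1 + a j‖ ≤ 2 := fun j => by
    have := norm_add_le 1 (a j)
    rw [norm_one] at this
    linarith [ha j]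
  have h1 : ∑ j, ‖1 + a j‖ < ∑ _j : Fin n, (2 : ℝ) :=
    Finset.sum_lt_sum (fun j _ => hle j) ⟨i, Finset.mem_univ i, hlt⟩
  rw [Finset.sum_const, Finset.card_univ, Fintype.card_fin, nsmul_eq_mul] at h1
  linarith [norm_sum_le (Finset.univ : Finset (Fin n)) fun j => 1 + a j]

theorem norm_sq_add_norm_sq_sub (a b : ℂ) :
    ‖a + b‖ ^ 2 + ‖a - b‖ ^ 2 = 2 * ‖a‖ ^ 2 + 2 * ‖b‖ ^ 2 := by
  have := parallelogram_law_with_norm ℝ a b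
  nlinarith

section Polydisc

variable {n : ℕ}

theorem polydisc_eq_ball : polydisc n = ball 0 1 := by
  ext z
  rw [mem_ball_zero_iff, pi_norm_lt_iff one_pos]
  rfl

theorem isClosed_torus : IsClosed (torus n) := by
  have : torus n = ⋂ i, {z | ‖z i‖ = 1} := by
    ext z; simp [torus]
  rw [this]
  exact isClosed_iInter fun i => isClosed_eq (by fun_prop) continuous_const

/-- Off the torus a coordinate of modulus below `1` can be moved. At `u` the peak function is `∑ᵢ (1
+ conj(uᵢ) zᵢ)`; without the summands `1` its modulus would also peak at all `λu` with `|λ| = 1`. -/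
theorem isShilovBoundary_polydisc : IsShilovBoundary (polydisc n) (torus n) := by
  rw [polydisc_eq_ball]
  have hcl : closure (ball (0 : Fin n → ℂ) 1) = closedBall 0 1 := closure_ball 0 one_ne_zero
  refine isShilovBoundary_of_peak ?_ fun u hu => ?_
  · refine isClosedBoundary_ball_of_disc isClosed_torus (fun z hz => ?_)
      (fun z => ∑ i, ‖z i‖ ^ 2) (by fun_prop) (fun z v hv => ?_) fun z hz hzt => ?_
    · rw [mem_closedBall_zero_iff, pi_norm_le_iff_of_nonneg zero_le_one]
      exact fun i => (hz i).le
    · rw [← Finset.sum_add_distrib, Finset.mul_sum]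
      obtain ⟨i, hi⟩ := Function.ne_iff.1 hv
      refine Finset.sum_lt_sum (fun j _ => ?_) ⟨i, Finset.mem_univ i, ?_⟩
      · rw [Pi.add_apply, Pi.sub_apply, norm_sq_add_norm_sq_sub]
        linarith [sq_nonneg ‖v j‖]
      · rw [Pi.add_apply, Pi.sub_apply, norm_sq_add_norm_sq_sub]
        have : 0 < ‖v i‖ ^ 2 := by
          have := norm_pos_iff.2 hi
          positivity
        linarith
    · rw [mem_closedBall_zero_iff, pi_norm_le_iff_of_nonneg zero_le_one] at hz
      obtain ⟨i, hi⟩ : ∃ i, ‖z i‖ ≠ 1 := by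
        by_contra! h; exact hzt h
      have hlt : ‖z i‖ < 1 := lt_of_le_of_ne (hz i) hi
      refine ⟨Pi.single i ((1 - ‖z i‖ : ℝ) : ℂ), ?_, fun ζ hζ => ?_⟩
      · rw [Ne, Pi.single_eq_zero_iff]
        exact Complex.ofReal_ne_zero.2 (by linarith)
      · rw [mem_closedBall_zero_iff, pi_norm_le_iff_of_nonneg zero_le_one]
        intro j
        by_cases hj : j = i
        · subst hj
          rw [Pi.add_apply, Pi.smul_apply, Pi.single_eq_same, smul_eq_mul]
          refine (norm_add_le _ _).trans ?_
          rw [norm_mul, Complex.norm_real, Real.norm_of_nonneg (by linarith)]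
          nlinarith
        · simpa [hj] using hz j
  · refine ⟨fun z => ∑ i, (1 + starRingEnd ℂ (u i) * z i), Differentiable.diffContOnCl (by fun_prop),
      fun y hy hle => ?_⟩
    rw [hcl, mem_closedBall_zero_iff, pi_norm_le_iff_of_nonneg zero_le_one] at hy
    have huu : ∀ i, starRingEnd ℂ (u i) * u i = 1 := fun i => by
      rw [← Complex.normSq_eq_conj_mul_self, Complex.normSq_eq_norm_sq, hu i]; simp
    have h1 : ‖∑ i, (1 + starRingEnd ℂ (u i) * u i)‖ = 2 * n := by
      simp only [huu]
      rw [Finset.sum_const, Finset.card_univ, Fintype.card_fin, nsmul_eq_mul, norm_mul]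
      norm_num
      ring
    rw [h1] at hle
    funext i
    have h2 := eq_one_of_le_norm_sum (a := fun i => starRingEnd ℂ (u i) * y i) (fun i => by
      rw [norm_mul, RCLike.norm_conj, hu i, one_mul]; exact hy i) hle i
    have h3 : starRingEnd ℂ (u i) ≠ 0 := left_ne_zero_of_mul_eq_one (huu i)
    exact mul_left_cancel₀ h3 (h2.trans (huu i).symm)

end Polydisc

end UnitBalls

/-! ### The Cartan domain of symmetric contractions. -/

noncomputable section CartanDomain

open Filter Topology Metric Set

section Contraction

variable {H : Type*} [NormedAddCommGroup H] [InnerProductSpace ℂ H] [CompleteSpace H]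

/-- Put `d = (1 - T*T)x`. Then `‖x‖² - ‖Tx‖² ≥ ‖d‖²`, while the added vector `w` has `‖w‖ ≤ ‖d‖/2`.
The left factor `1 - TT*` turns `⟨Tx, w⟩` into a multiple of `⟨Td, sd⟩`, so the cross term is also
quadratic in `d`. With the factor `1/4` the excess is at most `(1/2 + 1/4)‖d‖²`. -/
theorem norm_add_smul_defect_le_one {T s : H →L[ℂ] H} (hT : ‖T‖ ≤ 1) (hs : ‖s‖ ≤ 1) {ζ : ℂ}
    (hζ : ‖ζ‖ ≤ 1) :
    ‖T + ζ • ((1 / 4 : ℂ) • ((1 - T * star T) * s * (1 - star T * T)))‖ ≤ 1 := by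
  have hTs : ‖star T‖ ≤ 1 := by rwa [norm_star]
  have happ : ∀ {A : H →L[ℂ] H}, ‖A‖ ≤ 1 → ∀ x, ‖A x‖ ≤ ‖x‖ := fun hA x => by
    simpa using ContinuousLinearMap.le_of_opNorm_le _ hA x
  refine ContinuousLinearMap.opNorm_le_bound _ zero_le_one fun x => ?_
  set d : H := (1 - star T * T) x with hd
  set w : H := (ζ * (1 / 4)) • (1 - T * star T) (s d) with hw
  have hval : (T + ζ • ((1 / 4 : ℂ) • ((1 - T * star T) * s * (1 - star T * T)))) x = T x + w := by
    simp only [hw, hd, mul_smul]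
    rfl
  rw [hval, one_mul]
  have hd' : d = x - star T (T x) := rfl
  have hinner : inner ℂ x (star T (T x)) = ((‖T x‖ ^ 2 : ℝ) : ℂ) := by
    rw [ContinuousLinearMap.star_eq_adjoint, ContinuousLinearMap.adjoint_inner_right,
      inner_self_eq_norm_sq_to_K]
    push_cast; rfl
  have h1 : ‖d‖ ^ 2 ≤ ‖x‖ ^ 2 - ‖T x‖ ^ 2 := by
    rw [hd', @norm_sub_sq ℂ, hinner]
    have h2 := happ hTs (T x)
    have h3 : RCLike.re (((‖T x‖ ^ 2 : ℝ) : ℂ)) = ‖T x‖ ^ 2 := Complex.ofReal_re _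
    rw [h3]
    have h4 := pow_le_pow_left₀ (norm_nonneg _) h2 2
    linarith
  have hζ4 : ‖ζ * (1 / 4)‖ ≤ 1 / 4 := by
    rw [norm_mul]
    have : ‖(1 / 4 : ℂ)‖ = 1 / 4 := by norm_num
    rw [this]; linarith
  have hsd := happ hs d
  have hw1 : ‖w‖ ≤ 1 / 2 * ‖d‖ := by
    have h2 : ‖(1 - T * star T) (s d)‖ ≤ 2 * ‖d‖ := by
      change ‖s d - T (star T (s d))‖ ≤ _
      refine (norm_sub_le _ _).trans ?_
      linarith [happ hT (star T (s d)), happ hTs (s d)]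
    rw [hw, norm_smul]
    nlinarith [norm_nonneg (ζ * (1 / 4)), norm_nonneg d]
  have hw2 : ‖inner ℂ (T x) w‖ ≤ 1 / 4 * ‖d‖ ^ 2 := by
    have h2 : inner ℂ (T x) ((1 - T * star T) (s d)) = inner ℂ (T d) (s d) := by
      change inner ℂ (T x) (s d - T (star T (s d))) = inner ℂ (T (x - star T (T x))) (s d)
      rw [map_sub, inner_sub_right, inner_sub_left, ContinuousLinearMap.star_eq_adjoint,
        ← ContinuousLinearMap.adjoint_inner_left T, ContinuousLinearMap.adjoint_inner_right T]
    rw [hw, inner_smul_right, h2, norm_mul]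
    have h3 : ‖inner ℂ (T d) (s d)‖ ≤ ‖d‖ ^ 2 := by
      refine (norm_inner_le_norm _ _).trans ?_
      rw [pow_two]
      exact mul_le_mul (happ hT d) hsd (norm_nonneg _) (norm_nonneg _)
    exact mul_le_mul hζ4 h3 (norm_nonneg _) (by norm_num)
  have hfin : ‖T x + w‖ ^ 2 ≤ ‖x‖ ^ 2 := by
    rw [@norm_add_sq ℂ]
    have h2 := (RCLike.re_le_norm (inner ℂ (T x) w)).trans hw2
    have h3 : ‖w‖ ^ 2 ≤ 1 / 4 * ‖d‖ ^ 2 := by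
      have := pow_le_pow_left₀ (norm_nonneg _) hw1 2
      linarith
    linarith [sq_nonneg ‖d‖]
  exact le_of_sq_le_sq hfin (norm_nonneg _)

end Contraction

section Matrix

variable {n : Type*} [Fintype n] [DecidableEq n]

theorem Matrix.norm_add_smul_defect_le_one {z s : Matrix n n ℂ} (hz : ‖z‖ ≤ 1) (hs : ‖s‖ ≤ 1)
    {ζ : ℂ} (hζ : ‖ζ‖ ≤ 1) :
    ‖z + ζ • ((1 / 4 : ℂ) • ((1 - z * star z) * s * (1 - star z * z)))‖ ≤ 1 := by
  rw [Matrix.cstar_norm_def] at hz hs ⊢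
  simpa only [map_add, map_smul, map_mul, map_sub, map_one, map_star] using
    _root_.norm_add_smul_defect_le_one hz hs hζ

theorem Matrix.sum_norm_sq_col_le (A : Matrix n n ℂ) (j : n) : ∑ i, ‖A i j‖ ^ 2 ≤ ‖A‖ ^ 2 := by
  have h := Matrix.l2_opNorm_mulVec A (EuclideanSpace.single j (1 : ℂ))
  rw [PiLp.norm_single, norm_one, mul_one] at h
  have h2 := pow_le_pow_left₀ (norm_nonneg _) h 2
  rw [EuclideanSpace.norm_sq_eq] at h2
  simpa using h2

theorem Matrix.norm_entry_le (A : Matrix n n ℂ) (i j : n) : ‖A i j‖ ≤ ‖A‖ := by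
  refine le_of_sq_le_sq ((Finset.single_le_sum (f := fun i => ‖A i j‖ ^ 2)
    (fun i _ => sq_nonneg _) (Finset.mem_univ i)).trans (A.sum_norm_sq_col_le j)) (norm_nonneg _)

theorem Matrix.eq_one_of_diag_eq_one {A : Matrix n n ℂ} (hA : ‖A‖ ≤ 1) (h : ∀ i, A i i = 1) :
    A = 1 := by
  ext i j
  by_cases hij : i = j
  · subst hij
    rw [h, Matrix.one_apply_eq]
  rw [Matrix.one_apply_ne hij, ← norm_eq_zero, ← sq_eq_zero_iff]
  have h1 := A.sum_norm_sq_col_le j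
  have h2 : ∑ k ∈ ({i, j} : Finset n), ‖A k j‖ ^ 2 ≤ ∑ k, ‖A k j‖ ^ 2 :=
    Finset.sum_le_sum_of_subset_of_nonneg (Finset.subset_univ _) fun _ _ _ => sq_nonneg _
  rw [Finset.sum_pair hij, h j, norm_one] at h2
  have h3 := pow_le_one₀ (norm_nonneg _) hA (n := 2)
  linarith [sq_nonneg ‖A i j‖]

end Matrix

instance : ProperSpace SymMat := FiniteDimensional.proper ℂ SymMat

theorem SymMat.apply_comm (z : SymMat) (i j : Fin 2) :
    (z : Matrix (Fin 2) (Fin 2) ℂ) i j = (z : Matrix (Fin 2) (Fin 2) ℂ) j i :=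
  congrFun (congrFun (z.2 : (z : Matrix (Fin 2) (Fin 2) ℂ).transpose = z) j) i

theorem SymMat.differentiable_apply (i j : Fin 2) :
    Differentiable ℂ fun z : SymMat => (z : Matrix (Fin 2) (Fin 2) ℂ) i j :=
  (((Matrix.entryLinearMap ℂ ℂ i j).comp SymMat.subtype).toContinuousLinearMap).differentiable

theorem cartanII_eq_ball : cartanII = ball 0 1 := by
  ext z
  rw [mem_ball_zero_iff]
  rfl

theorem isClosed_symUnitary : IsClosed symUnitary :=
  isClosed_unitary.preimage continuous_subtype_val

theorem norm_le_one_of_mem_symUnitary {u : SymMat} (hu : u ∈ symUnitary) : ‖u‖ ≤ 1 :=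
  (CStarRing.norm_of_mem_unitary (U := (u : Matrix (Fin 2) (Fin 2) ℂ)) hu).le

/-- For symmetric `z` the defect `1 - zz*` is the transpose of `D = 1 - z*z`, so the direction `Dᵀ s
D` is symmetric for diagonal `s`. If `D i j ≠ 0`, taking for `s` the `i`-th diagonal unit makes its
entry `(j, j)` equal to `(D i j)²`. -/
theorem exists_disc_of_notMem_symUnitary {z : SymMat} (hz : ‖z‖ ≤ 1) (hzu : z ∉ symUnitary) :
    ∃ v ≠ 0, ∀ ζ : ℂ, ‖ζ‖ ≤ 1 → ‖z + ζ • v‖ ≤ 1 := by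
  obtain ⟨z, hzs⟩ := z
  have hzt : z.transpose = z := hzs
  have hst : (star z).transpose = star z := by
    ext i j
    exact congrArg star (congrFun (congrFun hzt j) i)
  set D : Matrix (Fin 2) (Fin 2) ℂ := 1 - star z * z with hD
  have hDt : D.transpose = 1 - z * star z := by
    rw [hD, Matrix.transpose_sub, Matrix.transpose_one, Matrix.transpose_mul, hzt, hst]
  have hD0 : D ≠ 0 := fun h => hzu (Matrix.mem_unitaryGroup_iff'.2 (sub_eq_zero.1 h).symm)
  obtain ⟨i, j, hij⟩ : ∃ i j, D i j ≠ 0 := by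
    by_contra! h
    exact hD0 (Matrix.ext h)
  set s : Matrix (Fin 2) (Fin 2) ℂ := Matrix.diagonal (Pi.single i 1) with hs
  have hs1 : ‖s‖ ≤ 1 := by
    rw [hs, Matrix.l2_opNorm_diagonal, Pi.norm_single, norm_one]
  set v : Matrix (Fin 2) (Fin 2) ℂ := (1 / 4 : ℂ) • (D.transpose * s * D) with hv
  have hvs : v.transpose = v := by
    rw [hv, Matrix.transpose_smul, Matrix.transpose_mul, Matrix.transpose_mul,
      Matrix.transpose_transpose, hs, Matrix.diagonal_transpose, Matrix.mul_assoc]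
  refine ⟨⟨v, hvs⟩, fun h => ?_, fun ζ hζ => ?_⟩
  · have h1 : v j j = 0 := by
      rw [show v = 0 from congrArg Subtype.val h]; rfl
    have h2 : v j j = 1 / 4 * (D i j) ^ 2 := by
      rw [hv, Matrix.smul_apply, Matrix.mul_apply, smul_eq_mul]
      congr 1
      rw [Finset.sum_eq_single i]
      · rw [hs, Matrix.mul_diagonal, Pi.single_eq_same, Matrix.transpose_apply]; ring
      · intro k _ hk
        rw [hs, Matrix.mul_diagonal, Pi.single_eq_of_ne hk]; ring
      · simp
    rw [h2] at h1
    exact mul_ne_zero (by norm_num) (pow_ne_zero 2 hij) h1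
  · have h := Matrix.norm_add_smul_defect_le_one (z := z) (s := s) hz hs1 hζ
    rw [← hDt] at h
    exact h

/-- The peak function at `u` is `∑ᵢ (1 + (u*z)ᵢᵢ)`. Its maximum forces the contraction `u*z` to have
unit diagonal, hence to be the identity. -/
theorem isShilovBoundary_cartanII : IsShilovBoundary cartanII symUnitary := by
  rw [cartanII_eq_ball]
  let _ : NormedSpace ℝ SymMat := NormedSpace.restrictScalars ℝ ℂ SymMat
  have hcl : closure (ball (0 : SymMat) 1) = closedBall 0 1 := closure_ball 0 one_ne_zero
  refine isShilovBoundary_of_peak ?_ fun u hu => ?_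
  · refine isClosedBoundary_ball_of_disc isClosed_symUnitary
      (fun z hz => mem_closedBall_zero_iff.2 (norm_le_one_of_mem_symUnitary hz))
      (fun z => ∑ i, ∑ j, ‖(z : Matrix (Fin 2) (Fin 2) ℂ) i j‖ ^ 2) ?_ (fun z v hv => ?_)
      fun z hz hzu => ?_
    · exact continuous_finsetSum _ fun i _ => continuous_finsetSum _ fun j _ =>
        (SymMat.differentiable_apply i j).continuous.norm.pow 2
    · simp only [Submodule.coe_add, Submodule.coe_sub, Matrix.add_apply, Matrix.sub_apply]
      simp only [← Finset.sum_add_distrib, Finset.mul_sum]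
      obtain ⟨i, j, hij⟩ : ∃ i j, (v : Matrix (Fin 2) (Fin 2) ℂ) i j ≠ 0 := by
        by_contra! h
        exact hv (Subtype.ext (Matrix.ext h))
      have hle : ∀ i j, 2 * ‖(z : Matrix (Fin 2) (Fin 2) ℂ) i j‖ ^ 2 ≤
          ‖(z : Matrix (Fin 2) (Fin 2) ℂ) i j + (v : Matrix (Fin 2) (Fin 2) ℂ) i j‖ ^ 2 +
          ‖(z : Matrix (Fin 2) (Fin 2) ℂ) i j - (v : Matrix (Fin 2) (Fin 2) ℂ) i j‖ ^ 2 :=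
        fun i j => by
          rw [norm_sq_add_norm_sq_sub]
          linarith [sq_nonneg ‖(v : Matrix (Fin 2) (Fin 2) ℂ) i j‖]
      refine Finset.sum_lt_sum (fun k _ => Finset.sum_le_sum fun l _ => hle k l)
        ⟨i, Finset.mem_univ i, Finset.sum_lt_sum (fun l _ => hle i l) ⟨j, Finset.mem_univ j, ?_⟩⟩
      rw [norm_sq_add_norm_sq_sub]
      have := norm_pos_iff.2 hij
      linarith [pow_pos this 2]
    · simp only [mem_closedBall_zero_iff] at hz ⊢
      exact exists_disc_of_notMem_symUnitary hz hzu
  · refine ⟨fun z => ∑ i, (1 + (star (u : Matrix (Fin 2) (Fin 2) ℂ) *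
      (z : Matrix (Fin 2) (Fin 2) ℂ)) i i), Differentiable.diffContOnCl ?_, fun y hy hle => ?_⟩
    · simp only [Matrix.mul_apply]
      exact Differentiable.fun_sum fun i _ => (differentiable_const _).add
        (Differentiable.fun_sum fun j _ => (SymMat.differentiable_apply j i).const_mul _)
    rw [hcl, mem_closedBall_zero_iff] at hy
    have huu : star (u : Matrix (Fin 2) (Fin 2) ℂ) * (u : Matrix (Fin 2) (Fin 2) ℂ) = 1 :=
      Matrix.mem_unitaryGroup_iff'.1 hu
    have hyu : ‖star (u : Matrix (Fin 2) (Fin 2) ℂ) * (y : Matrix (Fin 2) (Fin 2) ℂ)‖ ≤ 1 := by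
      refine (norm_mul_le _ _).trans (mul_le_one₀ ?_ (norm_nonneg _) hy)
      rw [norm_star]
      exact norm_le_one_of_mem_symUnitary hu
    have h1 := eq_one_of_le_norm_sum (n := 2)
      (a := fun i => (star (u : Matrix (Fin 2) (Fin 2) ℂ) * (y : Matrix (Fin 2) (Fin 2) ℂ)) i i)
      (fun i => (Matrix.norm_entry_le _ i i).trans hyu) (by
        refine le_trans ?_ hle
        simp only [huu, Matrix.one_apply_eq]
        norm_num)
    have h2 := Matrix.eq_one_of_diag_eq_one hyu h1
    have h3 : (u : Matrix (Fin 2) (Fin 2) ℂ) * star (u : Matrix (Fin 2) (Fin 2) ℂ) = 1 :=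
      Matrix.mem_unitaryGroup_iff.1 hu
    refine Subtype.ext ?_
    calc (y : Matrix (Fin 2) (Fin 2) ℂ) = u * star (u : Matrix (Fin 2) (Fin 2) ℂ) * y := by
          rw [h3, Matrix.one_mul]
      _ = u := by rw [Matrix.mul_assoc, h2, Matrix.mul_one]

end CartanDomain

/-! ### The symmetrization map and the tetrablock map as proper self-maps; linear change of
coordinates. -/

noncomputable section Symmetrization

open Filter Topology Metric Set

section ProperSelfMaps

variable {n : ℕ} {f : (Fin n → ℂ) → (Fin n → ℂ)}

theorem isDomainSet_univ {V : Type*} [NormedAddCommGroup V] [NormedSpace ℝ V] :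
    IsDomainSet (univ : Set V) :=
  ⟨isOpen_univ, isConnected_univ⟩

theorem isProperHolomorphic_univ (hf : Differentiable ℂ f)
    (hb : ∀ R : ℝ, ∃ R' : ℝ, ∀ z, ‖f z‖ ≤ R → ‖z‖ ≤ R') :
    IsProperHolomorphic f univ univ := by
  refine ⟨hf.differentiableOn, mapsTo_univ _ _, fun C _ hC => ?_⟩
  obtain ⟨R, hR⟩ := hC.isBounded.exists_norm_le
  obtain ⟨R', hR'⟩ := hb R
  rw [univ_inter]
  refine (isCompact_closedBall (0 : Fin n → ℂ) R').of_isClosed_subset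
    (hC.isClosed.preimage hf.continuous) fun z hz => ?_
  exact mem_closedBall_zero_iff.2 (hR' z (hR _ hz))

/-- Proper maps are closed; by surjectivity and saturation the image of the complement is the
complement of the image. -/
theorem IsProperHolomorphic.isOpen_image_of_saturated (hf : IsProperHolomorphic f univ univ)
    {A : Set (Fin n → ℂ)} (hA : IsOpen A) (hsat : f ⁻¹' (f '' A) = A) : IsOpen (f '' A) := by
  have hprop : IsProperMap f := isProperMap_iff_isCompact_preimage.2
    ⟨continuousOn_univ.1 hf.1.continuousOn, fun K hK => by
      simpa using hf.2.2 K (subset_univ K) hK⟩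
  have hsurj : Function.Surjective f := fun z => by
    obtain ⟨w, -, hw⟩ := hf.subset_image isOpen_univ isOpen_univ isPreconnected_univ univ_nonempty
      (mem_univ z)
    exact ⟨w, hw⟩
  have h := hprop.isClosedMap Aᶜ hA.isClosed_compl
  have heq : f '' Aᶜ = (f '' A)ᶜ := by
    conv_lhs => rw [← hsat, ← preimage_compl, image_preimage_eq _ hsurj]
  rw [heq] at h
  exact isClosed_compl_iff.1 h

end ProperSelfMaps

section ElementarySymmetric

variable {n : ℕ}

theorem symMap_apply (z : Fin n → ℂ) (k : Fin n) :
    symMap n z k = ((Finset.univ : Finset (Fin n)).val.map z).esymm (k + 1) :=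
  (Finset.esymm_map_val z _ _).symm

/-- The elementary symmetric functions are, up to sign, the coefficients of `∏ (X - zᵢ)`, whose
roots recover the multiset. -/
theorem map_univ_eq_of_symMap_eq {z w : Fin n → ℂ} (h : symMap n z = symMap n w) :
    (Finset.univ : Finset (Fin n)).val.map z = (Finset.univ : Finset (Fin n)).val.map w := by
  have hprod : (((Finset.univ : Finset (Fin n)).val.map z).map
      fun t => Polynomial.X - Polynomial.C t).prod =
      (((Finset.univ : Finset (Fin n)).val.map w).map
        fun t => Polynomial.X - Polynomial.C t).prod := by
    rw [Multiset.prod_X_sub_X_eq_sum_esymm, Multiset.prod_X_sub_X_eq_sum_esymm,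
      Multiset.card_map, Multiset.card_map]
    refine Finset.sum_congr rfl fun j hj => ?_
    have hjn : j < n + 1 := by simpa using hj
    congr 3
    -- Degree `0` is not a component of `symMap`: component `k` has degree `k + 1`.
    cases j with
    | zero => simp [Multiset.esymm]
    | succ k =>
      have := congrFun h ⟨k, by omega⟩
      rwa [symMap_apply, symMap_apply] at this
  have := congrArg Polynomial.roots hprod
  rwa [Polynomial.roots_multiset_prod_X_sub_C, Polynomial.roots_multiset_prod_X_sub_C] at this

theorem differentiable_symMap : Differentiable ℂ (symMap n) := by
  refine differentiable_pi.2 fun k => ?_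
  unfold symMap
  fun_prop

/-- Cauchy's bound for the roots of a monic polynomial in terms of its coefficients. -/
theorem norm_le_of_norm_symMap_le {R : ℝ} {z : Fin n → ℂ} (hz : ‖symMap n z‖ ≤ R) :
    ‖z‖ ≤ R + 1 := by
  have hR : 0 ≤ R := (norm_nonneg _).trans hz
  lift R to NNReal using hR
  refine (pi_norm_le_iff_of_nonneg (by positivity)).2 fun i => ?_
  set s := (Finset.univ : Finset (Fin n)).val.map z with hs
  have hcard : Multiset.card s = n := by simp [hs]
  set p : Polynomial ℂ := (s.map fun t => Polynomial.X - Polynomial.C t).prod with hp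
  have hdeg : p.natDegree = n := by
    rw [hp, Polynomial.natDegree_multiset_prod_X_sub_C_eq_card, hcard]
  have hmon : p.Monic := Polynomial.monic_multisetProd_X_sub_C s
  have hroot : p.IsRoot (z i) := by
    rw [← Polynomial.mem_roots hmon.ne_zero, hp, Polynomial.roots_multiset_prod_X_sub_C, hs]
    exact Multiset.mem_map_of_mem z (Finset.mem_univ i)
  have hlt := hroot.norm_lt_cauchyBound hmon.ne_zero
  have hle : p.cauchyBound ≤ R + 1 := by
    rw [Polynomial.cauchyBound, hmon.leadingCoeff, nnnorm_one, div_one]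
    refine add_le_add_left (Finset.sup_le fun k hk => ?_) 1
    rw [hdeg, Finset.mem_range] at hk
    rw [hp, Multiset.prod_X_sub_C_coeff s (by omega), hcard, nnnorm_mul, nnnorm_pow, nnnorm_neg,
      nnnorm_one, one_pow, one_mul]
    have h1 := (norm_le_pi_norm (symMap n z) ⟨n - k - 1, by omega⟩).trans hz
    rw [symMap_apply] at h1
    have h2 : n - k - 1 + 1 = n - k := by omega
    simp only [h2] at h1
    exact h1
  exact_mod_cast (hlt.trans_le hle).le

theorem isProperHolomorphic_symMap (n : ℕ) : IsProperHolomorphic (symMap n) univ univ :=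
  isProperHolomorphic_univ differentiable_symMap fun R =>
    ⟨R + 1, fun _ hz => norm_le_of_norm_symMap_le hz⟩

theorem symMap_preimage_symPolydisc (n : ℕ) : symMap n ⁻¹' symPolydisc n = polydisc n := by
  refine Subset.antisymm (fun z hz i => ?_) (subset_preimage_image _ _)
  obtain ⟨w, hw, hwz⟩ := hz
  have hmem : z i ∈ (Finset.univ : Finset (Fin n)).val.map w := by
    rw [map_univ_eq_of_symMap_eq hwz]
    exact Multiset.mem_map_of_mem z (Finset.mem_univ i)
  obtain ⟨j, -, hj⟩ := Multiset.mem_map.1 hmem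
  rw [← hj]
  exact hw j

theorem isDomainSet_symPolydisc (n : ℕ) : IsDomainSet (symPolydisc n) := by
  constructor
  · refine (isProperHolomorphic_symMap n).isOpen_image_of_saturated ?_
      (symMap_preimage_symPolydisc n)
    rw [polydisc_eq_ball]
    exact isOpen_ball
  · refine IsConnected.image ?_ _ differentiable_symMap.continuous.continuousOn
    rw [polydisc_eq_ball]
    exact (convex_ball _ _).isConnected ⟨0, mem_ball_self one_pos⟩

theorem relCompactIn_univ_of_subset {V : Type*} [TopologicalSpace V] [T2Space V] {L K : Set V}
    (hK : IsCompact K) (h : L ⊆ K) : RelCompactIn L univ :=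
  ⟨hK.closure_of_subset h, subset_univ _⟩

theorem relCompactIn_symPolydisc (n : ℕ) : RelCompactIn (symPolydisc n) univ := by
  refine relCompactIn_univ_of_subset
    ((isCompact_closedBall (0 : Fin n → ℂ) 1).image differentiable_symMap.continuous)
    (image_mono ?_)
  rw [polydisc_eq_ball]
  exact ball_subset_closedBall

end ElementarySymmetric

section Tetrablock

/-- Coordinates `(z₁₁, z₂₂, z₁₂)` on the space of symmetric matrices. -/
def symMatEquiv : (Fin 3 → ℂ) ≃L[ℂ] SymMat :=
  LinearEquiv.toContinuousLinearEquiv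
    { toFun := fun z => ⟨!![z 0, z 2; z 2, z 1], by
        ext i j
        fin_cases i <;> fin_cases j <;> rfl⟩
      map_add' := fun z w => by
        ext i j
        fin_cases i <;> fin_cases j <;> rfl
      map_smul' := fun c z => by
        ext i j
        fin_cases i <;> fin_cases j <;> rfl
      invFun := fun A => ![(A : Matrix (Fin 2) (Fin 2) ℂ) 0 0, (A : Matrix (Fin 2) (Fin 2) ℂ) 1 1,
        (A : Matrix (Fin 2) (Fin 2) ℂ) 0 1]
      left_inv := fun z => by
        ext i
        fin_cases i <;> rfl
      right_inv := fun A => by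
        ext i j
        have := SymMat.apply_comm A 0 1
        fin_cases i <;> fin_cases j
        · rfl
        · rfl
        · exact this
        · rfl }

theorem coe_symMatEquiv (z : Fin 3 → ℂ) :
    (symMatEquiv z : Matrix (Fin 2) (Fin 2) ℂ) = !![z 0, z 2; z 2, z 1] := rfl

/-- The map `tetraMap` in the coordinates `symMatEquiv`. -/
def tetraCoord (z : Fin 3 → ℂ) : Fin 3 → ℂ := tetraMap !![z 0, z 2; z 2, z 1]

theorem tetraCoord_eq (z : Fin 3 → ℂ) : tetraCoord z = ![z 0, z 1, z 0 * z 1 - z 2 * z 2] := by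
  rw [tetraCoord, tetraMap, Matrix.det_fin_two_of]
  rfl

theorem differentiable_tetraCoord : Differentiable ℂ tetraCoord := by
  refine differentiable_pi.2 fun k => ?_
  simp only [tetraCoord_eq]
  fin_cases k
  · exact differentiable_apply 0
  · exact differentiable_apply 1
  · change Differentiable ℂ fun z : Fin 3 → ℂ => z 0 * z 1 - z 2 * z 2
    fun_prop

theorem tetraMap_eq_tetraCoord (A : SymMat) : tetraMap A = tetraCoord (symMatEquiv.symm A) := by
  rw [tetraCoord, ← coe_symMatEquiv, ContinuousLinearEquiv.apply_symm_apply]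

theorem continuous_tetraMap : Continuous fun A : SymMat => tetraMap A := by
  simp only [tetraMap_eq_tetraCoord]
  exact differentiable_tetraCoord.continuous.comp symMatEquiv.symm.continuous

theorem image_tetraMap (S : Set SymMat) :
    (fun A : SymMat => tetraMap A) '' S = tetraCoord '' (symMatEquiv ⁻¹' S) := by
  rw [← ContinuousLinearEquiv.image_symm_eq_preimage, image_image]
  exact image_congr fun A _ => tetraMap_eq_tetraCoord A

theorem isProperHolomorphic_tetraCoord : IsProperHolomorphic tetraCoord univ univ := by
  refine isProperHolomorphic_univ differentiable_tetraCoord fun R => ⟨1 + R + R ^ 2, fun z hz => ?_⟩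
  have hR : 0 ≤ R := (norm_nonneg _).trans hz
  rw [pi_norm_le_iff_of_nonneg hR, tetraCoord_eq] at hz
  have h0 : ‖z 0‖ ≤ R := hz 0
  have h1 : ‖z 1‖ ≤ R := hz 1
  have h2 : ‖z 0 * z 1 - z 2 * z 2‖ ≤ R := hz 2
  have h3 : ‖z 2‖ * ‖z 2‖ ≤ R * R + R := by
    have h4 : z 2 * z 2 = z 0 * z 1 - (z 0 * z 1 - z 2 * z 2) := by ring
    rw [← norm_mul, h4]
    refine (norm_sub_le _ _).trans (add_le_add ?_ h2)
    rw [norm_mul]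
    exact mul_le_mul h0 h1 (norm_nonneg _) hR
  refine (pi_norm_le_iff_of_nonneg (by positivity)).2 fun i => ?_
  fin_cases i
  · exact h0.trans (by nlinarith)
  · exact h1.trans (by nlinarith)
  · change ‖z 2‖ ≤ _
    nlinarith [norm_nonneg (z 2)]

/-- Conjugation by the unitary `diag(1, -1)`. The tetrablock coordinates determine `z₁₂` only up to
sign, so this makes the Cartan domain saturated. -/
theorem norm_neg_offDiag_le (a b c : ℂ) : ‖!![a, -c; -c, b]‖ ≤ ‖!![a, c; c, b]‖ := by
  have hd : ‖(Matrix.diagonal ![1, -1] : Matrix (Fin 2) (Fin 2) ℂ)‖ ≤ 1 := by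
    rw [Matrix.l2_opNorm_diagonal]
    refine (pi_norm_le_iff_of_nonneg zero_le_one).2 fun i => ?_
    fin_cases i <;> simp
  have h : !![a, -c; -c, b] = Matrix.diagonal ![1, -1] * !![a, c; c, b] *
      Matrix.diagonal ![1, -1] := by
    ext i j
    fin_cases i <;> fin_cases j <;> simp [Matrix.diagonal_mul, Matrix.mul_diagonal]
  rw [h]
  calc _ ≤ ‖(Matrix.diagonal ![1, -1] : Matrix (Fin 2) (Fin 2) ℂ)‖ * ‖!![a, c; c, b]‖ *
        ‖(Matrix.diagonal ![1, -1] : Matrix (Fin 2) (Fin 2) ℂ)‖ :=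
        (norm_mul_le _ _).trans (mul_le_mul_of_nonneg_right (norm_mul_le _ _) (norm_nonneg _))
    _ ≤ 1 * ‖!![a, c; c, b]‖ * 1 := by gcongr
    _ = _ := by ring

theorem tetrablock_eq_image : tetrablock = tetraCoord '' (symMatEquiv ⁻¹' cartanII) :=
  image_tetraMap cartanII

theorem tetraCoord_preimage_tetrablock :
    tetraCoord ⁻¹' tetrablock = symMatEquiv ⁻¹' cartanII := by
  rw [tetrablock_eq_image]
  refine Subset.antisymm (fun z hz => ?_) (subset_preimage_image _ _)
  obtain ⟨w, hw, hwz⟩ := hz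
  rw [tetraCoord_eq, tetraCoord_eq] at hwz
  have h0 : w 0 = z 0 := congrFun hwz 0
  have h1 : w 1 = z 1 := congrFun hwz 1
  have h2 : w 0 * w 1 - w 2 * w 2 = z 0 * z 1 - z 2 * z 2 := congrFun hwz 2
  have h3 : z 2 * z 2 = w 2 * w 2 := by
    rw [h0, h1] at h2
    linear_combination h2
  change ‖!![w 0, w 2; w 2, w 1]‖ < 1 at hw
  change ‖!![z 0, z 2; z 2, z 1]‖ < 1
  rw [h0, h1] at hw
  rcases mul_self_eq_mul_self_iff.1 h3 with h | h
  · rwa [h]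
  · rw [h]
    exact (norm_neg_offDiag_le _ _ _).trans_lt hw

theorem isDomainSet_tetrablock : IsDomainSet tetrablock := by
  constructor
  · rw [tetrablock_eq_image]
    refine isProperHolomorphic_tetraCoord.isOpen_image_of_saturated ?_ ?_
    · rw [cartanII_eq_ball]
      exact isOpen_ball.preimage symMatEquiv.continuous
    · rw [← tetrablock_eq_image, tetraCoord_preimage_tetrablock]
  · refine IsConnected.image ?_ _ continuous_tetraMap.continuousOn
    rw [cartanII_eq_ball]
    let _ : NormedSpace ℝ SymMat := NormedSpace.restrictScalars ℝ ℂ SymMat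
    exact (convex_ball _ _).isConnected ⟨0, mem_ball_self one_pos⟩

theorem relCompactIn_tetrablock : RelCompactIn tetrablock univ := by
  refine relCompactIn_univ_of_subset
    ((isCompact_closedBall (0 : SymMat) 1).image continuous_tetraMap) (image_mono ?_)
  rw [cartanII_eq_ball]
  exact ball_subset_closedBall

end Tetrablock

section Transport

variable {V W : Type*} [NormedAddCommGroup V] [NormedSpace ℂ V] [NormedAddCommGroup W]
  [NormedSpace ℂ W]

theorem IsClosedBoundary.preimage_equiv (e : V ≃L[ℂ] W) {D S : Set W} (h : IsClosedBoundary D S) :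
    IsClosedBoundary (e ⁻¹' D) (e ⁻¹' S) := by
  have hcl : closure (e ⁻¹' D) = e ⁻¹' closure D := (e.toHomeomorph.preimage_closure D).symm
  refine ⟨h.1.preimage e.continuous, hcl ▸ preimage_mono h.2.1, fun g hg x hx => ?_⟩
  rw [hcl] at hx
  have hge : DiffContOnCl ℂ (g ∘ e.symm) D :=
    hg.comp e.symm.differentiable.diffContOnCl fun y hy => by
      rwa [mem_preimage, e.apply_symm_apply]
  obtain ⟨y, hy, hxy⟩ := h.2.2 _ hge (e x) hx
  refine ⟨e.symm y, by rwa [mem_preimage, e.apply_symm_apply], ?_⟩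
  simpa using hxy

theorem IsShilovBoundary.preimage_equiv (e : V ≃L[ℂ] W) {D S : Set W} (h : IsShilovBoundary D S) :
    IsShilovBoundary (e ⁻¹' D) (e ⁻¹' S) := by
  refine ⟨IsClosedBoundary.preimage_equiv e h.1, fun T hT x hx => ?_⟩
  have h1 := IsClosedBoundary.preimage_equiv e.symm (show IsClosedBoundary (e ⁻¹' D) T from hT)
  have h2 : e.symm ⁻¹' (e ⁻¹' D) = D := e.symm_preimage_preimage D
  rw [h2] at h1
  simpa using h.2 h1 hx

end Transport

end Symmetrization

/-! ### The four concrete Shilov boundaries and the final statement. -/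

theorem shilovBoundary_polydisc (n : ℕ) : shilovBoundary (polydisc n) = torus n :=
  isShilovBoundary_polydisc.eq

theorem shilovBoundary_cartanII : shilovBoundary cartanII = symUnitary :=
  isShilovBoundary_cartanII.eq

theorem shilovBoundary_symPolydisc (n : ℕ) :
    IsShilovBoundary (symPolydisc n) (shilovBoundary (symPolydisc n)) ∧
      shilovBoundary (symPolydisc n) = symMap n '' torus n := by
  obtain ⟨h1, -, h3⟩ := shilovBoundary_eq_image isDomainSet_univ isDomainSet_univ
    (isProperHolomorphic_symMap n) (isDomainSet_symPolydisc n) (relCompactIn_symPolydisc n)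
  rw [Set.univ_inter, symMap_preimage_symPolydisc, shilovBoundary_polydisc] at h3
  exact ⟨h1, h3⟩

theorem shilovBoundary_tetrablock :
    IsShilovBoundary tetrablock (shilovBoundary tetrablock) ∧
      shilovBoundary tetrablock = (fun z : SymMat => tetraMap z) '' symUnitary := by
  obtain ⟨h1, -, h3⟩ := shilovBoundary_eq_image isDomainSet_univ isDomainSet_univ
    isProperHolomorphic_tetraCoord isDomainSet_tetrablock relCompactIn_tetrablock
  rw [Set.univ_inter, tetraCoord_preimage_tetrablock,
    (isShilovBoundary_cartanII.preimage_equiv symMatEquiv).eq, ← image_tetraMap] at h3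
  exact ⟨h1, h3⟩

theorem mainTheorem9 :
    -- the tetrablock
    (IsShilovBoundary tetrablock (shilovBoundary tetrablock) ∧
      IsShilovBoundary cartanII (shilovBoundary cartanII) ∧
      shilovBoundary tetrablock = (fun z : SymMat => tetraMap z) '' shilovBoundary cartanII ∧
      shilovBoundary cartanII = symUnitary ∧
      shilovBoundary tetrablock = (fun z : SymMat => tetraMap z) '' symUnitary) ∧
    -- the symmetrized polydisc
    (∀ n : ℕ,
      IsShilovBoundary (symPolydisc n) (shilovBoundary (symPolydisc n)) ∧
      IsShilovBoundary (polydisc n) (shilovBoundary (polydisc n)) ∧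
      shilovBoundary (symPolydisc n) = symMap n '' shilovBoundary (polydisc n) ∧
      shilovBoundary (polydisc n) = torus n ∧
      shilovBoundary (symPolydisc n) = symMap n '' torus n) ∧
    -- the class: relatively compact subdomains of targets of proper holomorphic maps
    (∀ (n : ℕ) (D G L : Set (Fin n → ℂ)) (f : (Fin n → ℂ) → (Fin n → ℂ)),
      IsDomainSet D → IsDomainSet G → IsProperHolomorphic f D G →
      IsDomainSet L → RelCompactIn L G →
      IsShilovBoundary L (shilovBoundary L) ∧
      IsShilovBoundary (D ∩ f ⁻¹' L) (shilovBoundary (D ∩ f ⁻¹' L)) ∧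
      shilovBoundary L = f '' shilovBoundary (D ∩ f ⁻¹' L)) ∧
    -- the class applies to the tetrablock, in the coordinates `(z₁₁, z₂₂, z₁₂)`
    (IsProperHolomorphic (fun z : Fin 3 → ℂ => tetraMap !![z 0, z 2; z 2, z 1])
        Set.univ Set.univ ∧
      IsDomainSet tetrablock ∧ RelCompactIn tetrablock Set.univ ∧
      (fun z : Fin 3 → ℂ => tetraMap !![z 0, z 2; z 2, z 1]) ⁻¹' tetrablock =
        {z | ‖!![z 0, z 2; z 2, z 1]‖ < 1}) ∧
    -- the class applies to the symmetrized polydisc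
    (∀ n : ℕ,
      IsProperHolomorphic (symMap n) Set.univ Set.univ ∧
      IsDomainSet (symPolydisc n) ∧ RelCompactIn (symPolydisc n) Set.univ ∧
      symMap n ⁻¹' symPolydisc n = polydisc n) := by
  refine ⟨⟨shilovBoundary_tetrablock.1, ?_, ?_, shilovBoundary_cartanII,
    shilovBoundary_tetrablock.2⟩, fun n => ⟨(shilovBoundary_symPolydisc n).1, ?_, ?_,
    shilovBoundary_polydisc n, (shilovBoundary_symPolydisc n).2⟩,
    fun n D G L f hD hG hf hLd hL => shilovBoundary_eq_image hD hG hf hLd hL,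
    ⟨isProperHolomorphic_tetraCoord, isDomainSet_tetrablock, relCompactIn_tetrablock,
      tetraCoord_preimage_tetrablock⟩,
    fun n => ⟨isProperHolomorphic_symMap n, isDomainSet_symPolydisc n,
      relCompactIn_symPolydisc n, symMap_preimage_symPolydisc n⟩⟩
  · rw [shilovBoundary_cartanII]
    exact isShilovBoundary_cartanII
  · rw [shilovBoundary_cartanII]
    exact shilovBoundary_tetrablock.2
  · rw [shilovBoundary_polydisc]
    exact isShilovBoundary_polydisc
  · rw [shilovBoundary_polydisc]
    exact (shilovBoundary_symPolydisc n).2
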